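/- Let $m\ge 0$ and let $M$ be a non-empty smooth ($C^\infty$) manifold of dimension $2m$ with a smooth pseudo-Riemannian metric $g$ of arbitrary signature, with Levi-Civita connection $\nabla$. Let $\phi$ be a smooth real conformal Killing–Yano 2-form on $M$: writing $\tau=d\phi$, there is a 1-form $K$ with $\nabla_X\phi=\frac13\,X\lrcorner\tau+\frac1{2m-1}\,g(X,\cdot)\wedge K$ for all vector fields $X$. Assume that at each point the endomorphism of $T_{\mathbb C}M=\mathbb C\otimes TM$ obtained from $\phi$ by raising an index has $2m$ distinct eigenvalues (so that it is diagonalisable, its eigenvalues come in pairs $\pm\lambda_\mu$, and it is invertible). A null eigenbasis at $x\in M$ is a family of complex vectors $V_\mu,V^\mu$ ($1\le\mu\le m$) in $T_{\mathbb C,x}M$ with $g(V_\mu,V_\nu)=g(V^\mu,V^\nu)=\phi(V_\mu,V_\nu)=\phi(V^\mu,V^\nu)=0$, $g(V_\mu,V^\nu)=\delta_{\mu\nu}$ and $\phi(V_\mu,V^\nu)=\lambda_\mu\delta_{\mu\nu}$ for some $\lambda_\mu\in\mathbb C$. It is a basis; let $\theta^\mu=g(V^\mu,\cdot)$, $\theta_\mu=g(V_\mu,\cdot)$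 be the dual basis. For an open set $U\subseteq M$, a family of eigendistributions on $U$ is a family $(D_s)$, indexed by the $2^m$ choices $s$ of one vector from each pair $\{V_\mu,V^\mu\}$, of smooth complex distributions of rank $m$ on $U$ such that at each $x\in U$ there is a null eigenbasis for which, for every $s$, $D_s(x)$ is spanned by the $m$ vectors chosen by $s$. We say that $\tau$ satisfies condition (T) if at each point, and for each null eigenbasis there, the components of $\tau$ whose three indices do not include a pair $V_\mu,V^\mu$ all vanish; that is, $\tau(A,B,C)=0$ whenever $A,B,C$ are among the $m$ vectors of one and the same choice $s$. (i) Each point of $M$ has an open neighbourhood that carries a family of eigendistributions. (ii) Let a null eigenbasis at a point be given. If $\theta^\mu\wedge\tau(V^\mu,\cdot,\cdot)=0$ and $\theta_\mu\wedge\tau(V_\mu,\cdot,\cdot)=0$ there for each $\mu$ (no summation), then the components of $\tau$ without such a pair vanish in that basis. The same conclusion holds if $\phi$ is closed, and it holds if $\dim M=4$. (iii) Assume (T). Let $(D_s)$ be a family of eigendistributions on an open set $U\subseteq M$. Then the $2^m$ subspaces $D_s(x)$ are pairwise distinct at each $x\in U$, each $D_s$ is maximal isotropic ($g$ vanishes on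 it, and it has rank $m$), and each $D_s$ is integrable, $[D_s,D_s]\subseteq D_s$. (iv) Assume (T) and that $g$ is positive definite. Then there is a family of eigendistributions on all of $M$. For every family of eigendistributions on an open set $U$, each $D_s$ is the $(1,0)$-tangent bundle (the $+i$-eigenbundle) of a Hermitian complex structure $J_s$ on $U$, that is, of a smooth $g$-orthogonal almost complex structure with vanishing Nijenhuis tensor, and these $2^m$ structures are pairwise distinct at each point of $U$. (v) Assume (T) and that $g$ is Lorentzian. Then there are two smooth fields of real null lines $L_+,L_-$ on $M$, distinct at each point, that are tangent to geodesic congruences (every local section $k$ satisfies $\nabla_kk\in L_\pm$), with the following property. There is a family of eigendistributions on all of $M$ such that for each of the two signs exactly $2^{m-1}$ of the $D_s$ have $D_s\cap\overline{D_s}=\mathbb C\otimes L_\pm$ at every point of $M$. Moreover, for every family of eigendistributions on an open set $U$, for each of the two signs exactly $2^{m-1}$ of the $D_s$ satisfy this at any given point of $U$, and, if $U$ is connected and non-empty, exactly $2^{m-1}$ of them satisfy it at all points of $U$ simultaneously. -/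

import Mathlib

open Set Filter Topology Manifold Bundle Module
open scoped ContDiff TensorProduct

noncomputable section

namespace CKY

set_option linter.unusedSectionVars false

section Tensors

variable (n : ℕ) (M : Type*) [TopologicalSpace M]
  [ChartedSpace (EuclideanSpace ℝ (Fin n)) M] [IsManifold (𝓡 n) ∞ M]

/-- A smooth pseudo-Riemannian metric (of arbitrary signature) on a smooth `n`-manifold. -/
structure PseudoRiemannianMetric where
  val (x : M) : TangentSpace (𝓡 n) x →L[ℝ] TangentSpace (𝓡 n) x →L[ℝ] ℝ
  symm (x : M) (v w : TangentSpace (𝓡 n) x) : val x v w = val x w v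
  nondegenerate (x : M) (v : TangentSpace (𝓡 n) x) (hv : ∀ w, val x v w = 0) : v = 0
  contMDiff : ContMDiff (𝓡 n)
    ((𝓡 n).prod 𝓘(ℝ, EuclideanSpace ℝ (Fin n) →L[ℝ] EuclideanSpace ℝ (Fin n) →L[ℝ] ℝ)) ∞
    (fun x => TotalSpace.mk'
      (EuclideanSpace ℝ (Fin n) →L[ℝ] EuclideanSpace ℝ (Fin n) →L[ℝ] ℝ) x (val x))

/-- A smooth (real) differential `2`-form on a smooth `n`-manifold. -/
structure TwoForm where
  val (x : M) : TangentSpace (𝓡 n) x →L[ℝ] TangentSpace (𝓡 n) x →L[ℝ] ℝ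
  skew (x : M) (v w : TangentSpace (𝓡 n) x) : val x v w = - val x w v
  contMDiff : ContMDiff (𝓡 n)
    ((𝓡 n).prod 𝓘(ℝ, EuclideanSpace ℝ (Fin n) →L[ℝ] EuclideanSpace ℝ (Fin n) →L[ℝ] ℝ)) ∞
    (fun x => TotalSpace.mk'
      (EuclideanSpace ℝ (Fin n) →L[ℝ] EuclideanSpace ℝ (Fin n) →L[ℝ] ℝ) x (val x))

end Tensors

section Calculus

variable {n : ℕ} {M : Type*} [TopologicalSpace M]
  [ChartedSpace (EuclideanSpace ℝ (Fin n)) M] [IsManifold (𝓡 n) ∞ M]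

/-- The vector field `X` is smooth on the set `U`. -/
def SmoothFieldOn (X : Π x : M, TangentSpace (𝓡 n) x) (U : Set M) : Prop :=
  ContMDiffOn (𝓡 n) ((𝓡 n).prod 𝓘(ℝ, EuclideanSpace ℝ (Fin n))) ∞
    (fun x => TotalSpace.mk' (EuclideanSpace ℝ (Fin n)) x (X x)) U

/-- The vector field `X` is differentiable at the point `x`. -/
def DiffFieldAt (X : Π x : M, TangentSpace (𝓡 n) x) (x : M) : Prop :=
  MDifferentiableAt (𝓡 n) ((𝓡 n).prod 𝓘(ℝ, EuclideanSpace ℝ (Fin n)))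
    (fun x => TotalSpace.mk' (EuclideanSpace ℝ (Fin n)) x (X x)) x

/-- The derivative `X f` of a function along a vector field. -/
def dirDeriv (X : Π x : M, TangentSpace (𝓡 n) x) (f : M → ℝ) (x : M) : ℝ :=
  mvfderiv (𝓡 n) f x (X x)

/-- The Koszul expression, which equals `g (∇_X Y, Z)` at `x`. -/
def koszul (g : PseudoRiemannianMetric n M) (X Y Z : Π x : M, TangentSpace (𝓡 n) x)
    (x : M) : ℝ :=
  (1 / 2) * (dirDeriv X (fun y => g.val y (Y y) (Z y)) x
    + dirDeriv Y (fun y => g.val y (X y) (Z y)) x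
    - dirDeriv Z (fun y => g.val y (X y) (Y y)) x
    + g.val x (VectorField.mlieBracket (𝓡 n) X Y x) (Z x)
    - g.val x (VectorField.mlieBracket (𝓡 n) X Z x) (Y x)
    - g.val x (VectorField.mlieBracket (𝓡 n) Y Z x) (X x))

open Classical in
/-- The Levi-Civita connection: `(∇_X Y)(x)` is the unique tangent vector `w` at `x` such that
`g (w, Z) = koszul g X Y Z` at `x` for every vector field `Z` that is differentiable at `x`. For `X`, `Y`
differentiable at `x` it exists, see `leviCivita_spec` and `leviCivita_unique`. -/
def leviCivita (g : PseudoRiemannianMetric n M) (X Y : Π x : M, TangentSpace (𝓡 n) x)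
    (x : M) : TangentSpace (𝓡 n) x :=
  if h : ∃ w : TangentSpace (𝓡 n) x, ∀ Z : Π x : M, TangentSpace (𝓡 n) x,
      DiffFieldAt Z x → g.val x w (Z x) = koszul g X Y Z x
  then h.choose else 0

/-- The covariant derivative `(∇_X φ)(Y, Z)` of a `2`-form. -/
def covDeriv (g : PseudoRiemannianMetric n M) (φ : TwoForm n M)
    (X Y Z : Π x : M, TangentSpace (𝓡 n) x) (x : M) : ℝ :=
  dirDeriv X (fun y => φ.val y (Y y) (Z y)) x
    - φ.val x (leviCivita g X Y x) (Z x) - φ.val x (Y x) (leviCivita g X Z x)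

/-- Cartan's formula for `(dφ)(X, Y, Z)` on vector fields. -/
def cartan (φ : TwoForm n M) (X Y Z : Π x : M, TangentSpace (𝓡 n) x) (x : M) : ℝ :=
  dirDeriv X (fun y => φ.val y (Y y) (Z y)) x
    - dirDeriv Y (fun y => φ.val y (X y) (Z y)) x
    + dirDeriv Z (fun y => φ.val y (X y) (Y y)) x
    - φ.val x (VectorField.mlieBracket (𝓡 n) X Y x) (Z x)
    + φ.val x (VectorField.mlieBracket (𝓡 n) X Z x) (Y x)
    - φ.val x (VectorField.mlieBracket (𝓡 n) Y Z x) (X x)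

/-- The exterior derivative `τ = dφ` on tangent vectors at `x`, computed by Cartan's formula on
extensions of the vectors to smooth vector fields near `x`; the choice of the extensions does not
matter, see `extDeriv_eq_cartan`. -/
def extDeriv (φ : TwoForm n M) (x : M) (u v w : TangentSpace (𝓡 n) x) : ℝ :=
  cartan φ (FiberBundle.extend (EuclideanSpace ℝ (Fin n)) u)
    (FiberBundle.extend (EuclideanSpace ℝ (Fin n)) v)
    (FiberBundle.extend (EuclideanSpace ℝ (Fin n)) w) x

theorem mdiff_bilin
    {B : Π x : M, TangentSpace (𝓡 n) x →L[ℝ] TangentSpace (𝓡 n) x →L[ℝ] ℝ}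
    (hB : ContMDiff (𝓡 n)
      ((𝓡 n).prod 𝓘(ℝ, EuclideanSpace ℝ (Fin n) →L[ℝ] EuclideanSpace ℝ (Fin n) →L[ℝ] ℝ)) ∞
      (fun x => TotalSpace.mk'
        (EuclideanSpace ℝ (Fin n) →L[ℝ] EuclideanSpace ℝ (Fin n) →L[ℝ] ℝ) x (B x)))
    {X Y : Π x : M, TangentSpace (𝓡 n) x} {x : M}
    (hX : DiffFieldAt X x) (hY : DiffFieldAt Y x) :
    MDifferentiableAt (𝓡 n) 𝓘(ℝ, ℝ) (fun y => B y (X y) (Y y)) x := by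
  have : MDifferentiableAt (𝓡 n) ((𝓡 n).prod 𝓘(ℝ, ℝ))
      (fun m ↦ TotalSpace.mk' ℝ (E := Bundle.Trivial M ℝ) m (B m (X m) (Y m))) x := by
    apply MDifferentiableAt.clm_bundle_apply₂ (F₁ := EuclideanSpace ℝ (Fin n))
      (F₂ := EuclideanSpace ℝ (Fin n))
    · exact hB.mdifferentiableAt (by simp)
    · exact hX
    · exact hY
  simp only [mdifferentiableAt_totalSpace] at this
  exact this.2

theorem dirDeriv_add (X : Π x : M, TangentSpace (𝓡 n) x) {f f' : M → ℝ} {x : M}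
    (hf : MDifferentiableAt (𝓡 n) 𝓘(ℝ, ℝ) f x) (hf' : MDifferentiableAt (𝓡 n) 𝓘(ℝ, ℝ) f' x) :
    dirDeriv X (fun y => f y + f' y) x = dirDeriv X f x + dirDeriv X f' x := by
  have := mvfderiv_add hf hf'
  simp only [dirDeriv]
  rw [show (fun y => f y + f' y) = f + f' from rfl, this]
  rfl

theorem dirDeriv_mul (X : Π x : M, TangentSpace (𝓡 n) x) {f f' : M → ℝ} {x : M}
    (hf : MDifferentiableAt (𝓡 n) 𝓘(ℝ, ℝ) f x) (hf' : MDifferentiableAt (𝓡 n) 𝓘(ℝ, ℝ) f' x) :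
    dirDeriv X (fun y => f y * f' y) x
      = dirDeriv X f x * f' x + f x * dirDeriv X f' x := by
  have := mvfderiv_mul hf hf'
  simp only [dirDeriv]
  rw [show (fun y => f y * f' y) = f * f' from rfl, this]
  simp [mul_comm, add_comm]

theorem dirDeriv_neg (X : Π x : M, TangentSpace (𝓡 n) x) (f : M → ℝ) (x : M) :
    dirDeriv X (fun y => - f y) x = - dirDeriv X f x := by
  simp only [dirDeriv]
  rw [show (fun y => - f y) = -f from rfl, mvfderiv_neg]
  rfl

theorem koszul_tensorial (g : PseudoRiemannianMetric n M)
    {X Y : Π x : M, TangentSpace (𝓡 n) x} {x : M}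
    (hX : DiffFieldAt X x) (hY : DiffFieldAt Y x) :
    TensorialAt (𝓡 n) (EuclideanSpace ℝ (Fin n)) (fun Z => koszul g X Y Z x) x where
  smul {f Z} hf hZ := by
    have h1 := dirDeriv_mul X hf (mdiff_bilin g.contMDiff hY hZ)
    have h2 := dirDeriv_mul Y hf (mdiff_bilin g.contMDiff hX hZ)
    have h3 := VectorField.mlieBracket_smul_right (V := X) hf hZ
    have h4 := VectorField.mlieBracket_smul_right (V := Y) hf hZ
    simp only [koszul, Pi.smul_apply', map_smul, smul_eq_mul, h1, h2, h3, h4]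
    simp [dirDeriv, g.symm x (Z x)]
    ring
  add {Z Z'} hZ hZ' := by
    have h1 := dirDeriv_add X (mdiff_bilin g.contMDiff hY hZ) (mdiff_bilin g.contMDiff hY hZ')
    have h2 := dirDeriv_add Y (mdiff_bilin g.contMDiff hX hZ) (mdiff_bilin g.contMDiff hX hZ')
    have h3 := VectorField.mlieBracket_add_right (V := X) hZ hZ'
    have h4 := VectorField.mlieBracket_add_right (V := Y) hZ hZ'
    simp only [koszul, Pi.add_apply, map_add, h1, h2, h3, h4]
    simp [dirDeriv]
    ring

theorem leviCivita_exists (g : PseudoRiemannianMetric n M)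
    {X Y : Π x : M, TangentSpace (𝓡 n) x} {x : M}
    (hX : DiffFieldAt X x) (hY : DiffFieldAt Y x) :
    ∃ w : TangentSpace (𝓡 n) x, ∀ Z : Π x : M, TangentSpace (𝓡 n) x,
      DiffFieldAt Z x → g.val x w (Z x) = koszul g X Y Z x := by
  let L : TangentSpace (𝓡 n) x →L[ℝ] ℝ :=
    TensorialAt.mkHom (fun Z => koszul g X Y Z x) x (koszul_tensorial g hX hY)
  have : FiniteDimensional ℝ (TangentSpace (𝓡 n) x) :=
    inferInstanceAs (FiniteDimensional ℝ (EuclideanSpace ℝ (Fin n)))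
  let B : LinearMap.BilinForm ℝ (TangentSpace (𝓡 n) x) := (g.val x).toBilinForm
  have hB : B.Nondegenerate := by
    have hr : B.IsRefl := fun v w h => by
      have := g.symm x v w
      simp_all [B]
    exact (LinearMap.IsRefl.nondegenerate_iff_separatingLeft hr).2
      (fun v hv => g.nondegenerate x v hv)
  refine ⟨(B.toDual hB).symm L.toLinearMap, fun Z hZ => ?_⟩
  have h := LinearMap.BilinForm.apply_toDual_symm_apply (hB := hB) L.toLinearMap (Z x)
  have h2 : L (Z x) = koszul g X Y Z x := TensorialAt.mkHom_apply _ hZ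
  rw [← h2]
  exact h

theorem leviCivita_spec (g : PseudoRiemannianMetric n M)
    {X Y Z : Π x : M, TangentSpace (𝓡 n) x} {x : M}
    (hX : DiffFieldAt X x) (hY : DiffFieldAt Y x) (hZ : DiffFieldAt Z x) :
    g.val x (leviCivita g X Y x) (Z x) = koszul g X Y Z x := by
  have h := leviCivita_exists g hX hY
  rw [leviCivita, dif_pos h]
  exact h.choose_spec Z hZ

theorem leviCivita_unique (g : PseudoRiemannianMetric n M)
    {X Y : Π x : M, TangentSpace (𝓡 n) x} {x : M}
    (hX : DiffFieldAt X x) (hY : DiffFieldAt Y x) (w : TangentSpace (𝓡 n) x)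
    (hw : ∀ Z : Π x : M, TangentSpace (𝓡 n) x,
      DiffFieldAt Z x → g.val x w (Z x) = koszul g X Y Z x) :
    w = leviCivita g X Y x := by
  rw [← sub_eq_zero]
  refine g.nondegenerate x _ fun v => ?_
  have hv : DiffFieldAt (FiberBundle.extend (EuclideanSpace ℝ (Fin n)) v) x :=
    FiberBundle.mdifferentiableAt_extend (𝓡 n) (EuclideanSpace ℝ (Fin n)) v
  have h1 := hw _ hv
  have h2 := leviCivita_spec g hX hY hv
  rw [FiberBundle.extend_apply_self] at h1 h2
  simp [h1, h2]

theorem cartan_swap₁₂ (φ : TwoForm n M) (X Y Z : Π x : M, TangentSpace (𝓡 n) x) (x : M) :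
    cartan φ X Y Z x = - cartan φ Y X Z x := by
  have h : (fun y => φ.val y (X y) (Y y)) = fun y => -(φ.val y (Y y) (X y)) :=
    funext fun y => φ.skew y _ _
  simp only [cartan]
  rw [h, dirDeriv_neg, VectorField.mlieBracket_swap_apply (V := Y) (W := X)]
  simp
  ring

theorem cartan_swap₂₃ (φ : TwoForm n M) (X Y Z : Π x : M, TangentSpace (𝓡 n) x) (x : M) :
    cartan φ X Y Z x = - cartan φ X Z Y x := by
  have h : (fun y => φ.val y (Y y) (Z y)) = fun y => -(φ.val y (Z y) (Y y)) :=
    funext fun y => φ.skew y _ _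
  simp only [cartan]
  rw [h, dirDeriv_neg, VectorField.mlieBracket_swap_apply (V := Z) (W := Y)]
  simp
  ring

theorem cartan_tensorial (φ : TwoForm n M)
    {X Y : Π x : M, TangentSpace (𝓡 n) x} {x : M}
    (hX : DiffFieldAt X x) (hY : DiffFieldAt Y x) :
    TensorialAt (𝓡 n) (EuclideanSpace ℝ (Fin n)) (fun Z => cartan φ X Y Z x) x where
  smul {f Z} hf hZ := by
    have h1 := dirDeriv_mul X hf (mdiff_bilin φ.contMDiff hY hZ)
    have h2 := dirDeriv_mul Y hf (mdiff_bilin φ.contMDiff hX hZ)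
    have h3 := VectorField.mlieBracket_smul_right (V := X) hf hZ
    have h4 := VectorField.mlieBracket_smul_right (V := Y) hf hZ
    simp only [cartan, Pi.smul_apply', map_smul, smul_eq_mul, h1, h2, h3, h4]
    simp [dirDeriv, φ.skew x (Z x)]
    ring
  add {Z Z'} hZ hZ' := by
    have h1 := dirDeriv_add X (mdiff_bilin φ.contMDiff hY hZ) (mdiff_bilin φ.contMDiff hY hZ')
    have h2 := dirDeriv_add Y (mdiff_bilin φ.contMDiff hX hZ) (mdiff_bilin φ.contMDiff hX hZ')
    have h3 := VectorField.mlieBracket_add_right (V := X) hZ hZ'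
    have h4 := VectorField.mlieBracket_add_right (V := Y) hZ hZ'
    simp only [cartan, Pi.add_apply, map_add, h1, h2, h3, h4]
    simp [dirDeriv]
    ring

theorem extDeriv_eq_cartan (φ : TwoForm n M)
    {X Y Z : Π x : M, TangentSpace (𝓡 n) x} {x : M}
    (hX : DiffFieldAt X x) (hY : DiffFieldAt Y x) (hZ : DiffFieldAt Z x) :
    extDeriv φ x (X x) (Y x) (Z x) = cartan φ X Y Z x := by
  have hX' : DiffFieldAt (FiberBundle.extend (EuclideanSpace ℝ (Fin n)) (X x)) x :=
    FiberBundle.mdifferentiableAt_extend (𝓡 n) (EuclideanSpace ℝ (Fin n)) (X x)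
  have hY' : DiffFieldAt (FiberBundle.extend (EuclideanSpace ℝ (Fin n)) (Y x)) x :=
    FiberBundle.mdifferentiableAt_extend (𝓡 n) (EuclideanSpace ℝ (Fin n)) (Y x)
  have hZ' : DiffFieldAt (FiberBundle.extend (EuclideanSpace ℝ (Fin n)) (Z x)) x :=
    FiberBundle.mdifferentiableAt_extend (𝓡 n) (EuclideanSpace ℝ (Fin n)) (Z x)
  rw [extDeriv, (cartan_tensorial φ hX' hY').pointwise hZ' hZ (by simp), cartan_swap₂₃,
    (cartan_tensorial φ hX' hZ).pointwise hY' hY (by simp), cartan_swap₁₂,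
    cartan_swap₂₃, (cartan_tensorial φ hZ hY).pointwise hX' hX (by simp),
    cartan_swap₂₃ φ X Y Z, cartan_swap₁₂ φ X Z Y, cartan_swap₂₃ φ Z X Y]

end Calculus

section Complexification

variable {V : Type*} [AddCommGroup V] [Module ℝ V]

/-- The real part `ℂ ⊗ V → V`, `z ⊗ v ↦ (re z) v`. -/
def cre : ℂ ⊗[ℝ] V →ₗ[ℝ] V := (TensorProduct.lid ℝ V).toLinearMap ∘ₗ Complex.reLm.rTensor V

/-- The imaginary part `ℂ ⊗ V → V`, `z ⊗ v ↦ (im z) v`. -/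
def cim : ℂ ⊗[ℝ] V →ₗ[ℝ] V := (TensorProduct.lid ℝ V).toLinearMap ∘ₗ Complex.imLm.rTensor V

/-- The complex vector `a + i b`. -/
def cmk (a b : V) : ℂ ⊗[ℝ] V := (1 : ℂ) ⊗ₜ[ℝ] a + Complex.I ⊗ₜ[ℝ] b

/-- The complex-trilinear extension of a real trilinear form to `ℂ ⊗ V`. -/
def cext₃ (T : V → V → V → ℝ) (A B C : ℂ ⊗[ℝ] V) : ℂ :=
  ⟨T (cre A) (cre B) (cre C) - T (cre A) (cim B) (cim C)
      - T (cim A) (cre B) (cim C) - T (cim A) (cim B) (cre C),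
    T (cim A) (cre B) (cre C) + T (cre A) (cim B) (cre C)
      + T (cre A) (cre B) (cim C) - T (cim A) (cim B) (cim C)⟩

/-- The real vectors `k ∈ V` lying in a complex subspace `D ⊆ ℂ ⊗ V`; they form the real subspace
whose complexification is `D ∩ conj D`. -/
def realPoints (D : Submodule ℂ (ℂ ⊗[ℝ] V)) : Submodule ℝ V :=
  (D.restrictScalars ℝ).comap (TensorProduct.mk ℝ ℂ V 1)

end Complexification

section Geometry

variable {n : ℕ} {M : Type*} [TopologicalSpace M]
  [ChartedSpace (EuclideanSpace ℝ (Fin n)) M] [IsManifold (𝓡 n) ∞ M]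

/-- The metric is positive definite. -/
def PseudoRiemannianMetric.IsRiemannian (g : PseudoRiemannianMetric n M) : Prop :=
  ∀ (x : M) (v : TangentSpace (𝓡 n) x), v ≠ 0 → 0 < g.val x v v

/-- The metric has Lorentzian signature (in either sign convention): at each point there is a
vector `t` with `g (t, t) ≠ 0` such that `g` is definite, of the sign opposite to that of
`g (t, t)`, on the orthogonal complement of `t`. -/
def PseudoRiemannianMetric.IsLorentzian (g : PseudoRiemannianMetric n M) : Prop :=
  ∀ x : M, ∃ t : TangentSpace (𝓡 n) x, g.val x t t ≠ 0 ∧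
    ∀ v : TangentSpace (𝓡 n) x, v ≠ 0 → g.val x t v = 0 → g.val x t t * g.val x v v < 0

/-- The metric, extended complex-bilinearly to `ℂ ⊗ T_x M`. -/
def PseudoRiemannianMetric.cval (g : PseudoRiemannianMetric n M) (x : M) :
    LinearMap.BilinForm ℂ (ℂ ⊗[ℝ] TangentSpace (𝓡 n) x) :=
  LinearMap.BilinForm.baseChange ℂ (g.val x).toBilinForm

/-- The `2`-form, extended complex-bilinearly to `ℂ ⊗ T_x M`. -/
def TwoForm.cval (φ : TwoForm n M) (x : M) :
    LinearMap.BilinForm ℂ (ℂ ⊗[ℝ] TangentSpace (𝓡 n) x) :=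
  LinearMap.BilinForm.baseChange ℂ (φ.val x).toBilinForm

/-- The `2`-form `φ` is conformal Killing-Yano: there is a `1`-form `K` such that
`∇_X φ = (1/3) X ⌟ dφ + (1/(n-1)) X^* ∧ K` for all (locally defined) smooth vector fields `X`. -/
def IsConformalKillingYano (g : PseudoRiemannianMetric n M) (φ : TwoForm n M) : Prop :=
  ∃ K : Π x : M, TangentSpace (𝓡 n) x →ₗ[ℝ] ℝ,
    ∀ U : Set M, IsOpen U → ∀ X Y Z : Π x : M, TangentSpace (𝓡 n) x,
      SmoothFieldOn X U → SmoothFieldOn Y U → SmoothFieldOn Z U → ∀ x ∈ U,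
        covDeriv g φ X Y Z x = (1 / 3) * extDeriv φ x (X x) (Y x) (Z x)
          + (1 / ((n : ℝ) - 1)) *
            (g.val x (X x) (Y x) * K x (Z x) - g.val x (X x) (Z x) * K x (Y x))

/-- The (complex) eigenvalues at `x` of the endomorphism of `ℂ ⊗ T_x M` obtained from `φ` by
raising an index with the metric: the `z` for which there is `l ≠ 0` with
`φ (·, l) = z g (·, l)`. -/
def eigenvalues (g : PseudoRiemannianMetric n M) (φ : TwoForm n M) (x : M) : Set ℂ :=
  {z | ∃ l : ℂ ⊗[ℝ] TangentSpace (𝓡 n) x, l ≠ 0 ∧ ∀ A, φ.cval x A l = z * g.cval x A l}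

/-- The complex vector field `Z` is smooth on `U`. -/
def SmoothCFieldOn (Z : Π x : M, ℂ ⊗[ℝ] TangentSpace (𝓡 n) x) (U : Set M) : Prop :=
  SmoothFieldOn (fun x => cre (Z x)) U ∧ SmoothFieldOn (fun x => cim (Z x)) U

/-- The Lie bracket, extended complex-bilinearly to complex vector fields. -/
def cbracket (Z W : Π x : M, ℂ ⊗[ℝ] TangentSpace (𝓡 n) x) (x : M) :
    ℂ ⊗[ℝ] TangentSpace (𝓡 n) x :=
  cmk (VectorField.mlieBracket (𝓡 n) (fun y => cre (Z y)) (fun y => cre (W y)) x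
      - VectorField.mlieBracket (𝓡 n) (fun y => cim (Z y)) (fun y => cim (W y)) x)
    (VectorField.mlieBracket (𝓡 n) (fun y => cre (Z y)) (fun y => cim (W y)) x
      + VectorField.mlieBracket (𝓡 n) (fun y => cim (Z y)) (fun y => cre (W y)) x)

/-- `D` is a smooth distribution of complex rank `k` on `U`: it is locally spanned by smooth,
pointwise linearly independent complex vector fields `Z 0, …, Z (k-1)`. -/
def IsSmoothDistribution (D : Π x : M, Submodule ℂ (ℂ ⊗[ℝ] TangentSpace (𝓡 n) x)) (k : ℕ)
    (U : Set M) : Prop :=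
  ∀ p ∈ U, ∃ V : Set M, IsOpen V ∧ p ∈ V ∧ V ⊆ U ∧
    ∃ Z : Fin k → Π x : M, ℂ ⊗[ℝ] TangentSpace (𝓡 n) x, (∀ i, SmoothCFieldOn (Z i) V) ∧
      ∀ x ∈ V, LinearIndependent ℂ (fun i => Z i x) ∧
        D x = Submodule.span ℂ (Set.range fun i => Z i x)

/-- Frobenius integrability `[D, D] ⊆ D` of a complex distribution on `U`. -/
def IsIntegrable (D : Π x : M, Submodule ℂ (ℂ ⊗[ℝ] TangentSpace (𝓡 n) x)) (U : Set M) : Prop :=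
  ∀ V : Set M, IsOpen V → V ⊆ U → ∀ Z W : Π x : M, ℂ ⊗[ℝ] TangentSpace (𝓡 n) x,
    SmoothCFieldOn Z V → SmoothCFieldOn W V → (∀ x ∈ V, Z x ∈ D x) → (∀ x ∈ V, W x ∈ D x) →
      ∀ x ∈ V, cbracket Z W x ∈ D x

/-- `J` is a Hermitian complex structure on `U`: a smooth, `g`-orthogonal almost complex structure
whose Nijenhuis tensor vanishes. -/
structure IsHermitianStructure (g : PseudoRiemannianMetric n M)
    (J : Π x : M, TangentSpace (𝓡 n) x →ₗ[ℝ] TangentSpace (𝓡 n) x) (U : Set M) : Prop where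
  sq : ∀ x ∈ U, ∀ v, J x (J x v) = -v
  orthogonal : ∀ x ∈ U, ∀ v w, g.val x (J x v) (J x w) = g.val x v w
  smooth : ∀ V : Set M, IsOpen V → V ⊆ U → ∀ X : Π x : M, TangentSpace (𝓡 n) x,
    SmoothFieldOn X V → SmoothFieldOn (fun x => J x (X x)) V
  nijenhuis : ∀ V : Set M, IsOpen V → V ⊆ U → ∀ X Y : Π x : M, TangentSpace (𝓡 n) x,
    SmoothFieldOn X V → SmoothFieldOn Y V → ∀ x ∈ V,
      VectorField.mlieBracket (𝓡 n) (fun y => J y (X y)) (fun y => J y (Y y)) x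
        - J x (VectorField.mlieBracket (𝓡 n) (fun y => J y (X y)) Y x)
        - J x (VectorField.mlieBracket (𝓡 n) X (fun y => J y (Y y)) x)
        - VectorField.mlieBracket (𝓡 n) X Y x = 0

/-- `L` is (the field of tangent lines of) a smooth geodesic null congruence on `M`: a smooth field
of null lines such that `∇_k k` is proportional to `k` for all local sections `k`, i.e. such that
the integral curves of `L` are geodesics up to parametrisation. -/
structure IsGeodesicNullCongruence (g : PseudoRiemannianMetric n M)
    (L : Π x : M, Submodule ℝ (TangentSpace (𝓡 n) x)) : Prop where
  smooth : ∀ p : M, ∃ V : Set M, IsOpen V ∧ p ∈ V ∧ ∃ k : Π x : M, TangentSpace (𝓡 n) x,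
    SmoothFieldOn k V ∧ ∀ x ∈ V, k x ≠ 0 ∧ L x = Submodule.span ℝ {k x}
  null : ∀ x, ∀ k ∈ L x, g.val x k k = 0
  geodesic : ∀ V : Set M, IsOpen V → ∀ k : Π x : M, TangentSpace (𝓡 n) x,
    SmoothFieldOn k V → (∀ x ∈ V, k x ∈ L x) → ∀ x ∈ V, leviCivita g k k x ∈ L x

end Geometry

section Eigendistributions

variable {m : ℕ} {M : Type*} [TopologicalSpace M]
  [ChartedSpace (EuclideanSpace ℝ (Fin (2 * m))) M] [IsManifold (𝓡 (2 * m)) ∞ M]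

/-- The `2m` complex vectors `v μ = V_μ`, `w μ = V^μ` at `x` form a null basis putting `φ` into
normal form: if `θ^μ`, `θ_μ` is the dual basis then `g = ∑ (θ^μ ⊗ θ_μ + θ_μ ⊗ θ^μ)` and
`φ = ∑ lam_μ θ^μ ∧ θ_μ`. (That the `2m` vectors are a basis follows from the values of `g`; the
dual basis is `θ^μ = g (V^μ, ·)`, `θ_μ = g (V_μ, ·)`.) -/
structure IsNullEigenbasis (g : PseudoRiemannianMetric (2 * m) M) (φ : TwoForm (2 * m) M) (x : M)
    (v w : Fin m → ℂ ⊗[ℝ] TangentSpace (𝓡 (2 * m)) x) (lam : Fin m → ℂ) : Prop where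
  g_vv : ∀ μ ν, g.cval x (v μ) (v ν) = 0
  g_ww : ∀ μ ν, g.cval x (w μ) (w ν) = 0
  g_vw : ∀ μ ν, g.cval x (v μ) (w ν) = if μ = ν then 1 else 0
  φ_vv : ∀ μ ν, φ.cval x (v μ) (v ν) = 0
  φ_ww : ∀ μ ν, φ.cval x (w μ) (w ν) = 0
  φ_vw : ∀ μ ν, φ.cval x (v μ) (w ν) = if μ = ν then lam μ else 0

/-- The choice of one vector from each pair `(v μ, w μ)` that is encoded by `s`. -/
def pick {x : M} (v w : Fin m → ℂ ⊗[ℝ] TangentSpace (𝓡 (2 * m)) x) (s : Fin m → Bool)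
    (μ : Fin m) : ℂ ⊗[ℝ] TangentSpace (𝓡 (2 * m)) x :=
  if s μ then v μ else w μ

/-- `D` is the family, indexed by `s : Fin m → Bool`, of the `2^m` distributions on `U` associated
to `φ`: each of them is smooth of rank `m`, and at each point `x` of `U` they are spanned by the
`2^m` choices of one vector from each pair of a null eigenbasis. -/
def IsEigendistributionFamily (g : PseudoRiemannianMetric (2 * m) M) (φ : TwoForm (2 * m) M)
    (U : Set M)
    (D : (Fin m → Bool) → Π x : M, Submodule ℂ (ℂ ⊗[ℝ] TangentSpace (𝓡 (2 * m)) x)) : Prop :=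
  (∀ s, IsSmoothDistribution (D s) m U) ∧
    ∀ x ∈ U, ∃ v w lam, IsNullEigenbasis g φ x v w lam ∧
      ∀ s, D s x = Submodule.span ℂ (Set.range (pick v w s))

/-- The components of `τ = dφ` at `x` in the null basis `v`, `w` vanish, except possibly those
whose indices include a pair `v μ`, `w μ`. Equivalently, `τ` restricts to zero on each of the `2^m`
subspaces spanned by one vector from each pair. -/
def TauComponentsVanish (φ : TwoForm (2 * m) M) (x : M)
    (v w : Fin m → ℂ ⊗[ℝ] TangentSpace (𝓡 (2 * m)) x) : Prop :=
  ∀ (s : Fin m → Bool) (κ μ ν : Fin m),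
    cext₃ (extDeriv φ x) (pick v w s κ) (pick v w s μ) (pick v w s ν) = 0

/-- The `3`-form `a ∧ τ (k, ·, ·)` vanishes at `x`, where `a = g (k, ·)`. -/
def WedgeContractionVanish (g : PseudoRiemannianMetric (2 * m) M) (φ : TwoForm (2 * m) M) (x : M)
    (k : ℂ ⊗[ℝ] TangentSpace (𝓡 (2 * m)) x) : Prop :=
  ∀ A B C : ℂ ⊗[ℝ] TangentSpace (𝓡 (2 * m)) x,
    g.cval x k A * cext₃ (extDeriv φ x) k B C + g.cval x k B * cext₃ (extDeriv φ x) k C A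
      + g.cval x k C * cext₃ (extDeriv φ x) k A B = 0

end Eigendistributions

end CKY

end

/-! Pointwise, skewness of `φ` gives `(z + y) g(l, k) = 0` for eigenvectors `l`, `k` with
eigenvalues `z`, `y`. With `2m` distinct eigenvalues the eigenvectors form a basis, so nondegeneracy
of `g` pairs each eigenline with that of the opposite eigenvalue. This yields null eigenbases
(`exists_nullEigen`), in which `w μ` belongs to `lam μ` and `v μ` to `-lam μ`. One vector from each
pair spans a subspace equal to its own orthogonal complement, and no two of its eigenvalues, nor one
taken twice, sum to zero. Since the eigenvalues are simple, the implicit function theorem makes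
eigenvectors locally smooth (`exists_smooth_eigenpair`).

Integrability rests on `IsConformalKillingYano.cnabla_mem`. For sections `X`, `A`, `C` of such a
`D`, differentiate `g(A, C) = 0` and `φ(A, C) = 0` along `X`. In the second relation the conformal
Killing-Yano right-hand side drops out, because `g` and `τ` vanish on `D`. If `A` and `C` are
eigenvectors at the point, with eigenvalues `z` and `y`, the two relations combine to `(z + y) g(A,
∇_X C) = 0`. So `∇_X` maps sections of `D` into the orthogonal complement of `D`, which is `D`, and
torsion-freeness gives `[D, D] ⊆ D`.

A family on all of `M` needs a coherent enumeration of half of the spectrum. In definite and in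
Lorentzian signature the eigenvalues lie on the two coordinate axes of `ℂ`; those with `re + im >
0`, sorted by `im - re`, are enumerated in exactly one way, and this normalisation is an open
condition (`exists_global_family`).

If `g` is positive definite, `D` contains no nonzero purely imaginary vector, so taking real parts
identifies `D` with the tangent space and defines `J`; the Nijenhuis tensor vanishes because `D` is
integrable. If `g` is Lorentzian, real isotropic subspaces are at most lines. Hence a non-imaginary
eigenvalue is real with a real null eigenvector, at most one is positive, and a sign argument on
norms shows that one exists. The eigenlines of `r` and `-r` are the two congruences. Which of them
lies in `D_s` depends only on the choice that `s` makes in the pair of `±r`, which gives the count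
`2^(m-1)`; geodesy is `∇_k k ∈ D` for a real section `k`. On a connected set the line cannot change,
since containing one line means omitting the other and omission is open
(`IsEigendistributionFamily.realPoints_constant`). -/

noncomputable section

namespace CKY

set_option linter.unusedSectionVars false

/-! ### Linear algebra of null eigenbases. -/

section NullEigen

variable {W : Type*} [AddCommGroup W] [Module ℂ W] [FiniteDimensional ℂ W] {m : ℕ}

/-- `v`, `w` is a null basis for the bilinear form `B` in which the skew form `Ω` has normal form
with eigenvalues `lam`. -/
structure NullEigen (B Ω : LinearMap.BilinForm ℂ W) (v w : Fin m → W) (lam : Fin m → ℂ) :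
    Prop where
  vv : ∀ μ ν, B (v μ) (v ν) = 0
  ww : ∀ μ ν, B (w μ) (w ν) = 0
  vw : ∀ μ ν, B (v μ) (w ν) = if μ = ν then 1 else 0
  Ωvv : ∀ μ ν, Ω (v μ) (v ν) = 0
  Ωww : ∀ μ ν, Ω (w μ) (w ν) = 0
  Ωvw : ∀ μ ν, Ω (v μ) (w ν) = if μ = ν then lam μ else 0

/-- The choice of one vector from each pair `(v μ, w μ)`. -/
def sel (v w : Fin m → W) (s : Fin m → Bool) (μ : Fin m) : W := if s μ then v μ else w μ

/-- The eigenvalues of the pencil `Ω - z B`. -/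
def evs (B Ω : LinearMap.BilinForm ℂ W) : Set ℂ :=
  {z | ∃ l : W, l ≠ 0 ∧ ∀ A, Ω A l = z * B A l}

variable {B Ω : LinearMap.BilinForm ℂ W} {v w : Fin m → W} {lam : Fin m → ℂ}

theorem NullEigen.wv (h : NullEigen B Ω v w lam) (hB : ∀ a b, B a b = B b a) (μ ν : Fin m) :
    B (w μ) (v ν) = if μ = ν then 1 else 0 := by
  rw [hB, h.vw]; simp [eq_comm]

theorem NullEigen.swap (h : NullEigen B Ω v w lam) (hB : ∀ a b, B a b = B b a)
    (hΩ : ∀ a b, Ω a b = - Ω b a) : NullEigen B Ω w v (fun μ => - lam μ) where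
  vv := h.ww
  ww := h.vv
  vw := h.wv hB
  Ωvv := h.Ωww
  Ωww := h.Ωvv
  Ωvw μ ν := by
    rw [hΩ, h.Ωvw]
    by_cases hh : μ = ν
    · subst hh; simp
    · simp [hh, Ne.symm hh]

theorem NullEigen.linearIndependent (h : NullEigen B Ω v w lam) (hB : ∀ a b, B a b = B b a) :
    LinearIndependent ℂ (Sum.elim v w) := by
  rw [Fintype.linearIndependent_iff]
  intro c hc
  rw [Fintype.sum_sum_type] at hc
  simp only [Sum.elim_inl, Sum.elim_inr] at hc
  rintro (μ | μ)
  · have := congrArg (fun z => B z (w μ)) hc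
    simpa [h.vw, h.ww, map_sum, LinearMap.sum_apply] using this
  · have := congrArg (fun z => B z (v μ)) hc
    simpa [h.vv, h.wv hB, map_sum, LinearMap.sum_apply] using this

theorem NullEigen.expansion (h : NullEigen B Ω v w lam) (hB : ∀ a b, B a b = B b a)
    (hd : finrank ℂ W = 2 * m) (A : W) :
    A = ∑ μ, B A (w μ) • v μ + ∑ μ, B A (v μ) • w μ := by
  have hspan : Submodule.span ℂ (range (Sum.elim v w)) = ⊤ := by
    apply (h.linearIndependent hB).span_eq_top_of_card_eq_finrank'
    rw [Fintype.card_sum, Fintype.card_fin, hd]; ring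
  have hA : A ∈ Submodule.span ℂ (range (Sum.elim v w)) := hspan ▸ Submodule.mem_top
  obtain ⟨c, rfl⟩ := (Submodule.mem_span_range_iff_exists_fun ℂ).1 hA
  rw [Fintype.sum_sum_type]
  simp [h.vv, h.wv hB, h.vw, h.ww, map_sum, LinearMap.sum_apply]

/-- In the expansion of `A` only the coefficient of `v ν` pairs with `w ν`, for `Ω` as for `B`. Thus
`w ν` is an eigenvector for `lam ν`, and by `swap` the vector `v ν` is one for `-lam ν`. -/
theorem NullEigen.Ω_w (h : NullEigen B Ω v w lam) (hB : ∀ a b, B a b = B b a)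
    (hd : finrank ℂ W = 2 * m) (A : W) (ν : Fin m) : Ω A (w ν) = lam ν * B A (w ν) := by
  have := congrArg (fun z => Ω z (w ν)) (h.expansion hB hd A)
  simp only [map_add, map_sum, LinearMap.add_apply, LinearMap.sum_apply, map_smul,
    LinearMap.smul_apply, h.Ωvw, h.Ωww, smul_eq_mul] at this
  simpa [mul_comm] using this

theorem NullEigen.Ω_v (h : NullEigen B Ω v w lam) (hB : ∀ a b, B a b = B b a)
    (hΩ : ∀ a b, Ω a b = - Ω b a)
    (hd : finrank ℂ W = 2 * m) (A : W) (ν : Fin m) : Ω A (v ν) = - lam ν * B A (v ν) :=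
  (h.swap hB hΩ).Ω_w hB hd A ν

theorem NullEigen.sel_sel (h : NullEigen B Ω v w lam) (hB : ∀ a b, B a b = B b a)
    (s : Fin m → Bool) (μ ν : Fin m) : B (sel v w s μ) (sel v w s ν) = 0 := by
  by_cases hh : μ = ν
  · subst hh; by_cases h1 : s μ <;> simp [sel, h1, h.vv, h.ww]
  · by_cases h1 : s μ <;> by_cases h2 : s ν <;> simp [sel, h1, h2, h.vv, h.ww, h.vw, h.wv hB, hh]

theorem NullEigen.Ω_sel_sel (h : NullEigen B Ω v w lam) (hΩ : ∀ a b, Ω a b = - Ω b a)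
    (s : Fin m → Bool) (μ ν : Fin m) : Ω (sel v w s μ) (sel v w s ν) = 0 := by
  by_cases hh : μ = ν
  · subst hh; by_cases h1 : s μ <;> simp [sel, h1, h.Ωvv, h.Ωww]
  · by_cases h1 : s μ <;> by_cases h2 : s ν <;>
      simp [sel, h1, h2, h.Ωvv, h.Ωww, h.Ωvw, hΩ (w μ) (v ν), hh, Ne.symm hh]

theorem bilin_eq_zero_of_mem_span {ι : Type*} {b : ι → W} (hb : ∀ i j, B (b i) (b j) = 0)
    {x y : W} (hx : x ∈ Submodule.span ℂ (range b)) (hy : y ∈ Submodule.span ℂ (range b)) :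
    B x y = 0 := by
  induction hx using Submodule.span_induction with
  | zero => simp
  | add a c _ _ ha hc => simp [ha, hc]
  | smul r a _ ha => simp [ha]
  | mem a ha =>
    obtain ⟨i, rfl⟩ := ha
    induction hy using Submodule.span_induction with
    | zero => simp
    | add a c _ _ ha hc => simp [ha, hc]
    | smul r a _ ha => simp [ha]
    | mem a ha => obtain ⟨j, rfl⟩ := ha; exact hb i j

theorem NullEigen.isotropic (h : NullEigen B Ω v w lam) (hB : ∀ a b, B a b = B b a)
    (s : Fin m → Bool) {x y : W} (hx : x ∈ Submodule.span ℂ (range (sel v w s)))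
    (hy : y ∈ Submodule.span ℂ (range (sel v w s))) : B x y = 0 :=
  bilin_eq_zero_of_mem_span (h.sel_sel hB s) hx hy

theorem NullEigen.Ω_isotropic (h : NullEigen B Ω v w lam) (hΩ : ∀ a b, Ω a b = - Ω b a)
    (s : Fin m → Bool) {x y : W} (hx : x ∈ Submodule.span ℂ (range (sel v w s)))
    (hy : y ∈ Submodule.span ℂ (range (sel v w s))) : Ω x y = 0 :=
  bilin_eq_zero_of_mem_span (h.Ω_sel_sel hΩ s) hx hy

theorem sel_mem (s : Fin m → Bool) (μ : Fin m) :
    sel v w s μ ∈ Submodule.span ℂ (range (sel v w s)) :=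
  Submodule.subset_span (mem_range_self μ)

/-- The coefficient of `A` along the vector of a pair that `s` does not pick is its product with the
one that `s` picks. This is the maximality of the isotropic span. -/
theorem NullEigen.mem_of_orthogonal (h : NullEigen B Ω v w lam) (hB : ∀ a b, B a b = B b a)
    (hd : finrank ℂ W = 2 * m) (s : Fin m → Bool) {A : W}
    (hA : ∀ μ, B A (sel v w s μ) = 0) : A ∈ Submodule.span ℂ (range (sel v w s)) := by
  rw [h.expansion hB hd A]
  refine add_mem (sum_mem fun μ _ => ?_) (sum_mem fun μ _ => ?_)
  · by_cases hs : s μ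
    · have := sel_mem (v := v) (w := w) s μ
      simp only [sel, hs, if_true] at this
      exact Submodule.smul_mem _ _ this
    · have := hA μ
      simp only [sel, hs] at this
      simp_all
  · by_cases hs : s μ
    · have := hA μ
      simp only [sel, hs] at this
      simp_all
    · have := sel_mem (v := v) (w := w) s μ
      simp only [sel, hs] at this
      exact Submodule.smul_mem _ _ (by simpa using this)

theorem NullEigen.linearIndependent_sel (h : NullEigen B Ω v w lam) (hB : ∀ a b, B a b = B b a)
    (s : Fin m → Bool) : LinearIndependent ℂ (sel v w s) := by
  have h1 := (h.linearIndependent hB).comp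
    (fun μ => if s μ then Sum.inl μ else Sum.inr μ : Fin m → Fin m ⊕ Fin m) (by
      intro a b hab
      by_cases ha : s a <;> by_cases hb : s b <;> simp_all)
  convert h1 using 1
  funext μ
  by_cases hs : s μ <;> simp [sel, hs]

theorem NullEigen.finrank_span (h : NullEigen B Ω v w lam) (hB : ∀ a b, B a b = B b a)
    (s : Fin m → Bool) : finrank ℂ (Submodule.span ℂ (range (sel v w s))) = m := by
  rw [finrank_span_eq_card (h.linearIndependent_sel hB s), Fintype.card_fin]

theorem NullEigen.v_mem_iff (h : NullEigen B Ω v w lam) (hB : ∀ a b, B a b = B b a)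
    (s : Fin m → Bool) (μ : Fin m) :
    v μ ∈ Submodule.span ℂ (range (sel v w s)) ↔ s μ = true := by
  constructor
  · intro hv
    by_contra hs
    have h1 := h.isotropic hB s hv (sel_mem s μ)
    simp [sel, hs, h.vw] at h1
  · intro hs
    have := sel_mem (v := v) (w := w) s μ
    simpa [sel, hs] using this

theorem NullEigen.w_mem_iff (h : NullEigen B Ω v w lam) (hB : ∀ a b, B a b = B b a)
    (s : Fin m → Bool) (μ : Fin m) :
    w μ ∈ Submodule.span ℂ (range (sel v w s)) ↔ s μ = false := by
  constructor
  · intro hv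
    by_contra hs
    have h1 := h.isotropic hB s hv (sel_mem s μ)
    simp only [Bool.not_eq_false] at hs
    simp [sel, hs, h.wv hB] at h1
  · intro hs
    have := sel_mem (v := v) (w := w) s μ
    simpa [sel, hs] using this

theorem NullEigen.span_injective (h : NullEigen B Ω v w lam) (hB : ∀ a b, B a b = B b a) :
    Function.Injective fun s => Submodule.span ℂ (range (sel v w s)) := by
  intro s t hst
  funext μ
  have h1 := h.v_mem_iff hB s μ
  have h2 := h.v_mem_iff hB t μ
  simp only at hst
  rw [hst, h2] at h1
  exact (Bool.eq_iff_iff.2 h1).symm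

theorem NullEigen.evs_eq (h : NullEigen B Ω v w lam) (hB : ∀ a b, B a b = B b a)
    (hΩ : ∀ a b, Ω a b = - Ω b a) (hd : finrank ℂ W = 2 * m) :
    evs B Ω = range (Sum.elim lam (fun μ => - lam μ)) := by
  ext z
  constructor
  · rintro ⟨l, hl, hz⟩
    by_contra hne
    refine hl ?_
    rw [h.expansion hB hd l]
    have h1 : ∀ μ, B l (w μ) = 0 := by
      intro μ
      have e1 := hz (w μ)
      rw [hΩ, h.Ω_w hB hd, hB (w μ)] at e1
      have : (z + lam μ) * B l (w μ) = 0 := by linear_combination -e1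
      refine (mul_eq_zero.1 this).resolve_left fun h0 => hne ⟨Sum.inr μ, ?_⟩
      simp; linear_combination -h0
    have h2 : ∀ μ, B l (v μ) = 0 := by
      intro μ
      have e1 := hz (v μ)
      rw [hΩ, h.Ω_v hB hΩ hd, hB (v μ)] at e1
      have : (z - lam μ) * B l (v μ) = 0 := by linear_combination -e1
      refine (mul_eq_zero.1 this).resolve_left fun h0 => hne ⟨Sum.inl μ, ?_⟩
      simp; linear_combination -h0
    simp [h1, h2]
  · rintro ⟨μ | μ, rfl⟩
    · exact ⟨w μ, (h.linearIndependent hB).ne_zero (Sum.inr μ), fun A => h.Ω_w hB hd A μ⟩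
    · exact ⟨v μ, (h.linearIndependent hB).ne_zero (Sum.inl μ), fun A => h.Ω_v hB hΩ hd A μ⟩

/-- The list `lam, -lam` has `2m` entries and its range, the spectrum, has `2m` elements. -/
theorem NullEigen.injective_elim (h : NullEigen B Ω v w lam) (hB : ∀ a b, B a b = B b a)
    (hΩ : ∀ a b, Ω a b = - Ω b a) (hd : finrank ℂ W = 2 * m) (hc : (evs B Ω).ncard = 2 * m) :
    Function.Injective (Sum.elim lam (fun μ => - lam μ)) := by
  classical
  rw [h.evs_eq hB hΩ hd, ← image_univ] at hc
  have := (Set.ncard_image_iff (s := univ) (toFinite _)).1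
    (by rw [hc, ncard_univ]; simp; ring)
  exact injOn_univ.1 this

theorem NullEigen.lam_injective (h : NullEigen B Ω v w lam) (hB : ∀ a b, B a b = B b a)
    (hΩ : ∀ a b, Ω a b = - Ω b a) (hd : finrank ℂ W = 2 * m) (hc : (evs B Ω).ncard = 2 * m) :
    Function.Injective lam :=
  (h.injective_elim hB hΩ hd hc).comp Sum.inl_injective

theorem NullEigen.add_ne_zero (h : NullEigen B Ω v w lam) (hB : ∀ a b, B a b = B b a)
    (hΩ : ∀ a b, Ω a b = - Ω b a) (hd : finrank ℂ W = 2 * m) (hc : (evs B Ω).ncard = 2 * m)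
    (μ ν : Fin m) : lam μ + lam ν ≠ 0 := by
  intro h0
  have : (Sum.inl μ : Fin m ⊕ Fin m) = Sum.inr ν :=
    h.injective_elim hB hΩ hd hc (by simp; linear_combination h0)
  simp at this

/-- An eigenvector for `lam μ` is orthogonal to every basis vector whose eigenvalue is not `-lam μ`;
as the eigenvalues are distinct, only the product with `v μ` can survive. -/
theorem NullEigen.eigenvector_w (h : NullEigen B Ω v w lam) (hB : ∀ a b, B a b = B b a)
    (hΩ : ∀ a b, Ω a b = - Ω b a) (hd : finrank ℂ W = 2 * m) (hc : (evs B Ω).ncard = 2 * m)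
    {l : W} {μ : Fin m} (hl : ∀ A, Ω A l = lam μ * B A l) : l = B l (v μ) • w μ := by
  have h1 : ∀ ν, B l (w ν) = 0 := by
    intro ν
    have e1 := hl (w ν)
    rw [hΩ, h.Ω_w hB hd, hB (w ν)] at e1
    have : (lam μ + lam ν) * B l (w ν) = 0 := by linear_combination -e1
    exact (mul_eq_zero.1 this).resolve_left (h.add_ne_zero hB hΩ hd hc μ ν)
  have h2 : ∀ ν, ν ≠ μ → B l (v ν) = 0 := by
    intro ν hν
    have e1 := hl (v ν)
    rw [hΩ, h.Ω_v hB hΩ hd, hB (v ν)] at e1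
    have : (lam ν - lam μ) * B l (v ν) = 0 := by linear_combination e1
    exact (mul_eq_zero.1 this).resolve_left
      (sub_ne_zero.2 fun h0 => hν (h.lam_injective hB hΩ hd hc h0))
  conv_lhs => rw [h.expansion hB hd l]
  rw [Finset.sum_eq_single (f := fun ν => B l (v ν) • w ν) μ]
  · simp [h1]
  · intro ν _ hν; simp [h2 ν hν]
  · simp

theorem NullEigen.eigenvector_v (h : NullEigen B Ω v w lam) (hB : ∀ a b, B a b = B b a)
    (hΩ : ∀ a b, Ω a b = - Ω b a) (hd : finrank ℂ W = 2 * m) (hc : (evs B Ω).ncard = 2 * m)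
    {l : W} {μ : Fin m} (hl : ∀ A, Ω A l = - lam μ * B A l) : l = B l (w μ) • v μ :=
  (h.swap hB hΩ).eigenvector_w hB hΩ hd hc hl

/-- Eigenlines are one-dimensional, so the spans depend on the enumeration `lam` alone. This lets a
pointwise choice of eigenbases be compared with a smooth one. -/
theorem NullEigen.span_eq (h : NullEigen B Ω v w lam) (hB : ∀ a b, B a b = B b a)
    (hΩ : ∀ a b, Ω a b = - Ω b a) (hd : finrank ℂ W = 2 * m) (hc : (evs B Ω).ncard = 2 * m)
    {v' w' : Fin m → W} (h' : NullEigen B Ω v' w' lam) (s : Fin m → Bool) :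
    Submodule.span ℂ (range (sel v w s)) = Submodule.span ℂ (range (sel v' w' s)) := by
  have key : ∀ {v w v' w' : Fin m → W}, NullEigen B Ω v w lam → NullEigen B Ω v' w' lam →
      Submodule.span ℂ (range (sel v w s)) ≤ Submodule.span ℂ (range (sel v' w' s)) := by
    intro v w v' w' h h'
    rw [Submodule.span_le]
    rintro _ ⟨μ, rfl⟩
    have hm := sel_mem (v := v') (w := w') s μ
    by_cases hs : s μ
    · simp only [sel, hs, if_true] at hm ⊢
      rw [h'.eigenvector_v hB hΩ hd hc (l := v μ) (μ := μ) fun A => h.Ω_v hB hΩ hd A μ]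
      exact Submodule.smul_mem _ _ hm
    · simp only [sel, hs] at hm ⊢
      rw [if_neg (by simp)] at hm ⊢
      rw [h'.eigenvector_w hB hΩ hd hc (l := w μ) (μ := μ) fun A => h.Ω_w hB hd A μ]
      exact Submodule.smul_mem _ _ hm
  exact le_antisymm (key h h') (key h' h)

end NullEigen

/-! ### Existence of null eigenbases and normalised enumerations of the spectrum. -/

section Existence

variable {W : Type*} [AddCommGroup W] [Module ℂ W] [FiniteDimensional ℂ W] {m : ℕ}
  {B Ω : LinearMap.BilinForm ℂ W}

theorem exists_pencil_endomorphism (hBn : B.Nondegenerate) (hB : ∀ a b, B a b = B b a) :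
    ∃ F : Module.End ℂ W, ∀ A l, Ω A l = B A (F l) := by
  refine ⟨(B.toDual hBn).symm.toLinearMap ∘ₗ Ω.flip, fun A l => ?_⟩
  rw [hB]
  simp

theorem evs_finite (hBn : B.Nondegenerate) (hB : ∀ a b, B a b = B b a) : (evs B Ω).Finite := by
  obtain ⟨F, hF⟩ := exists_pencil_endomorphism (Ω := Ω) hBn hB
  refine F.finite_hasEigenvalue.subset ?_
  rintro z ⟨l, hl, hz⟩
  refine Module.End.hasEigenvalue_of_hasEigenvector (x := l) ⟨?_, hl⟩
  rw [Module.End.mem_eigenspace_iff, ← sub_eq_zero]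
  refine hBn.2 _ fun A => ?_
  simp [map_sub, ← hF, hz]

/-- By the count, the eigenvectors are a basis. If `u z` were orthogonal to `u (-z)`, or `-z` were
not an eigenvalue, `u z` would be orthogonal to this whole basis, contradicting nondegeneracy. -/
theorem exists_eigenvectors (hBn : B.Nondegenerate) (hB : ∀ a b, B a b = B b a)
    (hΩ : ∀ a b, Ω a b = - Ω b a) (hd : finrank ℂ W = 2 * m) (hc : (evs B Ω).ncard = 2 * m) :
    ∃ u : ℂ → W, (∀ z ∈ evs B Ω, ∀ A, Ω A (u z) = z * B A (u z)) ∧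
      ∀ z ∈ evs B Ω, -z ∈ evs B Ω ∧ B (u (-z)) (u z) ≠ 0 := by
  classical
  obtain ⟨F, hF⟩ := exists_pencil_endomorphism (Ω := Ω) hBn hB
  have : ∃ u : ℂ → W, ∀ z ∈ evs B Ω, u z ≠ 0 ∧ ∀ A, Ω A (u z) = z * B A (u z) := by
    -- The value `0` off the spectrum is never used.
    refine ⟨fun z => if hz : z ∈ evs B Ω then hz.choose else 0, fun z hz => ?_⟩
    simpa only [hz, dif_pos] using hz.choose_spec
  obtain ⟨u, hu⟩ := this
  have hli : LinearIndependent ℂ (fun z : evs B Ω => u z) := by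
    refine Module.End.eigenvectors_linearIndependent' F (fun z : evs B Ω => (z : ℂ))
      Subtype.coe_injective _ fun z => ⟨?_, (hu z z.2).1⟩
    rw [Module.End.mem_eigenspace_iff, ← sub_eq_zero]
    refine hBn.2 _ fun A => ?_
    simp [map_sub, ← hF, (hu z z.2).2]
  have : Fintype (evs B Ω) := (evs_finite hBn hB).fintype
  have hspan : Submodule.span ℂ (range fun z : evs B Ω => u z) = ⊤ := by
    apply hli.span_eq_top_of_card_eq_finrank'
    rw [hd, ← hc, Set.ncard_eq_toFinset_card', Set.toFinset_card]
  refine ⟨u, fun z hz => (hu z hz).2, fun z hz => ?_⟩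
  by_contra hcon
  push Not at hcon
  refine (hu z hz).1 (hBn.2 _ fun A => ?_)
  have hA : A ∈ Submodule.span ℂ (range fun z : evs B Ω => u z) := hspan ▸ Submodule.mem_top
  induction hA using Submodule.span_induction with
  | zero => simp
  | add a c _ _ ha hc => simp [ha, hc]
  | smul r a _ ha => simp [ha]
  | mem a ha =>
    obtain ⟨⟨y, hy⟩, rfl⟩ := ha
    simp only
    have e1 := (hu z hz).2 (u y)
    rw [hΩ, (hu y hy).2, hB (u z)] at e1
    have e2 : (z + y) * B (u y) (u z) = 0 := by linear_combination -e1
    rcases mul_eq_zero.1 e2 with h0 | h0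
    · have : y = -z := by linear_combination h0
      subst this
      exact hcon hy
    · exact h0

theorem exists_nullEigen (hBn : B.Nondegenerate) (hB : ∀ a b, B a b = B b a)
    (hΩ : ∀ a b, Ω a b = - Ω b a) (hd : finrank ℂ W = 2 * m) (hc : (evs B Ω).ncard = 2 * m)
    {lam : Fin m → ℂ} (hinj : Function.Injective lam) (hmem : ∀ μ, lam μ ∈ evs B Ω)
    (hne : ∀ μ ν, lam μ + lam ν ≠ 0) : ∃ v w, NullEigen B Ω v w lam := by
  obtain ⟨u, hu, hn⟩ := exists_eigenvectors hBn hB hΩ hd hc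
  have orth : ∀ z ∈ evs B Ω, ∀ y ∈ evs B Ω, y + z ≠ 0 → B (u y) (u z) = 0 := by
    intro z hz y hy hzy
    have e1 := hu z hz (u y)
    rw [hΩ, hu y hy, hB (u z)] at e1
    have e2 : (y + z) * B (u y) (u z) = 0 := by linear_combination -e1
    exact (mul_eq_zero.1 e2).resolve_left hzy
  -- The nonzero products of opposite eigenvectors, by which the `v μ` are divided.
  let r : Fin m → ℂ := fun μ => B (u (-lam μ)) (u (lam μ))
  have hr : ∀ μ, r μ ≠ 0 := fun μ => (hn _ (hmem μ)).2
  have hvw : ∀ μ ν, B (u (-lam μ)) (u (lam ν)) = if μ = ν then r μ else 0 := by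
    intro μ ν
    split_ifs with h
    · subst h; rfl
    · exact orth _ (hmem ν) _ (hn _ (hmem μ)).1 fun h0 => h (hinj (by linear_combination -h0))
  have hvv : ∀ μ ν, B (u (-lam μ)) (u (-lam ν)) = 0 := fun μ ν =>
    orth _ (hn _ (hmem ν)).1 _ (hn _ (hmem μ)).1 fun h0 => hne μ ν (by linear_combination -h0)
  have hww : ∀ μ ν, B (u (lam μ)) (u (lam ν)) = 0 := fun μ ν =>
    orth _ (hmem ν) _ (hmem μ) (hne μ ν)
  refine ⟨fun μ => (r μ)⁻¹ • u (-lam μ), fun μ => u (lam μ), ?_, hww, ?_, ?_, ?_, ?_⟩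
  · intro μ ν; simp [hvv]
  · intro μ ν
    by_cases h : μ = ν
    · subst h; simp [hvw, hr μ]
    · simp [hvw, h]
  · intro μ ν; simp [hu _ (hn _ (hmem ν)).1, hvv]
  · intro μ ν; simp [hu _ (hmem ν), hww]
  · intro μ ν
    by_cases h : μ = ν
    · subst h
      simp only [map_smul, LinearMap.smul_apply, hu _ (hmem μ), hvw, if_true, smul_eq_mul]
      field_simp [hr μ]
    · simp [hu _ (hmem ν), hvw, h]

/-- Negation exchanges the nonzero eigenvalues that satisfy `P` with those that do not, so each
class is half of them. -/
theorem exists_half (hBn : B.Nondegenerate) (hB : ∀ a b, B a b = B b a)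
    (hΩ : ∀ a b, Ω a b = - Ω b a) (hd : finrank ℂ W = 2 * m) (hc : (evs B Ω).ncard = 2 * m)
    (P : ℂ → Prop) (hP : ∀ z ∈ evs B Ω, z ≠ 0 → (P z ↔ ¬ P (-z))) :
    ∃ T : Finset ℂ, T.card = m ∧ ∀ z, z ∈ T ↔ z ∈ evs B Ω ∧ P z := by
  classical
  obtain ⟨u, hu, hn⟩ := exists_eigenvectors hBn hB hΩ hd hc
  have hfin := evs_finite (Ω := Ω) hBn hB
  let S := hfin.toFinset
  have hS : S.card = 2 * m := by rw [← hc, Set.ncard_eq_toFinset_card _ hfin]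
  have hmS : ∀ z, z ∈ S ↔ z ∈ evs B Ω := fun z => hfin.mem_toFinset
  have h1 : ((S.erase 0).filter P).card + ((S.erase 0).filter fun z => ¬ P z).card
      = (S.erase 0).card := Finset.card_filter_add_card_filter_not P
  have h2 : ((S.erase 0).filter fun z => ¬ P z) = ((S.erase 0).filter P).image (fun z => -z) := by
    ext z
    simp only [Finset.mem_filter, Finset.mem_erase, Finset.mem_image, hmS]
    constructor
    · rintro ⟨⟨h0, hz⟩, hPz⟩
      exact ⟨-z, ⟨⟨neg_ne_zero.2 h0, (hn z hz).1⟩, by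
        by_contra h3; exact hPz ((hP z hz h0).2 h3)⟩, neg_neg z⟩
    · rintro ⟨y, ⟨⟨h0, hy⟩, hPy⟩, rfl⟩
      exact ⟨⟨neg_ne_zero.2 h0, (hn y hy).1⟩, (hP y hy h0).1 hPy⟩
  rw [h2, Finset.card_image_of_injective _ neg_injective] at h1
  -- Otherwise the number `2m - 1` of nonzero eigenvalues would be even.
  have h3 : (0 : ℂ) ∉ S := by
    intro h0
    rw [Finset.card_erase_of_mem h0] at h1
    have : 0 < S.card := Finset.card_pos.2 ⟨0, h0⟩
    omega
  rw [Finset.erase_eq_of_notMem h3] at h1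
  refine ⟨S.filter P, by omega, fun z => ?_⟩
  simp [hmS]

theorem exists_nullEigen_of_half (hBn : B.Nondegenerate) (hB : ∀ a b, B a b = B b a)
    (hΩ : ∀ a b, Ω a b = - Ω b a) (hd : finrank ℂ W = 2 * m) (hc : (evs B Ω).ncard = 2 * m)
    (P : ℂ → Prop) (hP : ∀ z ∈ evs B Ω, z ≠ 0 → (P z ↔ ¬ P (-z))) (hP0 : ¬ P 0)
    {lam : Fin m → ℂ} (hinj : Function.Injective lam) (hmem : ∀ μ, lam μ ∈ evs B Ω)
    (hl : ∀ μ, P (lam μ)) : ∃ v w, NullEigen B Ω v w lam := by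
  refine exists_nullEigen hBn hB hΩ hd hc hinj hmem fun μ ν h0 => ?_
  have h1 : lam ν = - lam μ := by linear_combination h0
  have h2 := hl ν
  rw [h1] at h2
  exact (hP _ (hmem μ) fun h => hP0 (h ▸ hl μ)).1 (hl μ) h2

theorem exists_nullEigen_any (hBn : B.Nondegenerate) (hB : ∀ a b, B a b = B b a)
    (hΩ : ∀ a b, Ω a b = - Ω b a) (hd : finrank ℂ W = 2 * m) (hc : (evs B Ω).ncard = 2 * m) :
    ∃ (v w : Fin m → W) (lam : Fin m → ℂ), NullEigen B Ω v w lam := by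
  -- The lexicographic half-plane contains exactly one of `z`, `-z` for every nonzero `z`, wherever
  -- the spectrum lies.
  let P : ℂ → Prop := fun z => 0 < z.re ∨ (z.re = 0 ∧ 0 < z.im)
  have hP : ∀ z ∈ evs B Ω, z ≠ 0 → (P z ↔ ¬ P (-z)) := by
    intro z _ hz
    have : ¬ (z.re = 0 ∧ z.im = 0) := fun h => hz (Complex.ext h.1 h.2)
    simp only [P, Complex.neg_re, Complex.neg_im]
    rcases lt_trichotomy z.re 0 with h | h | h <;> rcases lt_trichotomy z.im 0 with h' | h' | h' <;>
      simp_all <;> grind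
  have hP0 : ¬ P 0 := by simp [P]
  obtain ⟨T, hT, hmT⟩ := exists_half hBn hB hΩ hd hc P hP
  let e := (Finset.equivFinOfCardEq hT).symm
  obtain ⟨v, w, h⟩ := exists_nullEigen_of_half hBn hB hΩ hd hc P hP hP0
    (lam := fun μ => e μ) (Subtype.coe_injective.comp e.injective)
    (fun μ => ((hmT _).1 (e μ).2).1) (fun μ => ((hmT _).1 (e μ).2).2)
  exact ⟨v, w, _, h⟩

/-- The normalised enumerations of half of the spectrum. -/
def Ordered (lam : Fin m → ℂ) : Prop :=
  (∀ μ, 0 < (lam μ).re + (lam μ).im) ∧ StrictMono fun μ => (lam μ).im - (lam μ).re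

/-- A set of complex numbers admits at most one normalised enumeration. -/
structure Orderable (S : Set ℂ) : Prop where
  ne : ∀ z ∈ S, z.re + z.im ≠ 0
  inj : ∀ z ∈ S, ∀ y ∈ S, 0 < z.re + z.im → 0 < y.re + y.im →
    z.im - z.re = y.im - y.re → z = y

theorem exists_nullEigen_ordered (hBn : B.Nondegenerate) (hB : ∀ a b, B a b = B b a)
    (hΩ : ∀ a b, Ω a b = - Ω b a) (hd : finrank ℂ W = 2 * m) (hc : (evs B Ω).ncard = 2 * m)
    (hS : Orderable (evs B Ω)) :
    ∃ (v w : Fin m → W) (lam : Fin m → ℂ), NullEigen B Ω v w lam ∧ Ordered lam := by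
  classical
  let P : ℂ → Prop := fun z => 0 < z.re + z.im
  have hP : ∀ z ∈ evs B Ω, z ≠ 0 → (P z ↔ ¬ P (-z)) := by
    intro z hz _
    have := hS.ne z hz
    simp only [P, Complex.neg_re, Complex.neg_im]
    constructor
    · intro h; linarith
    · intro h; exact lt_of_le_of_ne (by linarith) this.symm
  have hP0 : ¬ P 0 := by simp [P]
  obtain ⟨T, hT, hmT⟩ := exists_half hBn hB hΩ hd hc P hP
  let κ : ℂ → ℝ := fun z => z.im - z.re
  have hκ : Set.InjOn κ T := fun z hz y hy h => by
    have h1 := (hmT z).1 hz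
    have h2 := (hmT y).1 hy
    exact hS.inj z h1.1 y h2.1 h1.2 h2.2 h
  have hcard : (T.image κ).card = m := by rw [Finset.card_image_of_injOn hκ, hT]
  let e := (T.image κ).orderEmbOfFin hcard
  have he : ∀ μ, ∃ z ∈ T, κ z = e μ := fun μ =>
    Finset.mem_image.1 ((T.image κ).orderEmbOfFin_mem hcard μ)
  choose lam hlam hle using he
  have hmono : StrictMono fun μ => κ (lam μ) := by
    simp only [hle]; exact e.strictMono
  obtain ⟨v, w, h⟩ := exists_nullEigen_of_half hBn hB hΩ hd hc P hP hP0
    (lam := lam) (fun a b hab => hmono.injective (by simp [hab]))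
    (fun μ => ((hmT _).1 (hlam μ)).1) (fun μ => ((hmT _).1 (hlam μ)).2)
  exact ⟨v, w, lam, h, fun μ => ((hmT _).1 (hlam μ)).2, hmono⟩

/-- The spectrum is `± lam'`, and of each opposite pair only the member `lam' ν` lies in the
half-plane. So both enumerations have the same set of sorting keys, and strictly monotone functions
on `Fin m` with equal ranges agree. -/
theorem ordered_unique (hB : ∀ a b, B a b = B b a)
    (hΩ : ∀ a b, Ω a b = - Ω b a) (hd : finrank ℂ W = 2 * m)
    (hS : Orderable (evs B Ω)) {v w v' w' : Fin m → W} {lam lam' : Fin m → ℂ}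
    (h : NullEigen B Ω v w lam) (h' : NullEigen B Ω v' w' lam')
    (ho : Ordered lam) (ho' : Ordered lam') : lam = lam' := by
  have hmem : ∀ {v w lam}, NullEigen B Ω v w lam → ∀ μ : Fin m, lam μ ∈ evs B Ω :=
    fun h μ => by rw [h.evs_eq hB hΩ hd]; exact ⟨Sum.inl μ, rfl⟩
  have key : ∀ {v w v' w' : Fin m → W} {lam lam' : Fin m → ℂ}, NullEigen B Ω v w lam →
      NullEigen B Ω v' w' lam' → Ordered lam → Ordered lam' →
      range (fun μ => (lam μ).im - (lam μ).re) ⊆ range (fun μ => (lam' μ).im - (lam' μ).re) := by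
    rintro v w v' w' lam lam' h h' ho ho' _ ⟨μ, rfl⟩
    have h1 := hmem h μ
    rw [h'.evs_eq hB hΩ hd] at h1
    obtain ⟨ν | ν, hν⟩ := h1
    · exact ⟨ν, by simp only [Sum.elim_inl] at hν; simp [hν]⟩
    · have h2 := ho.1 μ
      have h3 := ho'.1 ν
      simp only [Sum.elim_inr] at hν
      rw [← hν] at h2
      simp at h2
      linarith
  have e := (StrictMono.range_inj ho.2 ho'.2).1
    ((key h h' ho ho').antisymm (key h' h ho' ho))
  funext μ
  exact hS.inj _ (hmem h μ) _ (hmem h' μ) (ho.1 μ) (ho'.1 μ) (congrFun e μ)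

end Existence

/-! ### Real and imaginary parts, and conjugation, on `ℂ ⊗ V`. -/

section Complexification

variable {V : Type*} [AddCommGroup V] [Module ℝ V]

@[simp] theorem cre_tmul (z : ℂ) (a : V) : cre (z ⊗ₜ[ℝ] a) = z.re • a := by simp [cre]

@[simp] theorem cim_tmul (z : ℂ) (a : V) : cim (z ⊗ₜ[ℝ] a) = z.im • a := by simp [cim]

@[simp] theorem cre_cmk (a b : V) : cre (cmk a b) = a := by simp [cmk]

@[simp] theorem cim_cmk (a b : V) : cim (cmk a b) = b := by simp [cmk]

theorem cmk_cre_cim (A : ℂ ⊗[ℝ] V) : cmk (cre A) (cim A) = A := by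
  induction A using TensorProduct.induction_on with
  | zero => simp [cmk]
  | tmul z a =>
    simp only [cmk, cre_tmul, cim_tmul, TensorProduct.tmul_smul]
    rw [TensorProduct.smul_tmul', TensorProduct.smul_tmul', ← TensorProduct.add_tmul]
    congr 1
    apply Complex.ext <;> simp
  | add x y hx hy =>
    conv_rhs => rw [← hx, ← hy]
    simp only [cmk, map_add, TensorProduct.tmul_add]
    abel

theorem ctensor_ext {A B : ℂ ⊗[ℝ] V} (h1 : cre A = cre B) (h2 : cim A = cim B) : A = B := by
  rw [← cmk_cre_cim A, ← cmk_cre_cim B, h1, h2]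

@[simp] theorem cre_smul (z : ℂ) (A : ℂ ⊗[ℝ] V) :
    cre (z • A) = z.re • cre A - z.im • cim A := by
  induction A using TensorProduct.induction_on with
  | zero => simp
  | tmul y a => simp [TensorProduct.smul_tmul', sub_smul, mul_smul]
  | add x y hx hy => simp [smul_add, hx, hy]; abel

@[simp] theorem cim_smul (z : ℂ) (A : ℂ ⊗[ℝ] V) :
    cim (z • A) = z.re • cim A + z.im • cre A := by
  induction A using TensorProduct.induction_on with
  | zero => simp
  | tmul y a => simp [TensorProduct.smul_tmul', add_smul, mul_smul]
  | add x y hx hy => simp [smul_add, hx, hy]; abel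

theorem baseChange_eq (b : LinearMap.BilinForm ℝ V) (A B : ℂ ⊗[ℝ] V) :
    LinearMap.BilinForm.baseChange ℂ b A B =
      ⟨b (cre A) (cre B) - b (cim A) (cim B), b (cre A) (cim B) + b (cim A) (cre B)⟩ := by
  conv_lhs => rw [← cmk_cre_cim A, ← cmk_cre_cim B]
  apply Complex.ext <;>
    simp [cmk, LinearMap.BilinForm.baseChange_tmul]
  ring

/-- Complex conjugation on `ℂ ⊗ V`. -/
def cconj (A : ℂ ⊗[ℝ] V) : ℂ ⊗[ℝ] V := cmk (cre A) (- cim A)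

@[simp] theorem cre_cconj (A : ℂ ⊗[ℝ] V) : cre (cconj A) = cre A := by simp [cconj]

@[simp] theorem cim_cconj (A : ℂ ⊗[ℝ] V) : cim (cconj A) = - cim A := by simp [cconj]

theorem cconj_cconj (A : ℂ ⊗[ℝ] V) : cconj (cconj A) = A := by
  apply ctensor_ext <;> simp

theorem baseChange_cconj (b : LinearMap.BilinForm ℝ V) (A B : ℂ ⊗[ℝ] V) :
    LinearMap.BilinForm.baseChange ℂ b (cconj A) (cconj B) =
      (starRingEnd ℂ) (LinearMap.BilinForm.baseChange ℂ b A B) := by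
  rw [baseChange_eq, baseChange_eq]
  apply Complex.ext <;> simp
  ring

end Complexification

/-! ### The complexified metric and 2-form at a point. -/

section Pointwise

variable {n : ℕ} {M : Type*} [TopologicalSpace M]
  [ChartedSpace (EuclideanSpace ℝ (Fin n)) M] [IsManifold (𝓡 n) ∞ M]

instance finiteDimensional_tangentSpace (x : M) : FiniteDimensional ℝ (TangentSpace (𝓡 n) x) :=
  inferInstanceAs (FiniteDimensional ℝ (EuclideanSpace ℝ (Fin n)))

theorem finrank_ctangent (x : M) : finrank ℂ (ℂ ⊗[ℝ] TangentSpace (𝓡 n) x) = n := by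
  rw [Module.finrank_baseChange]
  exact finrank_euclideanSpace_fin

theorem cval_eq (g : PseudoRiemannianMetric n M) (x : M) (A B : ℂ ⊗[ℝ] TangentSpace (𝓡 n) x) :
    g.cval x A B = ⟨g.val x (cre A) (cre B) - g.val x (cim A) (cim B),
      g.val x (cre A) (cim B) + g.val x (cim A) (cre B)⟩ :=
  baseChange_eq _ A B

theorem TwoForm.cval_eq (φ : TwoForm n M) (x : M) (A B : ℂ ⊗[ℝ] TangentSpace (𝓡 n) x) :
    φ.cval x A B = ⟨φ.val x (cre A) (cre B) - φ.val x (cim A) (cim B),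
      φ.val x (cre A) (cim B) + φ.val x (cim A) (cre B)⟩ :=
  baseChange_eq _ A B

theorem cval_symm (g : PseudoRiemannianMetric n M) (x : M)
    (A B : ℂ ⊗[ℝ] TangentSpace (𝓡 n) x) : g.cval x A B = g.cval x B A := by
  rw [cval_eq, cval_eq]
  apply Complex.ext
  · simp [g.symm x (cre A), g.symm x (cim A)]
  · simp [g.symm x (cre A), g.symm x (cim A), add_comm]

theorem TwoForm.cval_skew (φ : TwoForm n M) (x : M)
    (A B : ℂ ⊗[ℝ] TangentSpace (𝓡 n) x) : φ.cval x A B = - φ.cval x B A := by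
  rw [TwoForm.cval_eq, TwoForm.cval_eq]
  apply Complex.ext
  · simp [φ.skew x (cre A), φ.skew x (cim A)]; ring
  · simp [φ.skew x (cre A), φ.skew x (cim A)]

theorem cval_nondegenerate (g : PseudoRiemannianMetric n M) (x : M) :
    (g.cval x).Nondegenerate := by
  have hr : (g.cval x).IsRefl := fun v w h => by rw [cval_symm]; exact h
  refine (LinearMap.IsRefl.nondegenerate_iff_separatingLeft hr).2 fun A hA => ?_
  have key : ∀ w, g.val x (cre A) w = 0 ∧ g.val x (cim A) w = 0 := by
    intro w
    have h := hA (1 ⊗ₜ w)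
    rw [cval_eq] at h
    have h1 := congrArg Complex.re h
    have h2 := congrArg Complex.im h
    simp at h1 h2
    exact ⟨h1, h2⟩
  apply ctensor_ext
  · simpa using g.nondegenerate x _ fun w => (key w).1
  · simpa using g.nondegenerate x _ fun w => (key w).2

theorem cval_cconj (g : PseudoRiemannianMetric n M) (x : M)
    (A B : ℂ ⊗[ℝ] TangentSpace (𝓡 n) x) :
    g.cval x (cconj A) (cconj B) = (starRingEnd ℂ) (g.cval x A B) := baseChange_cconj _ A B

theorem TwoForm.cval_cconj (φ : TwoForm n M) (x : M)
    (A B : ℂ ⊗[ℝ] TangentSpace (𝓡 n) x) :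
    φ.cval x (cconj A) (cconj B) = (starRingEnd ℂ) (φ.cval x A B) := baseChange_cconj _ A B

end Pointwise

/-! ### Smooth complex functions and vector fields. -/

section Smoothness

variable {n : ℕ} {M : Type*} [TopologicalSpace M]
  [ChartedSpace (EuclideanSpace ℝ (Fin n)) M] [IsManifold (𝓡 n) ∞ M] {U : Set M}

/-- The complex function `f` is smooth on `U`. -/
abbrev SmoothCOn (n : ℕ) {M : Type*} [TopologicalSpace M]
    [ChartedSpace (EuclideanSpace ℝ (Fin n)) M] (f : M → ℂ) (U : Set M) : Prop :=
  ContMDiffOn (𝓡 n) 𝓘(ℝ, ℂ) ∞ f U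

theorem SmoothCOn.re {f : M → ℂ} (hf : SmoothCOn n f U) :
    ContMDiffOn (𝓡 n) 𝓘(ℝ, ℝ) ∞ (fun x => (f x).re) U :=
  (Complex.reCLM.contMDiff (n := ∞)).comp_contMDiffOn hf

theorem SmoothCOn.im {f : M → ℂ} (hf : SmoothCOn n f U) :
    ContMDiffOn (𝓡 n) 𝓘(ℝ, ℝ) ∞ (fun x => (f x).im) U :=
  (Complex.imCLM.contMDiff (n := ∞)).comp_contMDiffOn hf

theorem smoothCOn_mk {a b : M → ℝ} (ha : ContMDiffOn (𝓡 n) 𝓘(ℝ, ℝ) ∞ a U)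
    (hb : ContMDiffOn (𝓡 n) 𝓘(ℝ, ℝ) ∞ b U) : SmoothCOn n (fun x => (⟨a x, b x⟩ : ℂ)) U := by
  have h := (Complex.equivRealProdCLM.symm.toContinuousLinearMap.contMDiff
    (n := ∞)).comp_contMDiffOn (ha.prodMk_space hb)
  refine h.congr fun x _ => ?_
  apply Complex.ext <;> simp

theorem smooth_bilin
    {B : Π x : M, TangentSpace (𝓡 n) x →L[ℝ] TangentSpace (𝓡 n) x →L[ℝ] ℝ}
    (hB : ContMDiff (𝓡 n)
      ((𝓡 n).prod 𝓘(ℝ, EuclideanSpace ℝ (Fin n) →L[ℝ] EuclideanSpace ℝ (Fin n) →L[ℝ] ℝ)) ∞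
      (fun x => TotalSpace.mk'
        (EuclideanSpace ℝ (Fin n) →L[ℝ] EuclideanSpace ℝ (Fin n) →L[ℝ] ℝ) x (B x)))
    {X Y : Π x : M, TangentSpace (𝓡 n) x}
    (hX : SmoothFieldOn X U) (hY : SmoothFieldOn Y U) :
    ContMDiffOn (𝓡 n) 𝓘(ℝ, ℝ) ∞ (fun y => B y (X y) (Y y)) U := by
  have : ContMDiffOn (𝓡 n) ((𝓡 n).prod 𝓘(ℝ, ℝ)) ∞
      (fun m ↦ TotalSpace.mk' ℝ (E := Bundle.Trivial M ℝ) m (B m (X m) (Y m))) U := by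
    apply ContMDiffOn.clm_bundle_apply₂ (F₁ := EuclideanSpace ℝ (Fin n))
      (F₂ := EuclideanSpace ℝ (Fin n))
    · exact hB.contMDiffOn
    · exact hX
    · exact hY
  intro x hx
  have h := this x hx
  rw [contMDiffWithinAt_totalSpace] at h
  exact h.2

theorem smooth_g (g : PseudoRiemannianMetric n M) {X Y : Π x : M, TangentSpace (𝓡 n) x}
    (hX : SmoothFieldOn X U) (hY : SmoothFieldOn Y U) :
    ContMDiffOn (𝓡 n) 𝓘(ℝ, ℝ) ∞ (fun y => g.val y (X y) (Y y)) U :=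
  smooth_bilin g.contMDiff hX hY

theorem smooth_φ (φ : TwoForm n M) {X Y : Π x : M, TangentSpace (𝓡 n) x}
    (hX : SmoothFieldOn X U) (hY : SmoothFieldOn Y U) :
    ContMDiffOn (𝓡 n) 𝓘(ℝ, ℝ) ∞ (fun y => φ.val y (X y) (Y y)) U :=
  smooth_bilin φ.contMDiff hX hY

theorem smooth_cval (g : PseudoRiemannianMetric n M)
    {Z W : Π x : M, ℂ ⊗[ℝ] TangentSpace (𝓡 n) x}
    (hZ : SmoothCFieldOn Z U) (hW : SmoothCFieldOn W U) :
    SmoothCOn n (fun x => g.cval x (Z x) (W x)) U := by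
  simp only [cval_eq]
  exact smoothCOn_mk ((smooth_g g hZ.1 hW.1).sub (smooth_g g hZ.2 hW.2))
    ((smooth_g g hZ.1 hW.2).add (smooth_g g hZ.2 hW.1))

theorem SmoothFieldOn.mono {X : Π x : M, TangentSpace (𝓡 n) x} {V : Set M}
    (hX : SmoothFieldOn X U) (h : V ⊆ U) : SmoothFieldOn X V := ContMDiffOn.mono hX h

theorem SmoothFieldOn.diffAt {X : Π x : M, TangentSpace (𝓡 n) x}
    (hX : SmoothFieldOn X U) (hU : IsOpen U) {x : M} (hx : x ∈ U) : DiffFieldAt X x :=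
  (ContMDiffOn.contMDiffAt hX (hU.mem_nhds hx)).mdifferentiableAt (by simp)

theorem SmoothFieldOn.add {X Y : Π x : M, TangentSpace (𝓡 n) x}
    (hX : SmoothFieldOn X U) (hY : SmoothFieldOn Y U) : SmoothFieldOn (fun x => X x + Y x) U :=
  ContMDiffOn.add_section hX hY

theorem SmoothFieldOn.sub {X Y : Π x : M, TangentSpace (𝓡 n) x}
    (hX : SmoothFieldOn X U) (hY : SmoothFieldOn Y U) : SmoothFieldOn (fun x => X x - Y x) U :=
  ContMDiffOn.sub_section hX hY

theorem SmoothFieldOn.neg {X : Π x : M, TangentSpace (𝓡 n) x}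
    (hX : SmoothFieldOn X U) : SmoothFieldOn (fun x => - X x) U :=
  ContMDiffOn.neg_section hX

theorem SmoothFieldOn.smul {X : Π x : M, TangentSpace (𝓡 n) x} {f : M → ℝ}
    (hf : ContMDiffOn (𝓡 n) 𝓘(ℝ, ℝ) ∞ f U)
    (hX : SmoothFieldOn X U) : SmoothFieldOn (fun x => f x • X x) U :=
  ContMDiffOn.smul_section hf hX

theorem SmoothFieldOn.sum {ι : Type*} {s : Finset ι} {X : ι → Π x : M, TangentSpace (𝓡 n) x}
    (hX : ∀ i ∈ s, SmoothFieldOn (X i) U) : SmoothFieldOn (fun x => ∑ i ∈ s, X i x) U :=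
  ContMDiffOn.sum_section hX

theorem smoothFieldOn_zero : SmoothFieldOn (fun _ => 0 : Π x : M, TangentSpace (𝓡 n) x) U :=
  (SmoothFieldOn.sum (s := (∅ : Finset (Fin 0))) (X := fun _ _ => 0) (by simp)).congr (by simp)

theorem SmoothCFieldOn.mono {Z : Π x : M, ℂ ⊗[ℝ] TangentSpace (𝓡 n) x} {V : Set M}
    (hZ : SmoothCFieldOn Z U) (h : V ⊆ U) : SmoothCFieldOn Z V := ⟨hZ.1.mono h, hZ.2.mono h⟩

theorem SmoothCFieldOn.smul {Z : Π x : M, ℂ ⊗[ℝ] TangentSpace (𝓡 n) x} {f : M → ℂ}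
    (hf : SmoothCOn n f U) (hZ : SmoothCFieldOn Z U) : SmoothCFieldOn (fun x => f x • Z x) U := by
  constructor
  · simp only [cre_smul]
    exact (SmoothFieldOn.smul hf.re hZ.1).sub (SmoothFieldOn.smul hf.im hZ.2)
  · simp only [cim_smul]
    exact (SmoothFieldOn.smul hf.re hZ.2).add (SmoothFieldOn.smul hf.im hZ.1)

theorem SmoothCFieldOn.const_smul {Z : Π x : M, ℂ ⊗[ℝ] TangentSpace (𝓡 n) x} (c : ℂ)
    (hZ : SmoothCFieldOn Z U) : SmoothCFieldOn (fun x => c • Z x) U :=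
  SmoothCFieldOn.smul contMDiffOn_const hZ

theorem SmoothCFieldOn.sum {ι : Type*} {s : Finset ι}
    {Z : ι → Π x : M, ℂ ⊗[ℝ] TangentSpace (𝓡 n) x}
    (hZ : ∀ i ∈ s, SmoothCFieldOn (Z i) U) : SmoothCFieldOn (fun x => ∑ i ∈ s, Z i x) U := by
  constructor
  · simp only [map_sum]; exact SmoothFieldOn.sum fun i hi => (hZ i hi).1
  · simp only [map_sum]; exact SmoothFieldOn.sum fun i hi => (hZ i hi).2

theorem smoothCFieldOn_cmk {X Y : Π x : M, TangentSpace (𝓡 n) x}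
    (hX : SmoothFieldOn X U) (hY : SmoothFieldOn Y U) :
    SmoothCFieldOn (fun x => cmk (X x) (Y x)) U := by
  constructor
  · simpa only [cre_cmk] using hX
  · simpa only [cim_cmk] using hY

theorem exists_local_frame (p : M) :
    ∃ (U : Set M) (e : Fin n → Π x : M, TangentSpace (𝓡 n) x), IsOpen U ∧ p ∈ U ∧
      (∀ i, SmoothFieldOn (e i) U) ∧ ∀ x ∈ U, LinearIndependent ℝ (fun i => e i x) ∧
        ⊤ ≤ Submodule.span ℝ (range fun i => e i x) := by
  let t := trivializationAt (EuclideanSpace ℝ (Fin n)) (TangentSpace (𝓡 n) : M → Type _) p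
  let b := (EuclideanSpace.basisFun (Fin n) ℝ).toBasis
  have h := t.isLocalFrameOn_localFrame_baseSet (𝓡 n) ∞ b
  exact ⟨t.baseSet, t.localFrame b, t.open_baseSet, mem_baseSet_trivializationAt _ _ p,
    h.contMDiffOn, fun x hx => ⟨h.linearIndependent hx, h.generating hx⟩⟩

end Smoothness

/-! ### Translation between tangent spaces and abstract linear algebra. -/

section Eigenbasis

variable {m : ℕ} {M : Type*} [TopologicalSpace M]
  [ChartedSpace (EuclideanSpace ℝ (Fin (2 * m))) M] [IsManifold (𝓡 (2 * m)) ∞ M]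
  {g : PseudoRiemannianMetric (2 * m) M} {φ : TwoForm (2 * m) M} {x : M}
  {v w : Fin m → ℂ ⊗[ℝ] TangentSpace (𝓡 (2 * m)) x} {lam : Fin m → ℂ}

theorem IsNullEigenbasis.nullEigen (h : IsNullEigenbasis g φ x v w lam) :
    NullEigen (g.cval x) (φ.cval x) v w lam :=
  ⟨h.g_vv, h.g_ww, h.g_vw, h.φ_vv, h.φ_ww, h.φ_vw⟩

theorem NullEigen.isNullEigenbasis (h : NullEigen (g.cval x) (φ.cval x) v w lam) :
    IsNullEigenbasis g φ x v w lam :=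
  ⟨h.vv, h.ww, h.vw, h.Ωvv, h.Ωww, h.Ωvw⟩

theorem evs_eq_eigenvalues (g : PseudoRiemannianMetric (2 * m) M) (φ : TwoForm (2 * m) M) (x : M) :
    evs (g.cval x) (φ.cval x) = eigenvalues g φ x := rfl

theorem pick_eq_sel (v w : Fin m → ℂ ⊗[ℝ] TangentSpace (𝓡 (2 * m)) x) (s : Fin m → Bool) :
    pick v w s = sel v w s := rfl

end Eigenbasis

/-! ### Smooth dependence of simple eigenpairs on a matrix pencil. -/

section Implicit

variable {k : ℕ}

/-- The equation for an eigenvector of a matrix pencil, normalised by a linear functional `a`. -/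
def pencilMap (a : Fin k → ℂ)
    (q : ((Fin k → Fin k → ℂ) × (Fin k → Fin k → ℂ)) × ((Fin k → ℂ) × ℂ)) : (Fin k → ℂ) × ℂ :=
  (fun i => ∑ j, q.1.1 i j * q.2.1 j - q.2.2 * ∑ j, q.1.2 i j * q.2.1 j, ∑ j, a j * q.2.1 j)

theorem contDiff_pencilMap (a : Fin k → ℂ) : ContDiff ℂ ω (pencilMap a) := by
  unfold pencilMap
  fun_prop

/-- The differential in a direction that leaves the pencil fixed is the derivative along the
straight line in that direction, where the map is an explicit polynomial in `t`. -/
theorem fderiv_pencilMap (a : Fin k → ℂ) (Φ G : Fin k → Fin k → ℂ) (u δ : Fin k → ℂ) (z κ : ℂ) :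
    fderiv ℂ (pencilMap a) ((Φ, G), (u, z)) (0, (δ, κ)) =
      (fun i => ∑ j, Φ i j * δ j - (κ * ∑ j, G i j * u j + z * ∑ j, G i j * δ j),
        ∑ j, a j * δ j) := by
  have hd : HasFDerivAt (pencilMap a) (fderiv ℂ (pencilMap a) ((Φ, G), (u, z)))
      ((Φ, G), (u, z)) :=
    ((contDiff_pencilMap a).differentiable (by simp) _).hasFDerivAt
  have hl : HasDerivAt (fun t : ℂ => (((Φ, G), (u, z)) + t • ((0, (δ, κ)) :
      ((Fin k → Fin k → ℂ) × (Fin k → Fin k → ℂ)) × ((Fin k → ℂ) × ℂ)))) (0, (δ, κ)) 0 := by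
    simpa using ((hasDerivAt_id (0 : ℂ)).smul_const ((0, (δ, κ)) :
      ((Fin k → Fin k → ℂ) × (Fin k → Fin k → ℂ)) × ((Fin k → ℂ) × ℂ))).const_add
        (((Φ, G), (u, z)) : ((Fin k → Fin k → ℂ) × (Fin k → Fin k → ℂ)) × ((Fin k → ℂ) × ℂ))
  have h1 := HasFDerivAt.comp_hasDerivAt_of_eq (0 : ℂ) hd hl (by simp)
  have hs : ∀ c : Fin k → ℂ,
      HasDerivAt (fun t : ℂ => ∑ j, c j * (u j + t * δ j)) (∑ j, c j * δ j) 0 := fun c => by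
    refine HasDerivAt.fun_sum fun j _ => ?_
    simpa using (((hasDerivAt_id (0 : ℂ)).mul_const (δ j)).const_add (u j)).const_mul (c j)
  have h2 : HasDerivAt (pencilMap a ∘ fun t : ℂ => (((Φ, G), (u, z)) + t • ((0, (δ, κ)) :
      ((Fin k → Fin k → ℂ) × (Fin k → Fin k → ℂ)) × ((Fin k → ℂ) × ℂ))))
      (fun i => ∑ j, Φ i j * δ j - (κ * ∑ j, G i j * u j + z * ∑ j, G i j * δ j),
        ∑ j, a j * δ j) 0 := by
    simp only [Function.comp_def, pencilMap, Prod.smul_mk, Prod.mk_add_mk, smul_zero, add_zero,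
      Pi.add_apply, Pi.smul_apply, smul_eq_mul]
    refine HasDerivAt.prodMk (hasDerivAt_pi.2 fun i => ?_) (hs a)
    refine (hs (Φ i)).sub ?_
    have hz : HasDerivAt (fun t : ℂ => z + t * κ) κ 0 := by
      simpa using ((hasDerivAt_id (0 : ℂ)).mul_const κ).const_add z
    have h := hz.mul (hs (G i))
    simp only [zero_mul, add_zero] at h
    exact h
  exact h1.unique h2

/-- The hypothesis `hinj` says that the normalised eigenvector equation has injective differential
in `(u, z)`, which is the infinitesimal form of simplicity. The implicit function theorem then
solves for `(u, z)` in terms of the pencil. -/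
theorem exists_smooth_eigenpair {Φ₀ G₀ : Fin k → Fin k → ℂ} {u₀ : Fin k → ℂ} {z₀ : ℂ}
    (a : Fin k → ℂ) (h0 : ∀ i, ∑ j, Φ₀ i j * u₀ j = z₀ * ∑ j, G₀ i j * u₀ j)
    (hinj : ∀ (δ : Fin k → ℂ) (κ : ℂ), (∀ i, ∑ j, Φ₀ i j * δ j =
      κ * ∑ j, G₀ i j * u₀ j + z₀ * ∑ j, G₀ i j * δ j) → ∑ j, a j * δ j = 0 → δ = 0 ∧ κ = 0) :
    ∃ O : Set ((Fin k → Fin k → ℂ) × (Fin k → Fin k → ℂ)), IsOpen O ∧ (Φ₀, G₀) ∈ O ∧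
      ∃ (Y : (Fin k → Fin k → ℂ) × (Fin k → Fin k → ℂ) → (Fin k → ℂ))
        (Λ : (Fin k → Fin k → ℂ) × (Fin k → Fin k → ℂ) → ℂ),
        ContDiffOn ℝ ∞ Y O ∧ ContDiffOn ℝ ∞ Λ O ∧ Y (Φ₀, G₀) = u₀ ∧ Λ (Φ₀, G₀) = z₀ ∧
          ∀ q ∈ O, ∀ i, ∑ j, q.1 i j * Y q j = Λ q * ∑ j, q.2 i j * Y q j := by
  let p₀ : ((Fin k → Fin k → ℂ) × (Fin k → Fin k → ℂ)) × ((Fin k → ℂ) × ℂ) := ((Φ₀, G₀), (u₀, z₀))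
  -- Regularity `ω` rather than `∞`: analyticity at a point holds on a neighbourhood, and real
  -- smoothness follows by restriction of scalars.
  have cdf : ContDiffAt ℂ ω (pencilMap a) p₀ := (contDiff_pencilMap a).contDiffAt
  let T := fderiv ℂ (pencilMap a) p₀ ∘L
    .inr ℂ ((Fin k → Fin k → ℂ) × (Fin k → Fin k → ℂ)) ((Fin k → ℂ) × ℂ)
  have hT : Function.Injective T.toLinearMap := by
    rw [← LinearMap.ker_eq_bot, LinearMap.ker_eq_bot']
    rintro ⟨δ, κ⟩ h
    have h' : fderiv ℂ (pencilMap a) p₀ (0, (δ, κ)) = 0 := h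
    rw [fderiv_pencilMap] at h'
    have h1 := congrArg Prod.fst h'
    have h2 := congrArg Prod.snd h'
    have := hinj δ κ (fun i => sub_eq_zero.1 (congrFun h1 i)) h2
    rw [this.1, this.2]; rfl
  -- Unknowns and equations both range over `(Fin k → ℂ) × ℂ`, so injectivity suffices.
  have if₂ : T.IsInvertible :=
    ⟨(LinearEquiv.ofInjectiveEndo T.toLinearMap hT).toContinuousLinearEquiv, by ext <;> rfl⟩
  let ψ := cdf.implicitFunction (by simp) if₂
  have h1 : ContDiffAt ℂ ω ψ p₀.1 := cdf.contDiffAt_implicitFunction (by simp) if₂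
  have h2 : ∀ᶠ q in 𝓝 p₀.1, ContDiffAt ℂ ω ψ q := h1.eventually (by simp)
  have h3 : ∀ᶠ q in 𝓝 p₀.1, pencilMap a (q, ψ q) = pencilMap a p₀ :=
    cdf.eventually_apply_implicitFunction (by simp) if₂
  have h4 : ψ p₀.1 = p₀.2 := cdf.implicitFunction_apply_self (by simp) if₂
  obtain ⟨O, hO, hOo, hOm⟩ := eventually_nhds_iff.1 (h2.and h3)
  have h5 : ContDiffOn ℝ ∞ ψ O := fun q hq =>
    (((hO q hq).1.restrict_scalars ℝ).of_le (by simp)).contDiffWithinAt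
  refine ⟨O, hOo, hOm, fun q => (ψ q).1, fun q => (ψ q).2, contDiff_fst.comp_contDiffOn h5,
    contDiff_snd.comp_contDiffOn h5, by simp [p₀] at h4; simp [h4],
    by simp [p₀] at h4; simp [h4], ?_⟩
  intro q hq i
  have h6 := congrFun (congrArg Prod.fst (hO q hq).2) i
  simp only [pencilMap, p₀, h0 i, sub_self] at h6
  exact sub_eq_zero.1 h6

end Implicit

/-! ### Local smooth eigenvector fields. -/

section LocalEigenvectors

variable {n : ℕ} {M : Type*} [TopologicalSpace M]
  [ChartedSpace (EuclideanSpace ℝ (Fin n)) M] [IsManifold (𝓡 n) ∞ M]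

theorem cval_tmul (g : PseudoRiemannianMetric n M) (x : M) (a b : TangentSpace (𝓡 n) x) :
    g.cval x (1 ⊗ₜ a) (1 ⊗ₜ b) = (g.val x a b : ℂ) := by
  rw [cval_eq]; apply Complex.ext <;> simp

theorem TwoForm.cval_tmul (φ : TwoForm n M) (x : M) (a b : TangentSpace (𝓡 n) x) :
    φ.cval x (1 ⊗ₜ a) (1 ⊗ₜ b) = (φ.val x a b : ℂ) := by
  rw [TwoForm.cval_eq]; apply Complex.ext <;> simp

theorem smoothCOn_ofReal {f : M → ℝ} {U : Set M} (hf : ContMDiffOn (𝓡 n) 𝓘(ℝ, ℝ) ∞ f U) :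
    SmoothCOn n (fun x => (f x : ℂ)) U :=
  smoothCOn_mk hf contMDiffOn_const

theorem smoothCFieldOn_tmul {X : Π x : M, TangentSpace (𝓡 n) x} {U : Set M}
    (hX : SmoothFieldOn X U) : SmoothCFieldOn (fun x => (1 : ℂ) ⊗ₜ[ℝ] X x) U := by
  constructor
  · simpa using hX
  · simpa using smoothFieldOn_zero

/-- In a local frame `φ` and `g` become matrices depending smoothly on the point, and the solution
for general pencils is pulled back along them. The hypothesis `hs` excludes generalised eigenvectors
and further eigenvectors. -/
theorem exists_local_eigenpair (g : PseudoRiemannianMetric n M) (φ : TwoForm n M) {p : M}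
    {u₀ : ℂ ⊗[ℝ] TangentSpace (𝓡 n) p} {z₀ : ℂ} (hu₀ : u₀ ≠ 0)
    (h0 : ∀ A, φ.cval p A u₀ = z₀ * g.cval p A u₀)
    (hs : ∀ (u : ℂ ⊗[ℝ] TangentSpace (𝓡 n) p) (κ : ℂ),
      (∀ A, φ.cval p A u = κ * g.cval p A u₀ + z₀ * g.cval p A u) →
        κ = 0 ∧ ∃ c : ℂ, u = c • u₀) :
    ∃ U : Set M, IsOpen U ∧ p ∈ U ∧ ∃ (Z : Π x : M, ℂ ⊗[ℝ] TangentSpace (𝓡 n) x) (Λ : M → ℂ),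
      SmoothCFieldOn Z U ∧ SmoothCOn n Λ U ∧ Z p = u₀ ∧ Λ p = z₀ ∧
        ∀ x ∈ U, ∀ A, φ.cval x A (Z x) = Λ x * g.cval x A (Z x) := by
  obtain ⟨U, e, hUo, hpU, hes, hb⟩ := exists_local_frame (n := n) p
  let b : ∀ x ∈ U, Basis (Fin n) ℝ (TangentSpace (𝓡 n) x) := fun x hx =>
    Basis.mk (hb x hx).1 (hb x hx).2
  let B : ∀ x ∈ U, Basis (Fin n) ℂ (ℂ ⊗[ℝ] TangentSpace (𝓡 n) x) := fun x hx =>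
    Algebra.TensorProduct.basis ℂ (b x hx)
  have hB : ∀ x hx i, B x hx i = 1 ⊗ₜ e i x := fun x hx i => by
    simp [B, b, Algebra.TensorProduct.basis_apply]
  let q : M → (Fin n → Fin n → ℂ) × (Fin n → Fin n → ℂ) := fun x =>
    (fun i j => (φ.val x (e i x) (e j x) : ℂ), fun i j => (g.val x (e i x) (e j x) : ℂ))
  have hq : ContMDiffOn (𝓡 n) 𝓘(ℝ, (Fin n → Fin n → ℂ) × (Fin n → Fin n → ℂ)) ∞ q U :=
    ContMDiffOn.prodMk_space
      (contMDiffOn_pi_space.2 fun i => contMDiffOn_pi_space.2 fun j =>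
        smoothCOn_ofReal (smooth_φ φ (hes i) (hes j)))
      (contMDiffOn_pi_space.2 fun i => contMDiffOn_pi_space.2 fun j =>
        smoothCOn_ofReal (smooth_g g (hes i) (hes j)))
  have hφsum : ∀ x ∈ U, ∀ (i : Fin n) (c : Fin n → ℂ),
      φ.cval x (1 ⊗ₜ e i x) (∑ j, c j • (1 ⊗ₜ[ℝ] e j x)) = ∑ j, (q x).1 i j * c j := by
    intro x hx i c
    simp [map_sum, TwoForm.cval_tmul, q, mul_comm]
  have hgsum : ∀ x ∈ U, ∀ (i : Fin n) (c : Fin n → ℂ),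
      g.cval x (1 ⊗ₜ e i x) (∑ j, c j • (1 ⊗ₜ[ℝ] e j x)) = ∑ j, (q x).2 i j * c j := by
    intro x hx i c
    simp [map_sum, cval_tmul, q, mul_comm]
  let c₀ : Fin n → ℂ := (B p hpU).equivFun u₀
  have hc₀ : ∑ j, c₀ j • (1 ⊗ₜ[ℝ] e j p) = u₀ := by
    simp only [← hB p hpU]; exact (B p hpU).sum_equivFun u₀
  have hne : ∃ j₀, c₀ j₀ ≠ 0 := by
    by_contra! h
    apply hu₀; rw [← hc₀]; simp [h]
  obtain ⟨j₀, hj₀⟩ := hne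
  -- The normalising functional is a coordinate that does not vanish at `u₀`. The kernel of the
  -- linearised problem lies on the line of `u₀`, and this functional is nonzero there.
  obtain ⟨O, hO, hmO, Y, Λ, hY, hΛ, hY0, hΛ0, heq⟩ := exists_smooth_eigenpair
    (Φ₀ := (q p).1) (G₀ := (q p).2) (u₀ := c₀) (z₀ := z₀) (Pi.single j₀ 1) (fun i => by
      rw [← hφsum p hpU, ← hgsum p hpU, hc₀, h0]) (fun δ κ h hδ => by
      have hA : ∀ A, φ.cval p A (∑ j, δ j • (1 ⊗ₜ[ℝ] e j p))
          = κ * g.cval p A u₀ + z₀ * g.cval p A (∑ j, δ j • (1 ⊗ₜ[ℝ] e j p)) := by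
        intro A
        have : (φ.cval p).flip (∑ j, δ j • (1 ⊗ₜ[ℝ] e j p)) = κ • (g.cval p).flip u₀
            + z₀ • (g.cval p).flip (∑ j, δ j • (1 ⊗ₜ[ℝ] e j p)) := by
          refine (B p hpU).ext fun i => ?_
          rw [hB p hpU]
          have := h i
          rw [← hφsum p hpU, ← hgsum p hpU, ← hgsum p hpU, hc₀] at this
          simpa using this
        simpa using LinearMap.congr_fun this A
      obtain ⟨h1, c, h2⟩ := hs _ κ hA
      refine ⟨?_, h1⟩
      have h3 : δ = c • c₀ := by
        have := congrArg (B p hpU).equivFun h2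
        rw [map_smul] at this
        rw [← this, ← LinearEquiv.symm_apply_eq, Basis.equivFun_symm_apply]
        simp only [hB]
      have h4 : c * c₀ j₀ = 0 := by
        rw [h3] at hδ
        simpa [Pi.single_apply] using hδ
      rw [h3, (mul_eq_zero.1 h4).resolve_right hj₀, zero_smul])
  have hopen : IsOpen (U ∩ q ⁻¹' O) := hq.continuousOn.isOpen_inter_preimage hUo hO
  have hYs : ContMDiffOn (𝓡 n) 𝓘(ℝ, Fin n → ℂ) ∞ (Y ∘ q) (U ∩ q ⁻¹' O) :=
    hY.contMDiffOn.comp (hq.mono inter_subset_left) inter_subset_right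
  have hΛs : ContMDiffOn (𝓡 n) 𝓘(ℝ, ℂ) ∞ (Λ ∘ q) (U ∩ q ⁻¹' O) :=
    hΛ.contMDiffOn.comp (hq.mono inter_subset_left) inter_subset_right
  refine ⟨U ∩ q ⁻¹' O, hopen, ⟨hpU, hmO⟩, fun x => ∑ j, Y (q x) j • (1 ⊗ₜ[ℝ] e j x), Λ ∘ q,
    SmoothCFieldOn.sum fun j _ => SmoothCFieldOn.smul (contMDiffOn_pi_space.1 hYs j)
      (smoothCFieldOn_tmul ((hes j).mono inter_subset_left)), hΛs, ?_, hΛ0, ?_⟩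
  · have : Y (q p) = c₀ := hY0
    simp only [this, hc₀]
  · rintro x ⟨hx, hxO⟩ A
    have : (φ.cval x).flip (∑ j, Y (q x) j • (1 ⊗ₜ[ℝ] e j x))
        = Λ (q x) • (g.cval x).flip (∑ j, Y (q x) j • (1 ⊗ₜ[ℝ] e j x)) := by
      refine (B x hx).ext fun i => ?_
      rw [hB x hx]
      have := heq _ hxO i
      rw [← hφsum x hx, ← hgsum x hx] at this
      simpa using this
    simpa using LinearMap.congr_fun this A

theorem SmoothCOn.inv {f : M → ℂ} {U : Set M} (hf : SmoothCOn n f U) (h : ∀ x ∈ U, f x ≠ 0) :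
    SmoothCOn n (fun x => (f x)⁻¹) U := by
  have h1 : ContDiffOn ℝ ∞ (fun z : ℂ => z⁻¹) {0}ᶜ := fun z hz =>
    (contDiffAt_inv ℝ hz).contDiffWithinAt
  exact h1.contMDiffOn.comp hf fun x hx => h x hx

end LocalEigenvectors

/-! ### Local smooth null eigenbases. -/

section LocalEigenbasis

variable {m : ℕ} {M : Type*} [TopologicalSpace M]
  [ChartedSpace (EuclideanSpace ℝ (Fin (2 * m))) M] [IsManifold (𝓡 (2 * m)) ∞ M]
  {g : PseudoRiemannianMetric (2 * m) M} {φ : TwoForm (2 * m) M}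

/-- Pairing the linearised eigenvector equation with `v₀ μ`, the opposite eigenvector, cancels the
terms in `u` and leaves `κ = 0`. Then `u` is an eigenvector for a simple eigenvalue. -/
theorem NullEigen.exists_local_eigenpair {p : M} (hc : (eigenvalues g φ p).ncard = 2 * m)
    {v₀ w₀ : Fin m → ℂ ⊗[ℝ] TangentSpace (𝓡 (2 * m)) p} {lam₀ : Fin m → ℂ}
    (h : NullEigen (g.cval p) (φ.cval p) v₀ w₀ lam₀) (μ : Fin m) :
    ∃ U : Set M, IsOpen U ∧ p ∈ U ∧ ∃ (Z : Π x : M, ℂ ⊗[ℝ] TangentSpace (𝓡 (2 * m)) x) (Λ : M → ℂ),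
      SmoothCFieldOn Z U ∧ SmoothCOn (2 * m) Λ U ∧ Z p = w₀ μ ∧ Λ p = lam₀ μ ∧
        ∀ x ∈ U, ∀ A, φ.cval x A (Z x) = Λ x * g.cval x A (Z x) := by
  have hB := cval_symm g p
  have hΩ := φ.cval_skew p
  have hd := finrank_ctangent (n := 2 * m) p
  refine CKY.exists_local_eigenpair g φ ((h.linearIndependent hB).ne_zero (Sum.inr μ))
    (fun A => h.Ω_w hB hd A μ) fun u κ hu => ?_
  have h1 := hu (v₀ μ)
  rw [hΩ, h.Ω_v hB hΩ hd, h.vw, hB (v₀ μ)] at h1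
  have hκ : κ = 0 := by simp at h1; exact h1
  refine ⟨hκ, _, h.eigenvector_w hB hΩ hd hc (μ := μ) fun A => ?_⟩
  rw [hu, hκ]; ring

theorem exists_local_nullEigenbasis {p : M} (hc : (eigenvalues g φ p).ncard = 2 * m)
    {v₀ w₀ : Fin m → ℂ ⊗[ℝ] TangentSpace (𝓡 (2 * m)) p} {lam₀ : Fin m → ℂ}
    (h : NullEigen (g.cval p) (φ.cval p) v₀ w₀ lam₀) :
    ∃ U : Set M, IsOpen U ∧ p ∈ U ∧
      ∃ (v w : Fin m → Π x : M, ℂ ⊗[ℝ] TangentSpace (𝓡 (2 * m)) x) (lam : Fin m → M → ℂ),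
        (∀ μ, SmoothCFieldOn (v μ) U) ∧ (∀ μ, SmoothCFieldOn (w μ) U) ∧
        (∀ μ, SmoothCOn (2 * m) (lam μ) U) ∧ (∀ μ, v μ p = v₀ μ) ∧ (∀ μ, w μ p = w₀ μ) ∧
        (∀ μ, lam μ p = lam₀ μ) ∧
        ∀ x ∈ U, NullEigen (g.cval x) (φ.cval x) (fun μ => v μ x) (fun μ => w μ x)
          (fun μ => lam μ x) := by
  have hB := fun x => cval_symm g x
  have hΩ := fun x => φ.cval_skew x
  have hd := fun x : M => finrank_ctangent (n := 2 * m) x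
  choose U₁ hU₁ hp₁ w lam hw hlam hw0 hlam0 hwe using fun μ => h.exists_local_eigenpair hc μ
  -- The `v μ` come from the swapped basis, with eigenvalue functions `lam'`. That `lam' = -lam` is
  -- used at `p` only; nearby, nonvanishing sums suffice for orthogonality.
  choose U₂ hU₂ hp₂ v lam' hv hlam' hv0 hlam0' hve using
    fun μ => (h.swap (hB p) (hΩ p)).exists_local_eigenpair hc μ
  let U : Set M := (⋂ μ, U₁ μ) ∩ ⋂ μ, U₂ μ
  have hU : IsOpen U := (isOpen_iInter_of_finite hU₁).inter (isOpen_iInter_of_finite hU₂)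
  have hpU : p ∈ U := ⟨mem_iInter.2 hp₁, mem_iInter.2 hp₂⟩
  have hs1 : ∀ μ, U ⊆ U₁ μ := fun μ => inter_subset_left.trans (iInter_subset _ μ)
  have hs2 : ∀ μ, U ⊆ U₂ μ := fun μ => inter_subset_right.trans (iInter_subset _ μ)
  have hr : ∀ μ, SmoothCOn (2 * m) (fun x => g.cval x (v μ x) (w μ x)) U := fun μ =>
    smooth_cval g ((hv μ).mono (hs2 μ)) ((hw μ).mono (hs1 μ))
  have hcl : ∀ μ, ContinuousAt (lam μ) p := fun μ =>
    ((hlam μ).continuousOn.mono (hs1 μ)).continuousAt (hU.mem_nhds hpU)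
  have hcl' : ∀ μ, ContinuousAt (lam' μ) p := fun μ =>
    ((hlam' μ).continuousOn.mono (hs2 μ)).continuousAt (hU.mem_nhds hpU)
  have hcr : ∀ μ, ContinuousAt (fun x => g.cval x (v μ x) (w μ x)) p := fun μ =>
    (hr μ).continuousOn.continuousAt (hU.mem_nhds hpU)
  have hadd := h.add_ne_zero (hB p) (hΩ p) (hd p) hc
  have hinj := h.lam_injective (hB p) (hΩ p) (hd p) hc
  have e1 : ∀ᶠ x in 𝓝 p, ∀ μ ν, lam μ x + lam ν x ≠ 0 :=
    eventually_all.2 fun μ => eventually_all.2 fun ν =>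
      ((hcl μ).add (hcl ν)).eventually_ne (by simpa [hlam0] using hadd μ ν)
  have e2 : ∀ᶠ x in 𝓝 p, ∀ μ ν, lam' μ x + lam' ν x ≠ 0 :=
    eventually_all.2 fun μ => eventually_all.2 fun ν =>
      ((hcl' μ).add (hcl' ν)).eventually_ne (by
        change lam' μ p + lam' ν p ≠ 0
        rw [hlam0', hlam0']
        exact fun h0 => hadd μ ν (by linear_combination -h0))
  -- The diagonal has to be excluded, since `lam' μ + lam μ` vanishes at `p`.
  have e3 : ∀ᶠ x in 𝓝 p, ∀ μ ν, μ ≠ ν → lam' μ x + lam ν x ≠ 0 :=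
    eventually_all.2 fun μ => eventually_all.2 fun ν => by
      by_cases hμν : μ = ν
      · exact Eventually.of_forall fun x hne => absurd hμν hne
      · refine (((hcl' μ).add (hcl ν)).eventually_ne ?_).mono fun x hx _ => hx
        change lam' μ p + lam ν p ≠ 0
        rw [hlam0', hlam0]
        exact fun h0 => hμν (hinj (by linear_combination -h0))
  have e4 : ∀ᶠ x in 𝓝 p, ∀ μ, g.cval x (v μ x) (w μ x) ≠ 0 :=
    eventually_all.2 fun μ => (hcr μ).eventually_ne (by simp [hv0, hw0, h.vw])
  obtain ⟨O, hO, hOo, hpO⟩ := eventually_nhds_iff.1 (e1.and (e2.and (e3.and e4)))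
  have orth : ∀ (x : M) (A C : ℂ ⊗[ℝ] TangentSpace (𝓡 (2 * m)) x) (z y : ℂ),
      (∀ D, φ.cval x D A = z * g.cval x D A) → (∀ D, φ.cval x D C = y * g.cval x D C) →
      z + y ≠ 0 → g.cval x A C = 0 := by
    intro x A C z y hA hC hne
    have e := hC A
    rw [hΩ, hA, hB x C A] at e
    have : (z + y) * g.cval x A C = 0 := by linear_combination -e
    exact (mul_eq_zero.1 this).resolve_left hne
  refine ⟨U ∩ O, hU.inter hOo, ⟨hpU, hpO⟩,
    fun μ x => (g.cval x (v μ x) (w μ x))⁻¹ • v μ x, w, lam, fun μ => ?_, fun μ => ?_, fun μ => ?_,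
    fun μ => ?_, hw0, hlam0, ?_⟩
  · exact SmoothCFieldOn.smul (SmoothCOn.inv ((hr μ).mono inter_subset_left) fun x hx => (hO x hx.2).2.2.2 μ)
      ((hv μ).mono (inter_subset_left.trans (hs2 μ)))
  · exact (hw μ).mono (inter_subset_left.trans (hs1 μ))
  · exact (hlam μ).mono (inter_subset_left.trans (hs1 μ))
  · simp [hv0, hw0, h.vw]
  · rintro x ⟨hxU, hxO⟩
    obtain ⟨a1, a2, a3, a4⟩ := hO x hxO
    have hwe' := fun μ => hwe μ x (hs1 μ hxU)
    have hve' := fun μ => hve μ x (hs2 μ hxU)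
    have hvv : ∀ μ ν, g.cval x (v μ x) (v ν x) = 0 := fun μ ν =>
      orth x _ _ _ _ (hve' μ) (hve' ν) (a2 μ ν)
    have hww : ∀ μ ν, g.cval x (w μ x) (w ν x) = 0 := fun μ ν =>
      orth x _ _ _ _ (hwe' μ) (hwe' ν) (a1 μ ν)
    have hvw : ∀ μ ν, μ ≠ ν → g.cval x (v μ x) (w ν x) = 0 := fun μ ν hμν =>
      orth x _ _ _ _ (hve' μ) (hwe' ν) (a3 μ ν hμν)
    refine ⟨?_, hww, ?_, ?_, ?_, ?_⟩
    · intro μ ν; simp [hvv]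
    · intro μ ν
      by_cases hμν : μ = ν
      · subst hμν; simp [a4]
      · simp [hμν, hvw μ ν hμν]
    · intro μ ν; simp [hve', hvv]
    · intro μ ν; simp [hwe', hww]
    · intro μ ν
      by_cases hμν : μ = ν
      · subst hμν
        simp only [map_smul, LinearMap.smul_apply, hwe', smul_eq_mul, if_true]
        field_simp [a4]
      · simp [hμν, hwe', hvw μ ν hμν]

end LocalEigenbasis

/-! ### The complexified Levi-Civita connection and parallelism along a distribution. -/

section LeviCivita

variable {n : ℕ} {M : Type*} [TopologicalSpace M]
  [ChartedSpace (EuclideanSpace ℝ (Fin n)) M] [IsManifold (𝓡 n) ∞ M]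

theorem tangent_ext (g : PseudoRiemannianMetric n M) {x : M} {v w : TangentSpace (𝓡 n) x}
    (h : ∀ Z : Π x : M, TangentSpace (𝓡 n) x, DiffFieldAt Z x →
      g.val x v (Z x) = g.val x w (Z x)) : v = w := by
  rw [← sub_eq_zero]
  refine g.nondegenerate x _ fun u => ?_
  have hu : DiffFieldAt (FiberBundle.extend (EuclideanSpace ℝ (Fin n)) u) x :=
    FiberBundle.mdifferentiableAt_extend (𝓡 n) (EuclideanSpace ℝ (Fin n)) u
  have h1 := h _ hu
  rw [FiberBundle.extend_apply_self] at h1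
  simp [h1]

theorem leviCivita_metric (g : PseudoRiemannianMetric n M)
    {X Y Z : Π x : M, TangentSpace (𝓡 n) x} {x : M}
    (hX : DiffFieldAt X x) (hY : DiffFieldAt Y x) (hZ : DiffFieldAt Z x) :
    dirDeriv X (fun y => g.val y (Y y) (Z y)) x =
      g.val x (leviCivita g X Y x) (Z x) + g.val x (Y x) (leviCivita g X Z x) := by
  rw [leviCivita_spec g hX hY hZ, g.symm x (Y x), leviCivita_spec g hX hZ hY]
  have h : (fun y => g.val y (Z y) (Y y)) = fun y => g.val y (Y y) (Z y) :=
    funext fun y => g.symm y _ _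
  have h2 := VectorField.mlieBracket_swap_apply (I := 𝓡 n) (V := Y) (W := Z) (x := x)
  simp only [koszul, h, h2, map_neg, neg_apply]
  ring

theorem leviCivita_torsion (g : PseudoRiemannianMetric n M)
    {X Y : Π x : M, TangentSpace (𝓡 n) x} {x : M}
    (hX : DiffFieldAt X x) (hY : DiffFieldAt Y x) :
    VectorField.mlieBracket (𝓡 n) X Y x = leviCivita g X Y x - leviCivita g Y X x := by
  refine tangent_ext g fun Z hZ => ?_
  rw [map_sub, sub_apply, leviCivita_spec g hX hY hZ,
    leviCivita_spec g hY hX hZ]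
  have h : (fun y => g.val y (Y y) (X y)) = fun y => g.val y (X y) (Y y) :=
    funext fun y => g.symm y _ _
  have h2 := VectorField.mlieBracket_swap_apply (I := 𝓡 n) (V := Y) (W := X) (x := x)
  simp only [koszul, h, h2, map_neg, neg_apply]
  ring

theorem dirDeriv_congr (X : Π x : M, TangentSpace (𝓡 n) x) {f f' : M → ℝ} {V : Set M}
    (hV : IsOpen V) {x : M} (hx : x ∈ V) (h : ∀ y ∈ V, f y = f' y) :
    dirDeriv X f x = dirDeriv X f' x := by
  have he : f =ᶠ[𝓝 x] f' := Filter.eventuallyEq_of_mem (hV.mem_nhds hx) h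
  simp only [dirDeriv, mvfderiv, he.mfderiv_eq]
  congr 1

/-- The Levi-Civita connection, extended complex-bilinearly to complex vector fields. -/
def cnabla (g : PseudoRiemannianMetric n M) (Z W : Π x : M, ℂ ⊗[ℝ] TangentSpace (𝓡 n) x) (x : M) :
    ℂ ⊗[ℝ] TangentSpace (𝓡 n) x :=
  cmk (leviCivita g (fun y => cre (Z y)) (fun y => cre (W y)) x
      - leviCivita g (fun y => cim (Z y)) (fun y => cim (W y)) x)
    (leviCivita g (fun y => cre (Z y)) (fun y => cim (W y)) x
      + leviCivita g (fun y => cim (Z y)) (fun y => cre (W y)) x)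

theorem cbracket_eq (g : PseudoRiemannianMetric n M)
    {Z W : Π x : M, ℂ ⊗[ℝ] TangentSpace (𝓡 n) x} {V : Set M} (hV : IsOpen V)
    (hZ : SmoothCFieldOn Z V) (hW : SmoothCFieldOn W V) {x : M} (hx : x ∈ V) :
    cbracket Z W x = cnabla g Z W x - cnabla g W Z x := by
  have h1 := hZ.1.diffAt hV hx
  have h2 := hZ.2.diffAt hV hx
  have h3 := hW.1.diffAt hV hx
  have h4 := hW.2.diffAt hV hx
  apply ctensor_ext
  · simp only [cbracket, cnabla, cre_cmk, map_sub, leviCivita_torsion g h1 h3,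
      leviCivita_torsion g h2 h4]
    abel
  · simp only [cbracket, cnabla, cim_cmk, map_sub, leviCivita_torsion g h1 h4,
      leviCivita_torsion g h2 h3]
    abel

variable {X A C : Π x : M, ℂ ⊗[ℝ] TangentSpace (𝓡 n) x} {V : Set M} {x : M}

/-- Metric compatibility for complex fields: each real or imaginary part of the sum is a signed
combination of real Leibniz rules, in which the derivatives cancel because `g(A, C)` vanishes
identically near `x`. -/
theorem cnabla_metric (g : PseudoRiemannianMetric n M) (hV : IsOpen V) (hx : x ∈ V)
    (hX : SmoothCFieldOn X V) (hA : SmoothCFieldOn A V) (hC : SmoothCFieldOn C V)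
    (h0 : ∀ y ∈ V, g.cval y (A y) (C y) = 0) :
    g.cval x (cnabla g X A x) (C x) + g.cval x (A x) (cnabla g X C x) = 0 := by
  have hre : ∀ y ∈ V, g.val y (cre (A y)) (cre (C y)) = g.val y (cim (A y)) (cim (C y)) :=
    fun y hy => by
      have := congrArg Complex.re (h0 y hy)
      rw [cval_eq] at this
      exact sub_eq_zero.1 this
  have him : ∀ y ∈ V, g.val y (cre (A y)) (cim (C y)) = - g.val y (cim (A y)) (cre (C y)) :=
    fun y hy => by
      have := congrArg Complex.im (h0 y hy)
      rw [cval_eq] at this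
      exact eq_neg_of_add_eq_zero_left this
  have d1 := fun Y : Π x : M, TangentSpace (𝓡 n) x => dirDeriv_congr Y hV hx hre
  have d2 := fun Y : Π x : M, TangentSpace (𝓡 n) x => dirDeriv_congr Y hV hx him
  simp only [dirDeriv_neg] at d2
  have r := fun {X Y Z : Π x : M, TangentSpace (𝓡 n) x} (hX : SmoothFieldOn X V)
    (hY : SmoothFieldOn Y V) (hZ : SmoothFieldOn Z V) =>
      leviCivita_metric g (hX.diffAt hV hx) (hY.diffAt hV hx) (hZ.diffAt hV hx)
  rw [cval_eq, cval_eq]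
  apply Complex.ext
  · simp only [cnabla, cre_cmk, cim_cmk, map_sub, map_add, sub_apply,
      add_apply, Complex.add_re, Complex.zero_re]
    linear_combination -r hX.1 hA.1 hC.1 + r hX.1 hA.2 hC.2 + r hX.2 hA.2 hC.1
      + r hX.2 hA.1 hC.2 + d1 (fun y => cre (X y)) - d2 (fun y => cim (X y))
  · simp only [cnabla, cre_cmk, cim_cmk, map_sub, map_add, sub_apply,
      add_apply, Complex.add_im, Complex.zero_im]
    linear_combination -r hX.1 hA.1 hC.2 - r hX.1 hA.2 hC.1 - r hX.2 hA.1 hC.1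
      + r hX.2 hA.2 hC.2 + d2 (fun y => cre (X y)) + d1 (fun y => cim (X y))

/-- As `φ(A, C)` vanishes identically near `x`, the sum is `-(∇_X φ)(A, C)`. On the right-hand side
of the Killing-Yano equation `hτ` kills the `τ` term, while `hXA` and `hXC` kill the two `K` terms.
-/
theorem IsConformalKillingYano.cnabla_φ {g : PseudoRiemannianMetric n M} {φ : TwoForm n M}
    (hφ : IsConformalKillingYano g φ) (hV : IsOpen V) (hx : x ∈ V)
    (hX : SmoothCFieldOn X V) (hA : SmoothCFieldOn A V) (hC : SmoothCFieldOn C V)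
    (h0 : ∀ y ∈ V, φ.cval y (A y) (C y) = 0) (hXA : g.cval x (X x) (A x) = 0)
    (hXC : g.cval x (X x) (C x) = 0) (hτ : cext₃ (extDeriv φ x) (X x) (A x) (C x) = 0) :
    φ.cval x (cnabla g X A x) (C x) + φ.cval x (A x) (cnabla g X C x) = 0 := by
  obtain ⟨K, hK⟩ := hφ
  have hre : ∀ y ∈ V, φ.val y (cre (A y)) (cre (C y)) = φ.val y (cim (A y)) (cim (C y)) :=
    fun y hy => by
      have := congrArg Complex.re (h0 y hy)
      rw [TwoForm.cval_eq] at this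
      exact sub_eq_zero.1 this
  have him : ∀ y ∈ V, φ.val y (cre (A y)) (cim (C y)) = - φ.val y (cim (A y)) (cre (C y)) :=
    fun y hy => by
      have := congrArg Complex.im (h0 y hy)
      rw [TwoForm.cval_eq] at this
      exact eq_neg_of_add_eq_zero_left this
  have d1 := fun Y : Π x : M, TangentSpace (𝓡 n) x => dirDeriv_congr Y hV hx hre
  have d2 := fun Y : Π x : M, TangentSpace (𝓡 n) x => dirDeriv_congr Y hV hx him
  simp only [dirDeriv_neg] at d2
  rw [cval_eq] at hXA hXC
  have a1 := congrArg Complex.re hXA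
  have a2 := congrArg Complex.im hXA
  have c1 := congrArg Complex.re hXC
  have c2 := congrArg Complex.im hXC
  have t1 := congrArg Complex.re hτ
  have t2 := congrArg Complex.im hτ
  simp only [cext₃, Complex.zero_re, Complex.zero_im] at a1 a2 c1 c2 t1 t2
  have r := fun {X Y Z : Π x : M, TangentSpace (𝓡 n) x} (hX : SmoothFieldOn X V)
    (hY : SmoothFieldOn Y V) (hZ : SmoothFieldOn Z V) => hK V hV X Y Z hX hY hZ x hx
  simp only [covDeriv] at r
  rw [TwoForm.cval_eq, TwoForm.cval_eq]
  set k : ℝ := 1 / ((n : ℝ) - 1)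
  apply Complex.ext
  · simp only [cnabla, cre_cmk, cim_cmk, map_sub, map_add, sub_apply,
      add_apply, Complex.add_re, Complex.zero_re]
    linear_combination -r hX.1 hA.1 hC.1 + r hX.1 hA.2 hC.2 + r hX.2 hA.2 hC.1
      + r hX.2 hA.1 hC.2 + d1 (fun y => cre (X y)) - d2 (fun y => cim (X y)) - 1 / 3 * t1
      - k * (a1 * K x (cre (C x)) - a2 * K x (cim (C x))
        - c1 * K x (cre (A x)) + c2 * K x (cim (A x)))
  · simp only [cnabla, cre_cmk, cim_cmk, map_sub, map_add, sub_apply,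
      add_apply, Complex.add_im, Complex.zero_im]
    linear_combination -r hX.1 hA.1 hC.2 - r hX.1 hA.2 hC.1 - r hX.2 hA.1 hC.1
      + r hX.2 hA.2 hC.2 + d2 (fun y => cre (X y)) + d1 (fun y => cim (X y)) - 1 / 3 * t2
      - k * (a1 * K x (cim (C x)) + a2 * K x (cre (C x))
        - c1 * K x (cim (A x)) - c2 * K x (cre (A x)))

theorem IsSmoothDistribution.exists_extension
    {D : Π x : M, Submodule ℂ (ℂ ⊗[ℝ] TangentSpace (𝓡 n) x)} {k : ℕ} {U : Set M}
    (hD : IsSmoothDistribution D k U) (hx : x ∈ U) {b : ℂ ⊗[ℝ] TangentSpace (𝓡 n) x}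
    (hb : b ∈ D x) : ∃ V : Set M, IsOpen V ∧ x ∈ V ∧ V ⊆ U ∧
      ∃ Z : Π x : M, ℂ ⊗[ℝ] TangentSpace (𝓡 n) x, SmoothCFieldOn Z V ∧ (∀ y ∈ V, Z y ∈ D y) ∧
        Z x = b := by
  obtain ⟨V, hVo, hxV, hVU, Z, hZ, hs⟩ := hD x hx
  rw [(hs x hxV).2, Submodule.mem_span_range_iff_exists_fun] at hb
  obtain ⟨c, hc⟩ := hb
  refine ⟨V, hVo, hxV, hVU, fun y => ∑ i, c i • Z i y,
    SmoothCFieldOn.sum fun i _ => (hZ i).const_smul (c i), fun y hy => ?_, hc⟩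
  rw [(hs y hy).2]
  exact sum_mem fun i _ => Submodule.smul_mem _ _ (Submodule.subset_span (mem_range_self i))

/-- A distribution on which `g`, `φ` and `τ` vanish, and which is spanned by eigenvectors of `φ`
with no two opposite eigenvalues, is parallel along itself. -/
theorem IsConformalKillingYano.cnabla_mem {g : PseudoRiemannianMetric n M} {φ : TwoForm n M}
    (hφ : IsConformalKillingYano g φ) {D : Π x : M, Submodule ℂ (ℂ ⊗[ℝ] TangentSpace (𝓡 n) x)}
    {k m : ℕ} {U : Set M} (hD : IsSmoothDistribution D k U)
    (hg : ∀ y ∈ U, ∀ A ∈ D y, ∀ B ∈ D y, g.cval y A B = 0)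
    (hφ0 : ∀ y ∈ U, ∀ A ∈ D y, ∀ B ∈ D y, φ.cval y A B = 0)
    {b : Fin m → ℂ ⊗[ℝ] TangentSpace (𝓡 n) x} {z : Fin m → ℂ}
    (hspan : D x = Submodule.span ℂ (range b))
    (hperp : ∀ A, (∀ i, g.cval x A (b i) = 0) → A ∈ D x)
    (heig : ∀ i A, φ.cval x A (b i) = z i * g.cval x A (b i)) (hz : ∀ i j, z i + z j ≠ 0)
    (hτ : ∀ A ∈ D x, ∀ B ∈ D x, ∀ C ∈ D x, cext₃ (extDeriv φ x) A B C = 0)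
    (hV : IsOpen V) (hVU : V ⊆ U) (hx : x ∈ V) (hX : SmoothCFieldOn X V)
    (hA : SmoothCFieldOn A V) (hXD : ∀ y ∈ V, X y ∈ D y) (hAD : ∀ y ∈ V, A y ∈ D y) :
    cnabla g X A x ∈ D x := by
  have hbm : ∀ i, b i ∈ D x := fun i => hspan ▸ Submodule.subset_span (mem_range_self i)
  -- Extensions of the eigenvectors `b i` inside `D`. They need be eigenvectors only at `x`, since
  -- the differentiated identities use just that `g` and `φ` vanish on `D`.
  choose O hO hxO hOU Y hY hYD hYx using fun i => hD.exists_extension (hVU hx) (hbm i)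
  have hgs := cval_symm g x
  have key : ∀ i j, g.cval x (b i) (cnabla g X (Y j) x) = 0 := by
    intro i j
    let N := V ∩ (O i ∩ O j)
    have hN : IsOpen N := hV.inter ((hO i).inter (hO j))
    have hxN : x ∈ N := ⟨hx, hxO i, hxO j⟩
    have hXN := hX.mono (V := N) inter_subset_left
    have hiN := (hY i).mono (V := N) (inter_subset_right.trans inter_subset_left)
    have hjN := (hY j).mono (V := N) (inter_subset_right.trans inter_subset_right)
    have e1 := cnabla_metric g hN hxN hXN hiN hjN fun y hy =>
      hg y (hVU hy.1) _ (hYD i y hy.2.1) _ (hYD j y hy.2.2)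
    have e2 := hφ.cnabla_φ hN hxN hXN hiN hjN
      (fun y hy => hφ0 y (hVU hy.1) _ (hYD i y hy.2.1) _ (hYD j y hy.2.2))
      (hg x (hVU hx) _ (hXD x hx) _ (hYD i x (hxO i)))
      (hg x (hVU hx) _ (hXD x hx) _ (hYD j x (hxO j)))
      (hτ _ (hXD x hx) _ (hYD i x (hxO i)) _ (hYD j x (hxO j)))
    rw [hYx, hYx] at e1 e2
    rw [heig, φ.cval_skew x (b i), heig, hgs (cnabla g X (Y j) x)] at e2
    -- Metric compatibility turns `g(∇_X Y_i, b_j)` into `-g(b_i, ∇_X Y_j)`, so the two eigenvalues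
    -- add instead of cancelling.
    have e3 : (z i + z j) * g.cval x (b i) (cnabla g X (Y j) x) = 0 := by
      linear_combination z j * e1 - e2
    exact (mul_eq_zero.1 e3).resolve_left (hz i j)
  have key2 : ∀ B ∈ D x, ∀ j, g.cval x B (cnabla g X (Y j) x) = 0 := by
    intro B hB j
    rw [hspan] at hB
    induction hB using Submodule.span_induction with
    | zero => simp
    | add a c _ _ ha hc => simp [ha, hc]
    | smul r a _ ha => simp [ha]
    | mem a ha => obtain ⟨i, rfl⟩ := ha; exact key i j
  -- For the given section `A`, metric compatibility moves the derivative onto `Y j`, where it is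
  -- already known to be orthogonal to `D x`.
  refine hperp _ fun j => ?_
  have e1 := cnabla_metric g (hV.inter (hO j)) ⟨hx, hxO j⟩ (hX.mono inter_subset_left)
    (hA.mono inter_subset_left) ((hY j).mono inter_subset_right)
    fun y hy => hg y (hVU hy.1) _ (hAD y hy.1) _ (hYD j y hy.2)
  rw [key2 _ (hAD x hx) j, add_zero, hYx] at e1
  exact e1

end LeviCivita

/-! ### Antisymmetry and linearity of the complexified `τ`. -/

section ExteriorDerivative

variable {n : ℕ} {M : Type*} [TopologicalSpace M]
  [ChartedSpace (EuclideanSpace ℝ (Fin n)) M] [IsManifold (𝓡 n) ∞ M]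
  (φ : TwoForm n M) (x : M)

theorem extDeriv_swap₁₂ (u v w : TangentSpace (𝓡 n) x) :
    extDeriv φ x u v w = - extDeriv φ x v u w := cartan_swap₁₂ φ _ _ _ x

theorem extDeriv_swap₂₃ (u v w : TangentSpace (𝓡 n) x) :
    extDeriv φ x u v w = - extDeriv φ x u w v := cartan_swap₂₃ φ _ _ _ x

theorem extDeriv_tensorial (u v : TangentSpace (𝓡 n) x) :
    TensorialAt (𝓡 n) (EuclideanSpace ℝ (Fin n))
      (fun Z => cartan φ (FiberBundle.extend (EuclideanSpace ℝ (Fin n)) u)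
        (FiberBundle.extend (EuclideanSpace ℝ (Fin n)) v) Z x) x :=
  cartan_tensorial φ (FiberBundle.mdifferentiableAt_extend (𝓡 n) (EuclideanSpace ℝ (Fin n)) u)
    (FiberBundle.mdifferentiableAt_extend (𝓡 n) (EuclideanSpace ℝ (Fin n)) v)

/-- `τ (u, v, ·)` as a linear form. -/
def extDerivHom (u v : TangentSpace (𝓡 n) x) : TangentSpace (𝓡 n) x →L[ℝ] ℝ :=
  TensorialAt.mkHom _ x (extDeriv_tensorial φ x u v)

theorem extDerivHom_apply (u v w : TangentSpace (𝓡 n) x) :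
    extDeriv φ x u v w = extDerivHom φ x u v w :=
  (TensorialAt.mkHom_apply_eq_extend (extDeriv_tensorial φ x u v) w).symm

theorem cext₃_swap₁₂ (A B C : ℂ ⊗[ℝ] TangentSpace (𝓡 n) x) :
    cext₃ (extDeriv φ x) A B C = - cext₃ (extDeriv φ x) B A C := by
  have h := extDeriv_swap₁₂ φ x
  apply Complex.ext
  · simp only [cext₃, Complex.neg_re]
    rw [h (cre A), h (cre A), h (cim A), h (cim A)]; ring
  · simp only [cext₃, Complex.neg_im]
    rw [h (cim A), h (cre A), h (cre A), h (cim A)]; ring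

theorem cext₃_swap₂₃ (A B C : ℂ ⊗[ℝ] TangentSpace (𝓡 n) x) :
    cext₃ (extDeriv φ x) A B C = - cext₃ (extDeriv φ x) A C B := by
  have h := fun u => extDeriv_swap₂₃ φ x u
  apply Complex.ext
  · simp only [cext₃, Complex.neg_re]
    rw [h _ (cre B), h _ (cim B), h _ (cre B), h _ (cim B)]; ring
  · simp only [cext₃, Complex.neg_im]
    rw [h _ (cre B), h _ (cim B), h _ (cre B), h _ (cim B)]; ring

theorem cext₃_mem_span {ι : Type*} {b : ι → ℂ ⊗[ℝ] TangentSpace (𝓡 n) x}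
    {A B C : ℂ ⊗[ℝ] TangentSpace (𝓡 n) x} (h : ∀ i, cext₃ (extDeriv φ x) A B (b i) = 0)
    (hC : C ∈ Submodule.span ℂ (range b)) : cext₃ (extDeriv φ x) A B C = 0 := by
  have key : ∀ C, cext₃ (extDeriv φ x) A B C =
      ⟨extDerivHom φ x (cre A) (cre B) (cre C) - extDerivHom φ x (cre A) (cim B) (cim C)
        - extDerivHom φ x (cim A) (cre B) (cim C) - extDerivHom φ x (cim A) (cim B) (cre C),
      extDerivHom φ x (cim A) (cre B) (cre C) + extDerivHom φ x (cre A) (cim B) (cre C)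
        + extDerivHom φ x (cre A) (cre B) (cim C) - extDerivHom φ x (cim A) (cim B) (cim C)⟩ := by
    intro C; simp only [cext₃, extDerivHom_apply]
  induction hC using Submodule.span_induction with
  | zero => rw [key]; apply Complex.ext <;> simp
  | add a c _ _ ha hc =>
    have e : cext₃ (extDeriv φ x) A B (a + c)
        = cext₃ (extDeriv φ x) A B a + cext₃ (extDeriv φ x) A B c := by
      rw [key, key, key]
      apply Complex.ext <;> simp <;> ring
    rw [e, ha, hc, add_zero]
  | smul r a _ ha =>
    rw [← mul_zero r, ← ha, key, key]
    apply Complex.ext <;> simp <;> ring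
  | mem a ha => obtain ⟨i, rfl⟩ := ha; exact h i

/-- Tensoriality gives linearity in the last slot, and antisymmetry brings each of the other slots
there. -/
theorem cext₃_eq_zero_of_span {ι : Type*} {b : ι → ℂ ⊗[ℝ] TangentSpace (𝓡 n) x}
    (h : ∀ i j k, cext₃ (extDeriv φ x) (b i) (b j) (b k) = 0)
    {A B C : ℂ ⊗[ℝ] TangentSpace (𝓡 n) x} (hA : A ∈ Submodule.span ℂ (range b))
    (hB : B ∈ Submodule.span ℂ (range b)) (hC : C ∈ Submodule.span ℂ (range b)) :
    cext₃ (extDeriv φ x) A B C = 0 := by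
  refine cext₃_mem_span φ x (fun k => ?_) hC
  rw [cext₃_swap₂₃, neg_eq_zero]
  refine cext₃_mem_span φ x (fun j => ?_) hB
  rw [cext₃_swap₁₂, cext₃_swap₂₃, neg_neg]
  refine cext₃_mem_span φ x (fun i => ?_) hA
  rw [cext₃_swap₂₃, cext₃_swap₁₂, h]
  simp

theorem cext₃_self₁₂ (A C : ℂ ⊗[ℝ] TangentSpace (𝓡 n) x) : cext₃ (extDeriv φ x) A A C = 0 :=
  self_eq_neg.1 (cext₃_swap₁₂ φ x A A C)

theorem cext₃_self₂₃ (A C : ℂ ⊗[ℝ] TangentSpace (𝓡 n) x) : cext₃ (extDeriv φ x) A C C = 0 :=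
  self_eq_neg.1 (cext₃_swap₂₃ φ x A C C)

theorem cext₃_self₁₃ (A C : ℂ ⊗[ℝ] TangentSpace (𝓡 n) x) : cext₃ (extDeriv φ x) A C A = 0 := by
  rw [cext₃_swap₂₃, cext₃_self₁₂, neg_zero]

end ExteriorDerivative

/-! ### Eigendistribution families, the conditions on `τ`, and integrability. -/

section Families

variable {m : ℕ} {M : Type*} [TopologicalSpace M]
  [ChartedSpace (EuclideanSpace ℝ (Fin (2 * m))) M] [IsManifold (𝓡 (2 * m)) ∞ M]
  {g : PseudoRiemannianMetric (2 * m) M} {φ : TwoForm (2 * m) M}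

theorem exists_eigenbasis_at {x : M} (hc : (eigenvalues g φ x).ncard = 2 * m) :
    ∃ v w lam, NullEigen (m := m) (g.cval x) (φ.cval x) v w lam :=
  exists_nullEigen_any (cval_nondegenerate g x) (cval_symm g x) (φ.cval_skew x)
    (finrank_ctangent x) hc

theorem smooth_sel {U : Set M} {v w : Fin m → Π x : M, ℂ ⊗[ℝ] TangentSpace (𝓡 (2 * m)) x}
    (hv : ∀ μ, SmoothCFieldOn (v μ) U) (hw : ∀ μ, SmoothCFieldOn (w μ) U) (s : Fin m → Bool)
    (μ : Fin m) : SmoothCFieldOn (fun x => sel (fun μ => v μ x) (fun μ => w μ x) s μ) U := by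
  by_cases hs : s μ
  · simpa [sel, hs] using hv μ
  · simpa [sel, hs] using hw μ

theorem exists_local_family (hc : ∀ x : M, (eigenvalues g φ x).ncard = 2 * m) (p : M) :
    ∃ U : Set M, IsOpen U ∧ p ∈ U ∧ ∃ D, IsEigendistributionFamily g φ U D := by
  obtain ⟨v₀, w₀, lam₀, h₀⟩ := exists_eigenbasis_at (hc p)
  obtain ⟨U, hU, hpU, v, w, lam, hv, hw, -, -, -, -, h⟩ := exists_local_nullEigenbasis (hc p) h₀
  refine ⟨U, hU, hpU, fun s x => Submodule.span ℂ (range (sel (fun μ => v μ x) (fun μ => w μ x) s)),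
    fun s q hq => ⟨U, hU, hq, Subset.rfl, _, smooth_sel hv hw s, fun x hx =>
      ⟨(h x hx).linearIndependent_sel (cval_symm g x) s, rfl⟩⟩, fun x hx =>
      ⟨_, _, _, (h x hx).isNullEigenbasis, fun s => rfl⟩⟩

/-- If the eigenvalues can be enumerated canonically, then the canonical enumerations define a
family of eigendistributions on the whole manifold. -/
theorem exists_global_family (hc : ∀ x : M, (eigenvalues g φ x).ncard = 2 * m)
    (hS : ∀ x : M, Orderable (eigenvalues g φ x)) :
    ∃ (v w : Π x : M, Fin m → ℂ ⊗[ℝ] TangentSpace (𝓡 (2 * m)) x) (lam : M → Fin m → ℂ),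
      (∀ x, NullEigen (g.cval x) (φ.cval x) (v x) (w x) (lam x) ∧ Ordered (lam x)) ∧
      IsEigendistributionFamily g φ univ
        fun s x => Submodule.span ℂ (range (sel (v x) (w x) s)) := by
  have hex := fun x : M => exists_nullEigen_ordered (cval_nondegenerate g x) (cval_symm g x)
    (φ.cval_skew x) (finrank_ctangent x) (hc x) (hS x)
  choose v w lam hn ho using hex
  refine ⟨v, w, lam, fun x => ⟨hn x, ho x⟩, fun s p _ => ?_, fun x _ =>
    ⟨_, _, _, (hn x).isNullEigenbasis, fun s => rfl⟩⟩
  -- The smooth eigenbasis starts from the chosen one at `p`. Its enumeration stays normalised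
  -- nearby, so by uniqueness it is the chosen enumeration there and the spans agree.
  obtain ⟨U, hU, hpU, v', w', lam', hv', hw', hlam', -, -, h0, h⟩ :=
    exists_local_nullEigenbasis (hc p) (hn p)
  have hcont : ∀ μ, ContinuousAt (lam' μ) p := fun μ =>
    (hlam' μ).continuousOn.continuousAt (hU.mem_nhds hpU)
  have hre : ∀ μ, ContinuousAt (fun x => (lam' μ x).re) p := fun μ =>
    Complex.continuous_re.continuousAt.comp (hcont μ)
  have him : ∀ μ, ContinuousAt (fun x => (lam' μ x).im) p := fun μ =>
    Complex.continuous_im.continuousAt.comp (hcont μ)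
  have e1 : ∀ᶠ x in 𝓝 p, ∀ μ, 0 < (lam' μ x).re + (lam' μ x).im :=
    eventually_all.2 fun μ => ((hre μ).add (him μ)).eventually_const_lt (by
      simpa [h0] using (ho p).1 μ)
  have e2 : ∀ᶠ x in 𝓝 p, ∀ μ ν, μ < ν →
      (lam' μ x).im - (lam' μ x).re < (lam' ν x).im - (lam' ν x).re :=
    eventually_all.2 fun μ => eventually_all.2 fun ν => by
      by_cases hμν : μ < ν
      · refine (((him μ).sub (hre μ)).eventually_lt ((him ν).sub (hre ν)) ?_).mono
          fun x hx _ => hx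
        simpa [h0] using (ho p).2 hμν
      · exact Eventually.of_forall fun x hx => absurd hx hμν
  obtain ⟨O, hO, hOo, hpO⟩ := eventually_nhds_iff.1 (e1.and e2)
  refine ⟨U ∩ O, hU.inter hOo, ⟨hpU, hpO⟩, subset_univ _, _,
    fun μ => (smooth_sel hv' hw' s μ).mono inter_subset_left, fun x hx =>
      ⟨(h x hx.1).linearIndependent_sel (cval_symm g x) s, ?_⟩⟩
  have e := ordered_unique (cval_symm g x) (φ.cval_skew x) (finrank_ctangent x) (hS x) (hn x)
    (h x hx.1) (ho x) ⟨(hO x hx.2).1, fun μ ν hμν => (hO x hx.2).2 μ ν hμν⟩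
  have h2 := hn x
  rw [e] at h2
  exact h2.span_eq (cval_symm g x) (φ.cval_skew x) (finrank_ctangent x) (hc x) (h x hx.1) s

/-- Evaluate the 3-form on the vector dual to the first picked one and on the other two picked
vectors. Isotropy of the picked vectors removes all but the first term, whose metric factor is `1`.
-/
theorem NullEigen.cext₃_of_wedge {x : M} {v w : Fin m → ℂ ⊗[ℝ] TangentSpace (𝓡 (2 * m)) x}
    {lam : Fin m → ℂ} (h : NullEigen (g.cval x) (φ.cval x) v w lam)
    (hw : ∀ μ, WedgeContractionVanish g φ x (w μ) ∧ WedgeContractionVanish g φ x (v μ))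
    (s : Fin m → Bool) (κ μ ν : Fin m) :
    cext₃ (extDeriv φ x) (sel v w s κ) (sel v w s μ) (sel v w s ν) = 0 := by
  have hs := h.sel_sel (cval_symm g x) s
  by_cases hk : s κ
  · have e := (hw κ).2 (w κ) (sel v w s μ) (sel v w s ν)
    have hv : v κ = sel v w s κ := by simp [sel, hk]
    rw [h.vw, if_pos rfl, hv, hs, hs] at e
    linear_combination e
  · have e := (hw κ).1 (v κ) (sel v w s μ) (sel v w s ν)
    have hv : w κ = sel v w s κ := by simp [sel, hk]
    rw [h.wv (cval_symm g x), if_pos rfl, hv, hs, hs] at e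
    linear_combination e

theorem tauComponentsVanish_of {x : M} {v w : Fin m → ℂ ⊗[ℝ] TangentSpace (𝓡 (2 * m)) x}
    {lam : Fin m → ℂ} (h : NullEigen (g.cval x) (φ.cval x) v w lam)
    (hw : (∀ μ, WedgeContractionVanish g φ x (w μ) ∧ WedgeContractionVanish g φ x (v μ)) ∨
      (∀ a b c, extDeriv φ x a b c = 0) ∨ m = 2) : TauComponentsVanish φ x v w := by
  intro s κ μ ν
  rw [pick_eq_sel]
  by_cases h1 : κ = μ
  · subst h1; exact cext₃_self₁₂ φ x _ _
  by_cases h2 : κ = ν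
  · subst h2; exact cext₃_self₁₃ φ x _ _
  by_cases h3 : μ = ν
  · subst h3; exact cext₃_self₂₃ φ x _ _
  rcases hw with hw | hw | rfl
  · exact h.cext₃_of_wedge hw s κ μ ν
  · apply Complex.ext <;> simp [cext₃, hw]
  -- Three distinct indices do not exist in `Fin 2`.
  · omega

variable {U : Set M}
  {D : (Fin m → Bool) → Π x : M, Submodule ℂ (ℂ ⊗[ℝ] TangentSpace (𝓡 (2 * m)) x)}

theorem IsEigendistributionFamily.nullEigen (hD : IsEigendistributionFamily g φ U D) {x : M}
    (hx : x ∈ U) : ∃ v w lam, NullEigen (g.cval x) (φ.cval x) v w lam ∧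
      ∀ s, D s x = Submodule.span ℂ (range (sel v w s)) := by
  obtain ⟨v, w, lam, h, hs⟩ := hD.2 x hx
  exact ⟨v, w, lam, h.nullEigen, hs⟩

theorem IsEigendistributionFamily.injective (hD : IsEigendistributionFamily g φ U D) {x : M}
    (hx : x ∈ U) : Function.Injective fun s => D s x := by
  obtain ⟨v, w, lam, h, hs⟩ := hD.nullEigen hx
  simp only [hs]
  exact h.span_injective (cval_symm g x)

theorem IsEigendistributionFamily.finrank (hD : IsEigendistributionFamily g φ U D) {x : M}
    (hx : x ∈ U) (s : Fin m → Bool) : finrank ℂ (D s x) = m := by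
  obtain ⟨v, w, lam, h, hs⟩ := hD.nullEigen hx
  rw [hs]
  exact h.finrank_span (cval_symm g x) s

theorem IsEigendistributionFamily.isotropic (hD : IsEigendistributionFamily g φ U D)
    (s : Fin m → Bool) : ∀ x ∈ U, ∀ A ∈ D s x, ∀ B ∈ D s x, g.cval x A B = 0 := by
  intro x hx A hA B hB
  obtain ⟨v, w, lam, h, hs⟩ := hD.nullEigen hx
  rw [hs] at hA hB
  exact h.isotropic (cval_symm g x) s hA hB

theorem IsEigendistributionFamily.φ_isotropic (hD : IsEigendistributionFamily g φ U D)
    (s : Fin m → Bool) : ∀ x ∈ U, ∀ A ∈ D s x, ∀ B ∈ D s x, φ.cval x A B = 0 := by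
  intro x hx A hA B hB
  obtain ⟨v, w, lam, h, hs⟩ := hD.nullEigen hx
  rw [hs] at hA hB
  exact h.Ω_isotropic (φ.cval_skew x) s hA hB

theorem IsEigendistributionFamily.mem_of_orthogonal (hD : IsEigendistributionFamily g φ U D)
    (s : Fin m → Bool) {x : M} (hx : x ∈ U) {A : ℂ ⊗[ℝ] TangentSpace (𝓡 (2 * m)) x}
    (hA : ∀ B ∈ D s x, g.cval x A B = 0) : A ∈ D s x := by
  obtain ⟨v, w, lam, h, hs⟩ := hD.nullEigen hx
  rw [hs] at hA ⊢
  exact h.mem_of_orthogonal (cval_symm g x) (finrank_ctangent x) s fun μ => hA _ (sel_mem s μ)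

/-- A choice `s` takes only one of each pair of opposite eigenvalues, and none is zero, so the sums
required by the general criterion never vanish. Condition (T) supplies the vanishing of `τ` on the
span. -/
theorem IsEigendistributionFamily.cnabla_mem (hD : IsEigendistributionFamily g φ U D)
    (hφ : IsConformalKillingYano g φ) (hc : ∀ x : M, (eigenvalues g φ x).ncard = 2 * m)
    (hT : ∀ (x : M) (v w : Fin m → ℂ ⊗[ℝ] TangentSpace (𝓡 (2 * m)) x) (lam : Fin m → ℂ),
      IsNullEigenbasis g φ x v w lam → TauComponentsVanish φ x v w)
    (s : Fin m → Bool) {V : Set M} (hV : IsOpen V) (hVU : V ⊆ U)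
    {X A : Π x : M, ℂ ⊗[ℝ] TangentSpace (𝓡 (2 * m)) x} (hX : SmoothCFieldOn X V)
    (hA : SmoothCFieldOn A V) (hXD : ∀ y ∈ V, X y ∈ D s y) (hAD : ∀ y ∈ V, A y ∈ D s y)
    {x : M} (hx : x ∈ V) : cnabla g X A x ∈ D s x := by
  obtain ⟨v, w, lam, h, hs⟩ := hD.nullEigen (hVU hx)
  have hB := cval_symm g x
  have hΩ := φ.cval_skew x
  have hd := finrank_ctangent (n := 2 * m) x
  have hadd := h.add_ne_zero hB hΩ hd (hc x)
  have hinj := h.lam_injective hB hΩ hd (hc x)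
  refine hφ.cnabla_mem (m := m) (b := sel v w s)
    (z := fun μ => if s μ then - lam μ else lam μ) (hD.1 s) (hD.isotropic s) (hD.φ_isotropic s)
    (hs s) (fun A hA => ?_) (fun μ A => ?_) (fun μ ν => ?_) (fun A hA B hB C hC => ?_) hV hVU hx
    hX hA hXD hAD
  · rw [hs]; exact h.mem_of_orthogonal hB hd s hA
  · by_cases hsμ : s μ
    · simpa [sel, hsμ] using h.Ω_v hB hΩ hd A μ
    · simpa [sel, hsμ] using h.Ω_w hB hd A μ
  · by_cases hμν : μ = ν
    · subst hμν
      by_cases hsμ : s μ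
      · simp only [hsμ, if_true]
        exact fun h0 => hadd μ μ (by linear_combination -h0)
      · simpa [hsμ] using hadd μ μ
    · by_cases hsμ : s μ <;> by_cases hsν : s ν <;> simp only [hsμ, hsν, if_true]
      · exact fun h0 => hadd μ ν (by linear_combination -h0)
      · exact fun h0 => hμν (hinj (by simp at h0; linear_combination -h0))
      · exact fun h0 => hμν (hinj (by simp at h0; linear_combination h0))
      · simpa using hadd μ ν
  · rw [hs] at hA hB hC
    exact cext₃_eq_zero_of_span φ x (hT x v w lam h.isNullEigenbasis s) hA hB hC

/-- By torsion-freeness the bracket is the difference of two covariant derivatives, each of which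
stays in `D s`. -/
theorem IsEigendistributionFamily.isIntegrable (hD : IsEigendistributionFamily g φ U D)
    (hφ : IsConformalKillingYano g φ) (hc : ∀ x : M, (eigenvalues g φ x).ncard = 2 * m)
    (hT : ∀ (x : M) (v w : Fin m → ℂ ⊗[ℝ] TangentSpace (𝓡 (2 * m)) x) (lam : Fin m → ℂ),
      IsNullEigenbasis g φ x v w lam → TauComponentsVanish φ x v w)
    (s : Fin m → Bool) : IsIntegrable (D s) U := by
  intro V hV hVU Z W hZ hW hZD hWD x hx
  rw [cbracket_eq g hV hZ hW hx]
  exact sub_mem (hD.cnabla_mem hφ hc hT s hV hVU hZ hW hZD hWD hx)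
    (hD.cnabla_mem hφ hc hT s hV hVU hW hZ hWD hZD hx)

end Families

/-! ### Complex structures on a real vector space from half-dimensional complex subspaces. -/

section ComplexStructures

theorem cconj_smul {V : Type*} [AddCommGroup V] [Module ℝ V] (z : ℂ) (A : ℂ ⊗[ℝ] V) :
    cconj (z • A) = (starRingEnd ℂ) z • cconj A := by
  apply ctensor_ext
  · simp
  · simp [add_comm]

theorem cconj_sum {V : Type*} [AddCommGroup V] [Module ℝ V] {ι : Type*} (s : Finset ι)
    (A : ι → ℂ ⊗[ℝ] V) : cconj (∑ i ∈ s, A i) = ∑ i ∈ s, cconj (A i) := by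
  apply ctensor_ext <;> simp [map_sum]

/-- Taking real parts is injective on `D`, and by the ranks it is a real isomorphism onto `V`. The
sign in `J (cre A) = -cim A` makes `D` the `+i` eigenspace. -/
theorem exists_complex_structure {V : Type*} [AddCommGroup V] [Module ℝ V] [FiniteDimensional ℝ V]
    {D : Submodule ℂ (ℂ ⊗[ℝ] V)} (hinj : ∀ A ∈ D, cre A = 0 → A = 0)
    (hrank : 2 * finrank ℂ D = finrank ℝ V) :
    ∃ J : V →ₗ[ℝ] V, (∀ A ∈ D, J (cre A) = - cim A) ∧ ∀ a, ∃ A ∈ D, cre A = a := by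
  let f : (D.restrictScalars ℝ) →ₗ[ℝ] V := cre.domRestrict (D.restrictScalars ℝ)
  have hf : Function.Injective f := by
    rw [← LinearMap.ker_eq_bot, LinearMap.ker_eq_bot']
    rintro ⟨A, hA⟩ h
    exact Subtype.ext (hinj A hA h)
  have hr : finrank ℝ (D.restrictScalars ℝ) = finrank ℝ V := by
    rw [← hrank, ← Complex.finrank_real_complex]
    exact (Module.finrank_mul_finrank ℝ ℂ D).symm
  let e := LinearEquiv.ofInjectiveOfFinrankEq f hf hr
  have he : ∀ A, e A = cre (A : ℂ ⊗[ℝ] V) := fun A => rfl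
  refine ⟨-(cim ∘ₗ (D.restrictScalars ℝ).subtype ∘ₗ e.symm.toLinearMap), fun A hA => ?_,
    fun a => ⟨e.symm a, (e.symm a).2, by rw [← he]; simp⟩⟩
  have : e.symm (cre A) = ⟨A, hA⟩ := by
    rw [LinearEquiv.symm_apply_eq]; rfl
  simp [this]

variable {V : Type*} [AddCommGroup V] [Module ℝ V] {D : Submodule ℂ (ℂ ⊗[ℝ] V)} {J : V →ₗ[ℝ] V}

theorem complex_structure_cim (hJ : ∀ A ∈ D, J (cre A) = - cim A) {A : ℂ ⊗[ℝ] V} (hA : A ∈ D) :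
    J (cim A) = cre A := by
  -- Multiplication by `-i` turns the imaginary part of `A` into the real part.
  have := hJ (-Complex.I • A) (Submodule.smul_mem _ _ hA)
  simpa using this

theorem complex_structure_sq (hJ : ∀ A ∈ D, J (cre A) = - cim A) (hs : ∀ a, ∃ A ∈ D, cre A = a)
    (a : V) : J (J a) = -a := by
  obtain ⟨A, hA, rfl⟩ := hs a
  rw [hJ A hA, map_neg, complex_structure_cim hJ hA]

theorem complex_structure_mem (hJ : ∀ A ∈ D, J (cre A) = - cim A) (hs : ∀ a, ∃ A ∈ D, cre A = a)
    (a : V) : cmk (J a) a ∈ D := by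
  obtain ⟨A, hA, rfl⟩ := hs a
  rw [hJ A hA]
  have : cmk (- cim A) (cre A) = Complex.I • A := by apply ctensor_ext <;> simp
  rw [this]
  exact Submodule.smul_mem _ _ hA

theorem cre_baseChange (J : V →ₗ[ℝ] V) (A : ℂ ⊗[ℝ] V) : cre (J.baseChange ℂ A) = J (cre A) := by
  induction A using TensorProduct.induction_on with
  | zero => simp
  | tmul z a => simp
  | add x y hx hy => simp [hx, hy]

theorem cim_baseChange (J : V →ₗ[ℝ] V) (A : ℂ ⊗[ℝ] V) : cim (J.baseChange ℂ A) = J (cim A) := by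
  induction A using TensorProduct.induction_on with
  | zero => simp
  | tmul z a => simp
  | add x y hx hy => simp [hx, hy]

theorem complex_structure_eigenspace (hJ : ∀ A ∈ D, J (cre A) = - cim A)
    (hs : ∀ a, ∃ A ∈ D, cre A = a) :
    D = Module.End.eigenspace (J.baseChange ℂ) Complex.I := by
  ext A
  rw [Module.End.mem_eigenspace_iff]
  constructor
  · intro hA
    apply ctensor_ext
    · rw [cre_baseChange, hJ A hA]; simp
    · rw [cim_baseChange, complex_structure_cim hJ hA]; simp
  · intro h
    have h1 := congrArg cim h
    rw [cim_baseChange] at h1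
    have h2 : J (cim A) = cre A := by simpa using h1
    have := complex_structure_mem hJ hs (cim A)
    rwa [h2, cmk_cre_cim] at this

end ComplexStructures

/-! ### Cramer's rule with smooth coefficients. -/

section Determinant

variable {n : ℕ} {M : Type*} [TopologicalSpace M]
  [ChartedSpace (EuclideanSpace ℝ (Fin n)) M] [IsManifold (𝓡 n) ∞ M] {U : Set M}

theorem SmoothCOn.mul {f h : M → ℂ} (hf : SmoothCOn n f U) (hh : SmoothCOn n h U) :
    SmoothCOn n (fun x => f x * h x) U := by
  have h1 : ContDiff ℝ ∞ (fun z : ℂ × ℂ => z.1 * z.2) := contDiff_fst.mul contDiff_snd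
  exact h1.contMDiff.comp_contMDiffOn (hf.prodMk_space hh)

theorem smooth_det {k : ℕ} {N : M → Matrix (Fin k) (Fin k) ℂ}
    (hN : ∀ i j, SmoothCOn n (fun x => N x i j) U) : SmoothCOn n (fun x => (N x).det) U := by
  have h1 : ContDiff ℝ ∞ (fun N : Fin k → Fin k → ℂ => (Matrix.of N).det) := by
    simp only [Matrix.det_apply', Matrix.of_apply]
    fun_prop
  have h2 : ContMDiffOn (𝓡 n) 𝓘(ℝ, Fin k → Fin k → ℂ) ∞ (fun x i j => N x i j) U :=
    contMDiffOn_pi_space.2 fun i => contMDiffOn_pi_space.2 fun j => hN i j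
  exact h1.contMDiff.comp_contMDiffOn h2

/-- The solution of a regular linear system with smooth coefficients is smooth. -/
theorem smooth_of_linear_system {k : ℕ} {N : M → Matrix (Fin k) (Fin k) ℂ} {c h : M → Fin k → ℂ}
    (hN : ∀ i j, SmoothCOn n (fun x => N x i j) U) (hh : ∀ i, SmoothCOn n (fun x => h x i) U)
    (hdet : ∀ x ∈ U, (N x).det ≠ 0) (hc : ∀ x ∈ U, (N x).mulVec (c x) = h x) (i : Fin k) :
    SmoothCOn n (fun x => c x i) U := by
  have h1 : SmoothCOn n (fun x => ((N x).updateCol i (h x)).det) U :=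
    smooth_det fun a b => by
      by_cases hb : b = i
      · subst hb; simpa using hh a
      · simpa [hb] using hN a b
  refine (SmoothCOn.mul (SmoothCOn.inv (smooth_det hN) hdet) h1).congr fun x hx => ?_
  have h2 : ((N x).updateCol i (h x)).det = (N x).det * c x i := by
    rw [← Matrix.cramer_apply, Matrix.cramer_eq_adjugate_mulVec, ← hc x hx, Matrix.mulVec_mulVec,
      Matrix.adjugate_mul]
    simp [Matrix.smul_mulVec]
  rw [h2, inv_mul_cancel_left₀ (hdet x hx)]

end Determinant

/-! ### Positive definite metrics and Hermitian structures. -/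

section Riemannian

variable {m : ℕ} {M : Type*} [TopologicalSpace M]
  [ChartedSpace (EuclideanSpace ℝ (Fin (2 * m))) M] [IsManifold (𝓡 (2 * m)) ∞ M]
  {g : PseudoRiemannianMetric (2 * m) M} {φ : TwoForm (2 * m) M}

theorem cconj_eigenvector {x : M} {l : ℂ ⊗[ℝ] TangentSpace (𝓡 (2 * m)) x} {z : ℂ}
    (h : ∀ A, φ.cval x A l = z * g.cval x A l) (A : ℂ ⊗[ℝ] TangentSpace (𝓡 (2 * m)) x) :
    φ.cval x A (cconj l) = (starRingEnd ℂ) z * g.cval x A (cconj l) := by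
  rw [← cconj_cconj A, φ.cval_cconj, cval_cconj, h, map_mul]

theorem eigenvector_orthogonal {x : M} {l k : ℂ ⊗[ℝ] TangentSpace (𝓡 (2 * m)) x} {z y : ℂ}
    (hl : ∀ A, φ.cval x A l = z * g.cval x A l) (hk : ∀ A, φ.cval x A k = y * g.cval x A k)
    (hzy : z + y ≠ 0) : g.cval x l k = 0 := by
  have e := hk l
  rw [φ.cval_skew, hl, cval_symm g x k] at e
  have : (z + y) * g.cval x l k = 0 := by linear_combination -e
  exact (mul_eq_zero.1 this).resolve_left hzy

theorem zero_notMem_eigenvalues {x : M} (hc : (eigenvalues g φ x).ncard = 2 * m) :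
    (0 : ℂ) ∉ eigenvalues g φ x := by
  obtain ⟨v, w, lam, h⟩ := exists_eigenbasis_at hc
  have hB := cval_symm g x
  have hΩ := φ.cval_skew x
  have hd := finrank_ctangent (n := 2 * m) x
  rw [← evs_eq_eigenvalues, h.evs_eq hB hΩ hd]
  rintro ⟨μ | μ, hμ⟩
  · have hμ : lam μ = 0 := hμ
    exact h.add_ne_zero hB hΩ hd hc μ μ (by rw [hμ, add_zero])
  · have hμ : -lam μ = 0 := hμ
    exact h.add_ne_zero hB hΩ hd hc μ μ (by linear_combination -2 * hμ)

theorem cval_cconj_self (g : PseudoRiemannianMetric (2 * m) M) (x : M)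
    (A : ℂ ⊗[ℝ] TangentSpace (𝓡 (2 * m)) x) : g.cval x A (cconj A) =
      ((g.val x (cre A) (cre A) + g.val x (cim A) (cim A) : ℝ) : ℂ) := by
  rw [cval_eq]
  apply Complex.ext
  · simp
  · simp [g.symm x (cim A)]

theorem PseudoRiemannianMetric.IsRiemannian.eq_zero (hg : g.IsRiemannian) {x : M}
    {A : ℂ ⊗[ℝ] TangentSpace (𝓡 (2 * m)) x} (h : g.cval x A (cconj A) = 0) : A = 0 := by
  rw [cval_cconj_self, Complex.ofReal_eq_zero] at h
  have nn : ∀ v, 0 ≤ g.val x v v := fun v => by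
    by_cases hv : v = 0
    · simp [hv]
    · exact (hg x v hv).le
  have h1 := nn (cre A)
  have h2 := nn (cim A)
  apply ctensor_ext
  · by_contra hne
    have := hg x (cre A) (by simpa using hne)
    linarith
  · by_contra hne
    have := hg x (cim A) (by simpa using hne)
    linarith

/-- If `re z ≠ 0` then `z + conj z ≠ 0`, so an eigenvector is orthogonal to its conjugate, which
definiteness forbids. The nonzero imaginary eigenvalues in the half-plane are separated by their
imaginary parts. -/
theorem PseudoRiemannianMetric.IsRiemannian.orderable (hg : g.IsRiemannian)
    (hc : ∀ x : M, (eigenvalues g φ x).ncard = 2 * m) (x : M) :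
    Orderable (eigenvalues g φ x) := by
  have hre : ∀ z ∈ eigenvalues g φ x, z.re = 0 := by
    rintro z ⟨l, hl, hz⟩
    by_contra hne
    refine hl (hg.eq_zero (eigenvector_orthogonal hz (cconj_eigenvector hz) fun h0 => hne ?_))
    have := congrArg Complex.re h0
    simp at this
    linarith
  constructor
  · intro z hz h0
    rw [hre z hz, zero_add] at h0
    have : z = 0 := Complex.ext (hre z hz) h0
    exact zero_notMem_eigenvalues (hc x) (this ▸ hz)
  · intro z hz y hy _ _ h
    rw [hre z hz, hre y hy] at h
    exact Complex.ext (by rw [hre z hz, hre y hy]) (by linarith)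

variable {U : Set M}
  {D : (Fin m → Bool) → Π x : M, Submodule ℂ (ℂ ⊗[ℝ] TangentSpace (𝓡 (2 * m)) x)}

/-- A purely imaginary `A` in `D` has `conj A = -A`, so isotropy gives `g(A, conj A) = 0` and hence
`A = 0`. -/
theorem IsEigendistributionFamily.exists_complex_structure
    (hD : IsEigendistributionFamily g φ U D) (hg : g.IsRiemannian) (s : Fin m → Bool) {x : M}
    (hx : x ∈ U) : ∃ J : TangentSpace (𝓡 (2 * m)) x →ₗ[ℝ] TangentSpace (𝓡 (2 * m)) x,
      (∀ A ∈ D s x, J (cre A) = - cim A) ∧ ∀ a, ∃ A ∈ D s x, cre A = a := by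
  refine CKY.exists_complex_structure (fun A hA h0 => hg.eq_zero ?_) ?_
  · have : cconj A = -A := by apply ctensor_ext <;> simp [h0]
    rw [this, map_neg, hD.isotropic s x hx A hA A hA, neg_zero]
  · rw [hD.finrank hx]
    exact finrank_euclideanSpace_fin.symm

/-- A smooth real vector field is the real part of a smooth section of `D`, if `D` is a smooth
distribution that is isotropic for a positive definite metric. -/
theorem smooth_lift (hg : g.IsRiemannian)
    {D : Π x : M, Submodule ℂ (ℂ ⊗[ℝ] TangentSpace (𝓡 (2 * m)) x)} {k : ℕ}
    (hD : IsSmoothDistribution D k U) (hiso : ∀ x ∈ U, ∀ A ∈ D x, ∀ B ∈ D x, g.cval x A B = 0)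
    {A : Π x : M, ℂ ⊗[ℝ] TangentSpace (𝓡 (2 * m)) x} {V : Set M} (hV : IsOpen V) (hVU : V ⊆ U)
    (hAD : ∀ x ∈ V, A x ∈ D x) (hA : SmoothFieldOn (fun x => cre (A x)) V) :
    SmoothCFieldOn A V := by
  have key : ∀ p ∈ V, ∃ O : Set M, IsOpen O ∧ p ∈ O ∧ SmoothCFieldOn A O := by
    intro p hp
    obtain ⟨O, hO, hpO, hOU, Z, hZ, hs⟩ := hD p (hVU hp)
    have hconj : ∀ i, SmoothCFieldOn (fun x => cconj (Z i x)) (V ∩ O) := fun i =>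
      smoothCFieldOn_cmk ((hZ i).1.mono inter_subset_right) ((hZ i).2.mono inter_subset_right).neg
    have hex : ∀ x, ∃ c : Fin k → ℂ, x ∈ V ∩ O → ∑ i, c i • Z i x = A x := by
      intro x
      by_cases hx : x ∈ V ∩ O
      · have h1 := hAD x hx.1
        rw [(hs x hx.2).2, Submodule.mem_span_range_iff_exists_fun] at h1
        obtain ⟨c, hc⟩ := h1
        exact ⟨c, fun _ => hc⟩
      · exact ⟨0, fun h => absurd h hx⟩
    choose c hc using hex
    let N : M → Matrix (Fin k) (Fin k) ℂ := fun x =>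
      Matrix.of fun j i => g.cval x (Z i x) (cconj (Z j x))
    have hN : ∀ x (a : Fin k → ℂ) j,
        (N x).mulVec a j = g.cval x (∑ i, a i • Z i x) (cconj (Z j x)) := by
      intro x a j
      simp [N, Matrix.mulVec, dotProduct, map_sum, LinearMap.sum_apply, mul_comm]
    have hmem : ∀ x ∈ V ∩ O, ∀ i, Z i x ∈ D x := fun x hx i => by
      rw [(hs x hx.2).2]; exact Submodule.subset_span (mem_range_self i)
    have hcs : ∀ i, SmoothCOn (2 * m) (fun x => c x i) (V ∩ O) := by
      -- Pair `2 cre A = A + conj A` with `conj (Z j)`. By isotropy the term of `conj A` drops out,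
      -- so the coefficients of `A` solve a linear system with smooth data.
      refine smooth_of_linear_system (N := N)
        (h := fun x j => 2 * g.cval x ((1 : ℂ) ⊗ₜ cre (A x)) (cconj (Z j x))) (fun j i => ?_)
        (fun j => ?_) (fun x hx h0 => ?_) (fun x hx => ?_)
      · exact smooth_cval g ((hZ i).mono inter_subset_right) (hconj j)
      · exact SmoothCOn.mul contMDiffOn_const
          (smooth_cval g (smoothCFieldOn_tmul (hA.mono inter_subset_left)) (hconj j))
      -- The Gram matrix is regular: a kernel vector would give a combination orthogonal to its own
      -- conjugate.
      · obtain ⟨a, ha, hNa⟩ := Matrix.exists_mulVec_eq_zero_iff.2 h0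
        have h1 : ∀ j, g.cval x (∑ i, a i • Z i x) (cconj (Z j x)) = 0 := fun j => by
          rw [← hN, hNa]; rfl
        have h2 : ∑ i, a i • Z i x = 0 := by
          apply hg.eq_zero
          rw [cconj_sum, map_sum]
          refine Finset.sum_eq_zero fun j _ => ?_
          rw [cconj_smul, map_smul, h1, smul_zero]
        exact ha (funext fun i => Fintype.linearIndependent_iff.1 (hs x hx.2).1 a h2 i)
      · funext j
        rw [hN, hc x hx]
        have h1 : (2 : ℂ) • ((1 : ℂ) ⊗ₜ[ℝ] cre (A x)) = A x + cconj (A x) := by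
          apply ctensor_ext
          · simp [two_smul]
          · simp
        have h2 : g.cval x (cconj (A x)) (cconj (Z j x)) = 0 := by
          rw [cval_cconj, hiso x (hVU hx.1) _ (hAD x hx.1) _ (hmem x hx j), map_zero]
        have h3 := congrArg (fun B => g.cval x B (cconj (Z j x))) h1
        simpa [h2] using h3.symm
    have hsm : SmoothCFieldOn (fun x => ∑ i, c x i • Z i x) (V ∩ O) :=
      SmoothCFieldOn.sum fun i _ => SmoothCFieldOn.smul (hcs i) ((hZ i).mono inter_subset_right)
    refine ⟨V ∩ O, hV.inter hO, ⟨hp, hpO⟩, hsm.1.congr fun x hx => ?_, hsm.2.congr fun x hx => ?_⟩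
    · simp only [hc x hx]
    · simp only [hc x hx]
  constructor
  · exact hA
  · intro p hp
    obtain ⟨O, hO, hpO, h⟩ := key p hp
    exact (ContMDiffOn.contMDiffAt h.2 (hO.mem_nhds hpO)).contMDiffWithinAt

theorem IsEigendistributionFamily.exists_hermitian (hD : IsEigendistributionFamily g φ U D)
    (hint : ∀ s, IsIntegrable (D s) U) (hg : g.IsRiemannian) :
    ∃ J : (Fin m → Bool) →
        Π x : M, TangentSpace (𝓡 (2 * m)) x →ₗ[ℝ] TangentSpace (𝓡 (2 * m)) x,
      (∀ s, IsHermitianStructure g (J s) U) ∧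
      (∀ s, ∀ x ∈ U, D s x = Module.End.eigenspace ((J s x).baseChange ℂ) Complex.I) ∧
      (∀ x ∈ U, Function.Injective fun s => J s x) := by
  have hex : ∀ (s : Fin m → Bool) (x : M),
      ∃ J : TangentSpace (𝓡 (2 * m)) x →ₗ[ℝ] TangentSpace (𝓡 (2 * m)) x, x ∈ U →
        (∀ A ∈ D s x, J (cre A) = - cim A) ∧ ∀ a, ∃ A ∈ D s x, cre A = a := by
    intro s x
    by_cases hx : x ∈ U
    · obtain ⟨J, hJ⟩ := hD.exists_complex_structure hg s hx
      exact ⟨J, fun _ => hJ⟩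
    · exact ⟨0, fun h => absurd h hx⟩
  choose J hJ using hex
  have heig : ∀ s, ∀ x ∈ U, D s x = Module.End.eigenspace ((J s x).baseChange ℂ) Complex.I :=
    fun s x hx => complex_structure_eigenspace (hJ s x hx).1 (hJ s x hx).2
  have hsmooth : ∀ s, ∀ V : Set M, IsOpen V → V ⊆ U → ∀ X : Π x : M, TangentSpace (𝓡 (2 * m)) x,
      SmoothFieldOn X V → SmoothFieldOn (fun x => J s x (X x)) V := by
    intro s V hV hVU X hX
    have h := smooth_lift hg (hD.1 s) (hD.isotropic s) (A := fun x => cmk (X x) (- J s x (X x)))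
      hV hVU (fun x hx => by
        have h1 := Submodule.smul_mem _ (-Complex.I)
          (complex_structure_mem (hJ s x (hVU hx)).1 (hJ s x (hVU hx)).2 (X x))
        convert h1 using 1
        apply ctensor_ext <;> simp) (by simpa using hX)
    simpa using h.2.neg
  refine ⟨J, fun s => ⟨fun x hx => complex_structure_sq (hJ s x hx).1 (hJ s x hx).2, ?_,
    hsmooth s, ?_⟩, heig, ?_⟩
  · intro x hx a b
    obtain ⟨A, hA, rfl⟩ := (hJ s x hx).2 a
    obtain ⟨B, hB, rfl⟩ := (hJ s x hx).2 b
    rw [(hJ s x hx).1 A hA, (hJ s x hx).1 B hB]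
    have := congrArg Complex.re (hD.isotropic s x hx A hA B hB)
    rw [cval_eq] at this
    simp at this
    simp
    linarith
  · intro V hV hVU X Y hX hY x hx
    have hmem := fun (W : Π x : M, TangentSpace (𝓡 (2 * m)) x) (y : M) (hy : y ∈ V) =>
      complex_structure_mem (hJ s y (hVU hy)).1 (hJ s y (hVU hy)).2 (W y)
    -- The bracket of `JX + iX` and `JY + iY` has real part `[JX, JY] - [X, Y]` and imaginary part
    -- `[JX, Y] + [X, JY]`. For vectors of `D`, `J` maps the imaginary part to the real part, which
    -- is the vanishing of the Nijenhuis tensor.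
    have h := hint s V hV hVU (fun y => cmk (J s y (X y)) (X y)) (fun y => cmk (J s y (Y y)) (Y y))
      (smoothCFieldOn_cmk (hsmooth s V hV hVU X hX) hX)
      (smoothCFieldOn_cmk (hsmooth s V hV hVU Y hY) hY) (hmem X) (hmem Y) x hx
    have h1 := complex_structure_cim (hJ s x (hVU hx)).1 h
    simp only [cbracket, cre_cmk, cim_cmk, map_add] at h1
    rw [eq_comm, sub_eq_iff_eq_add] at h1
    rw [h1]
    abel
  · intro x hx s t hst
    apply hD.injective hx
    simp only [heig _ x hx]
    simp only at hst
    rw [hst]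

end Riemannian

/-! ### Eigenvalues and real eigenvectors in Lorentzian signature. -/

section LorentzPointwise

variable {m : ℕ} {M : Type*} [TopologicalSpace M]
  [ChartedSpace (EuclideanSpace ℝ (Fin (2 * m))) M] [IsManifold (𝓡 (2 * m)) ∞ M]
  {g : PseudoRiemannianMetric (2 * m) M} {φ : TwoForm (2 * m) M} {x : M}

/-- In Lorentzian signature, orthogonal null vectors are proportional. -/
theorem PseudoRiemannianMetric.IsLorentzian.exists_smul (hg : g.IsLorentzian)
    {k l : TangentSpace (𝓡 (2 * m)) x} (hk : g.val x k k = 0) (hl : g.val x l l = 0)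
    (hkl : g.val x k l = 0) (hl0 : l ≠ 0) : ∃ c : ℝ, k = c • l := by
  obtain ⟨t, -, hv⟩ := hg x
  have htl : g.val x t l ≠ 0 := fun h => by
    have := hv l hl0 h
    rw [hl, mul_zero] at this
    exact lt_irrefl _ this
  have hlk : g.val x l k = 0 := by rw [g.symm]; exact hkl
  -- This combination is null and orthogonal to `t`, where `g` is definite.
  have h0 : g.val x t l • k - g.val x t k • l = 0 := by
    by_contra hne
    have := hv _ hne (by simp; ring)
    simp [hk, hl, hkl, hlk] at this
  refine ⟨(g.val x t l)⁻¹ * g.val x t k, ?_⟩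
  rw [mul_smul, ← sub_eq_zero.1 h0, smul_smul, inv_mul_cancel₀ htl, one_smul]

theorem one_tmul_real_smul (r : ℝ) (k : TangentSpace (𝓡 (2 * m)) x) :
    (1 : ℂ) ⊗ₜ[ℝ] (r • k) = (r : ℂ) • (1 ⊗ₜ[ℝ] k) := by
  rw [TensorProduct.tmul_smul, TensorProduct.smul_tmul', TensorProduct.smul_tmul']
  simp

theorem tmul_ne_zero {k : TangentSpace (𝓡 (2 * m)) x} (hk : k ≠ 0) :
    (1 : ℂ) ⊗ₜ[ℝ] k ≠ 0 := fun h => hk (by simpa using congrArg cre h)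

theorem exists_cval_ne_zero (g : PseudoRiemannianMetric (2 * m) M)
    {A : ℂ ⊗[ℝ] TangentSpace (𝓡 (2 * m)) x} (hA : A ≠ 0) : ∃ B, g.cval x B A ≠ 0 := by
  by_contra! h
  exact hA ((cval_nondegenerate g x).2 _ h)

theorem eigenvalue_unique {A : ℂ ⊗[ℝ] TangentSpace (𝓡 (2 * m)) x} (hA : A ≠ 0) {z y : ℂ}
    (hz : ∀ B, φ.cval x B A = z * g.cval x B A) (hy : ∀ B, φ.cval x B A = y * g.cval x B A) :
    z = y := by
  obtain ⟨B, hB⟩ := exists_cval_ne_zero g hA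
  exact mul_right_cancel₀ hB ((hz B).symm.trans (hy B))

/-- In Lorentzian signature an eigenvector whose eigenvalue is not imaginary is a multiple of a
real null vector, and the eigenvalue is real. -/
theorem PseudoRiemannianMetric.IsLorentzian.real_eigenvector (hg : g.IsLorentzian)
    {l : ℂ ⊗[ℝ] TangentSpace (𝓡 (2 * m)) x} (hl : l ≠ 0) {z : ℂ}
    (hz : ∀ A, φ.cval x A l = z * g.cval x A l) (hre : z.re ≠ 0) :
    z.im = 0 ∧ ∃ (c : ℂ) (k : TangentSpace (𝓡 (2 * m)) x), c ≠ 0 ∧ k ≠ 0 ∧ l = c • (1 ⊗ₜ[ℝ] k) := by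
  have h1 : g.cval x l l = 0 := eigenvector_orthogonal hz hz fun h => hre (by
    have := congrArg Complex.re h
    simp at this
    exact this)
  have h2 : g.cval x l (cconj l) = 0 :=
    eigenvector_orthogonal hz (cconj_eigenvector hz) fun h => hre (by
      have := congrArg Complex.re h
      simp at this
      linarith)
  rw [cval_cconj_self, Complex.ofReal_eq_zero] at h2
  rw [cval_eq] at h1
  have h3 := congrArg Complex.re h1
  have h4 := congrArg Complex.im h1
  simp [g.symm x (cim l) (cre l)] at h3 h4
  have ha : g.val x (cre l) (cre l) = 0 := by linarith
  have hb : g.val x (cim l) (cim l) = 0 := by linarith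
  have key : ∃ (c : ℂ) (k : TangentSpace (𝓡 (2 * m)) x), c ≠ 0 ∧ k ≠ 0 ∧ l = c • (1 ⊗ₜ[ℝ] k) := by
    by_cases h0 : cre l = 0
    · refine ⟨Complex.I, cim l, Complex.I_ne_zero, fun h => hl ?_, ?_⟩
      · apply ctensor_ext <;> simp [h0, h]
      · apply ctensor_ext <;> simp [h0]
    · obtain ⟨c, hc⟩ := hg.exists_smul hb ha (by rw [g.symm]; linarith) h0
      refine ⟨⟨1, c⟩, cre l, fun h => by simpa using congrArg Complex.re h, h0, ?_⟩
      apply ctensor_ext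
      · simp
      · simpa using hc
  refine ⟨?_, key⟩
  obtain ⟨c, k, hc, hk, rfl⟩ := key
  have hz' : ∀ A, φ.cval x A (1 ⊗ₜ[ℝ] k) = z * g.cval x A (1 ⊗ₜ[ℝ] k) := fun A => by
    have := hz A
    simp only [map_smul, smul_eq_mul] at this
    exact mul_left_cancel₀ hc (by rw [this]; ring)
  -- A real eigenvector equals its conjugate, so it belongs to both `z` and `conj z`.
  have hconj : cconj ((1 : ℂ) ⊗ₜ[ℝ] k) = 1 ⊗ₜ k := by apply ctensor_ext <;> simp
  have h5 := cconj_eigenvector hz'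
  rw [hconj] at h5
  exact Complex.conj_eq_iff_im.1 (eigenvalue_unique (tmul_ne_zero hk) h5 hz')

/-- The spectrum lies on the two axes. In the half-plane `re + im > 0` the key `im - re` is positive
on the imaginary axis and negative on the real one, and it is injective on each. -/
theorem PseudoRiemannianMetric.IsLorentzian.orderable (hg : g.IsLorentzian)
    (hc : ∀ x : M, (eigenvalues g φ x).ncard = 2 * m) (x : M) :
    Orderable (eigenvalues g φ x) := by
  have him : ∀ z ∈ eigenvalues g φ x, z.re ≠ 0 → z.im = 0 := by
    rintro z ⟨l, hl, hz⟩ hre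
    exact (hg.real_eigenvector hl hz hre).1
  constructor
  · intro z hz h0
    by_cases hre : z.re = 0
    · rw [hre, zero_add] at h0
      have : z = 0 := Complex.ext hre h0
      exact zero_notMem_eigenvalues (hc x) (this ▸ hz)
    · rw [him z hz hre, add_zero] at h0
      exact hre h0
  · intro z hz y hy h1 h2 h
    by_cases hz0 : z.re = 0 <;> by_cases hy0 : y.re = 0
    · rw [hz0, hy0] at h
      exact Complex.ext (by rw [hz0, hy0]) (by linarith)
    · have := him y hy hy0
      rw [this] at h h2
      rw [hz0] at h h1
      linarith
    · have := him z hz hz0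
      rw [this] at h h1
      rw [hy0] at h h2
      linarith
    · have e1 := him z hz hz0
      have e2 := him y hy hy0
      rw [e1, e2] at h
      exact Complex.ext (by linarith) (by rw [e1, e2])

/-- In Lorentzian signature there is at most one eigenvalue with positive real part. -/
theorem PseudoRiemannianMetric.IsLorentzian.pos_unique (hg : g.IsLorentzian) {z y : ℂ}
    (hz : z ∈ eigenvalues g φ x) (hy : y ∈ eigenvalues g φ x) (hz0 : 0 < z.re) (hy0 : 0 < y.re) :
    z = y := by
  obtain ⟨l, hl, hzl⟩ := hz
  obtain ⟨l', hl', hyl⟩ := hy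
  have e0 : ∀ {a b : ℂ}, 0 < a.re → 0 < b.re → a + b ≠ 0 := fun ha hb h => by
    have := congrArg Complex.re h
    simp at this
    linarith
  have e1 := eigenvector_orthogonal hzl hzl (e0 hz0 hz0)
  have e2 := eigenvector_orthogonal hyl hyl (e0 hy0 hy0)
  have e3 := eigenvector_orthogonal hzl hyl (e0 hz0 hy0)
  obtain ⟨-, c, k, hc, hk, rfl⟩ := hg.real_eigenvector hl hzl hz0.ne'
  obtain ⟨-, c', k', hc', hk', rfl⟩ := hg.real_eigenvector hl' hyl hy0.ne'
  simp only [map_smul, LinearMap.smul_apply, cval_tmul, smul_eq_mul, mul_eq_zero, hc, hc',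
    false_or, Complex.ofReal_eq_zero] at e1 e2 e3
  obtain ⟨r, rfl⟩ := hg.exists_smul e1 e2 e3 hk'
  have hr : (r : ℂ) ≠ 0 := fun h => hk (by
    rw [Complex.ofReal_eq_zero] at h; simp [h])
  refine eigenvalue_unique (g := g) (φ := φ) (tmul_ne_zero hk') (fun B => ?_) (fun B => ?_)
  · have := hzl B
    rw [one_tmul_real_smul] at this
    simp only [map_smul, smul_eq_mul] at this
    exact mul_left_cancel₀ (mul_ne_zero hc hr) (by linear_combination this)
  · have := hyl B
    simp only [map_smul, smul_eq_mul] at this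
    exact mul_left_cancel₀ hc' (by rw [this]; ring)

/-- If `t` has definite orthogonal complement, then a vector of a conformal plane has the norm
opposite in sign to that of `t`. -/
theorem norm_mul_neg {t a b : TangentSpace (𝓡 (2 * m)) x}
    (hv : ∀ v : TangentSpace (𝓡 (2 * m)) x, v ≠ 0 → g.val x t v = 0 →
      g.val x t t * g.val x v v < 0)
    (hab : g.val x a b = 0) (hn : g.val x a a = g.val x b b) (hpa : g.val x a a ≠ 0) :
    g.val x t t * g.val x a a < 0 := by
  have hba : g.val x b a = 0 := by rw [g.symm]; exact hab
  -- The vector of the plane of `a` and `b` that is orthogonal to `t`; its norm is a nonnegative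
  -- multiple of that of `a`. If it is zero, `a` itself is orthogonal to `t`.
  have hcc : g.val x (g.val x t b • a - g.val x t a • b) (g.val x t b • a - g.val x t a • b)
      = (g.val x t b ^ 2 + g.val x t a ^ 2) * g.val x a a := by
    simp [hab, hba]
    linear_combination -(g.val x t a) ^ 2 * hn
  by_cases h0 : g.val x t b • a - g.val x t a • b = 0
  · rw [h0] at hcc
    have h4 : g.val x t b ^ 2 + g.val x t a ^ 2 = 0 := by
      have : (g.val x t b ^ 2 + g.val x t a ^ 2) * g.val x a a = 0 := by rw [← hcc]; simp
      exact (mul_eq_zero.1 this).resolve_right hpa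
    have h5 : g.val x t a = 0 := by nlinarith [sq_nonneg (g.val x t b), sq_nonneg (g.val x t a)]
    exact hv a (fun h => hpa (by simp [h])) h5
  · have h4 := hv _ h0 (by simp; ring)
    rw [hcc] at h4
    have h5 : 0 ≤ g.val x t b ^ 2 + g.val x t a ^ 2 := by positivity
    by_contra h6
    push Not at h6
    nlinarith [mul_nonneg h5 h6]

/-- For imaginary `lam μ` the conjugate of `w μ` has eigenvalue `conj (lam μ) = -lam μ`, so it lies
on the line of `v μ`; the coefficient is `g(w μ, conj (w μ))`. -/
theorem NullEigen.cconj_w (hc : (eigenvalues g φ x).ncard = 2 * m)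
    {v w : Fin m → ℂ ⊗[ℝ] TangentSpace (𝓡 (2 * m)) x} {lam : Fin m → ℂ}
    (h : NullEigen (g.cval x) (φ.cval x) v w lam) {μ : Fin m} (hre : (lam μ).re = 0) :
    cconj (w μ) = ((g.val x (cre (w μ)) (cre (w μ)) + g.val x (cim (w μ)) (cim (w μ)) : ℝ) : ℂ) •
      v μ := by
  have hB := cval_symm g x
  have hd := finrank_ctangent (n := 2 * m) x
  have h1 := h.eigenvector_v hB (φ.cval_skew x) hd hc (l := cconj (w μ)) (μ := μ) fun A => by
    rw [cconj_eigenvector fun A => h.Ω_w hB hd A μ]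
    congr 1
    apply Complex.ext <;> simp [hre]
  rw [hB, cval_cconj_self] at h1
  exact h1

/-- In terms of a null basis `V_μ, V^μ` whose pairs consist of multiples of conjugate vectors,
the norm of a real vector is a combination of squares. -/
theorem norm_eq_sum
    {v w : Fin m → ℂ ⊗[ℝ] TangentSpace (𝓡 (2 * m)) x} {lam : Fin m → ℂ}
    (h : NullEigen (g.cval x) (φ.cval x) v w lam) {r : Fin m → ℝ} (hr0 : ∀ μ, r μ ≠ 0)
    (hconj : ∀ μ, cconj (w μ) = (r μ : ℂ) • v μ) (t : TangentSpace (𝓡 (2 * m)) x) :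
    g.val x t t = 2 * ∑ μ, Complex.normSq (g.cval x (1 ⊗ₜ[ℝ] t) (w μ)) / r μ := by
  have hB := cval_symm g x
  have hexp := congrArg (g.cval x (1 ⊗ₜ[ℝ] t))
    (h.expansion hB (finrank_ctangent x) (1 ⊗ₜ[ℝ] t))
  have hconjt : cconj ((1 : ℂ) ⊗ₜ[ℝ] t) = 1 ⊗ₜ t := by apply ctensor_ext <;> simp
  have hvw : ∀ μ, g.cval x (1 ⊗ₜ[ℝ] t) (w μ) * g.cval x (1 ⊗ₜ[ℝ] t) (v μ)
      = ((Complex.normSq (g.cval x (1 ⊗ₜ[ℝ] t) (w μ)) / r μ : ℝ) : ℂ) := fun μ => by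
    have h1 : (r μ : ℂ) * g.cval x (1 ⊗ₜ[ℝ] t) (v μ)
        = (starRingEnd ℂ) (g.cval x (1 ⊗ₜ[ℝ] t) (w μ)) := by
      rw [← cval_cconj, hconjt, hconj, map_smul, smul_eq_mul]
    have h2 : (r μ : ℂ) ≠ 0 := Complex.ofReal_ne_zero.2 (hr0 μ)
    rw [Complex.ofReal_div, eq_div_iff h2, ← Complex.mul_conj, ← h1]
    ring
  simp only [map_add, map_sum, map_smul, smul_eq_mul, cval_tmul,
    mul_comm (g.cval x (1 ⊗ₜ[ℝ] t) (v _)), hvw, ← Complex.ofReal_sum, ← Complex.ofReal_add,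
    Complex.ofReal_inj] at hexp
  rw [hexp]
  ring

/-- In Lorentzian signature there is an eigenvalue that is not imaginary. -/
theorem PseudoRiemannianMetric.IsLorentzian.exists_re_ne_zero (hg : g.IsLorentzian)
    (hc : (eigenvalues g φ x).ncard = 2 * m)
    {v w : Fin m → ℂ ⊗[ℝ] TangentSpace (𝓡 (2 * m)) x} {lam : Fin m → ℂ}
    (h : NullEigen (g.cval x) (φ.cval x) v w lam) : ∃ μ, (lam μ).re ≠ 0 := by
  by_contra! hre
  obtain ⟨t, ht, hv⟩ := hg x
  have hconj := fun μ => h.cconj_w hc (hre μ)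
  have hr0 : ∀ μ, g.val x (cre (w μ)) (cre (w μ)) + g.val x (cim (w μ)) (cim (w μ)) ≠ 0 :=
    fun μ h0 => (h.linearIndependent (cval_symm g x)).ne_zero (Sum.inr μ) (by
      have := hconj μ
      rw [h0, Complex.ofReal_zero, zero_smul] at this
      rw [Sum.elim_inr, ← cconj_cconj (w μ), this]
      apply ctensor_ext <;> simp)
  -- The real and imaginary parts of the null vector `w μ` are orthogonal of equal norm. All the
  -- coefficients thus have the sign opposite to `g(t, t)`, so the sum of squares for `g(t, t)`
  -- gives `g(t, t)^2 ≤ 0`.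
  have hsign : ∀ μ, g.val x t t *
      (g.val x (cre (w μ)) (cre (w μ)) + g.val x (cim (w μ)) (cim (w μ))) < 0 := fun μ => by
    have h1 := h.ww μ μ
    rw [cval_eq] at h1
    have h2 := congrArg Complex.re h1
    have h3 := congrArg Complex.im h1
    have hs := g.symm x (cim (w μ)) (cre (w μ))
    simp [hs] at h2 h3
    have hp := hr0 μ
    have := norm_mul_neg hv (a := cre (w μ)) (b := cim (w μ)) (by linarith) (by linarith)
      fun h => hp (by linarith)
    rw [← sub_eq_zero.1 h2, mul_add]
    linarith
  have hsum := norm_eq_sum h hr0 hconj t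
  have hle : g.val x t t * ∑ μ, Complex.normSq (g.cval x (1 ⊗ₜ[ℝ] t) (w μ)) /
      (g.val x (cre (w μ)) (cre (w μ)) + g.val x (cim (w μ)) (cim (w μ))) ≤ 0 := by
    rw [Finset.mul_sum]
    refine Finset.sum_nonpos fun μ _ => ?_
    have h1 : ∀ {a r : ℝ}, a * r < 0 → a / r ≤ 0 := fun {a r} h => by
      rw [div_nonpos_iff]
      rcases mul_neg_iff.1 h with h | h
      · exact Or.inl ⟨h.1.le, h.2.le⟩
      · exact Or.inr ⟨h.1.le, h.2.le⟩
    rw [mul_div_left_comm]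
    exact mul_nonpos_of_nonneg_of_nonpos (Complex.normSq_nonneg _) (h1 (hsign μ))
  have hpos : 0 < g.val x t t * g.val x t t := mul_self_pos.2 ht
  have h2 := congrArg (g.val x t t * ·) hsum
  rw [mul_left_comm] at h2
  linarith

theorem NullEigen.lam_mem {v w : Fin m → ℂ ⊗[ℝ] TangentSpace (𝓡 (2 * m)) x} {lam : Fin m → ℂ}
    (h : NullEigen (g.cval x) (φ.cval x) v w lam) (μ : Fin m) : lam μ ∈ eigenvalues g φ x := by
  rw [← evs_eq_eigenvalues, h.evs_eq (cval_symm g x) (φ.cval_skew x) (finrank_ctangent x)]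
  exact ⟨Sum.inl μ, rfl⟩

theorem NullEigen.neg_lam_mem {v w : Fin m → ℂ ⊗[ℝ] TangentSpace (𝓡 (2 * m)) x} {lam : Fin m → ℂ}
    (h : NullEigen (g.cval x) (φ.cval x) v w lam) (μ : Fin m) : -lam μ ∈ eigenvalues g φ x := by
  rw [← evs_eq_eigenvalues, h.evs_eq (cval_symm g x) (φ.cval_skew x) (finrank_ctangent x)]
  exact ⟨Sum.inr μ, rfl⟩

theorem PseudoRiemannianMetric.IsLorentzian.exists_pos (hg : g.IsLorentzian)
    (hc : (eigenvalues g φ x).ncard = 2 * m) :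
    ∃ r : ℝ, 0 < r ∧ (r : ℂ) ∈ eigenvalues g φ x := by
  obtain ⟨v, w, lam, h⟩ := exists_eigenbasis_at hc
  obtain ⟨μ, hμ⟩ := hg.exists_re_ne_zero hc h
  have key : ∀ z ∈ eigenvalues g φ x, 0 < z.re →
      ∃ r : ℝ, 0 < r ∧ (r : ℂ) ∈ eigenvalues g φ x := by
    intro z hz hre
    refine ⟨z.re, hre, ?_⟩
    obtain ⟨l, hl, hzl⟩ := id hz
    have : z = z.re := Complex.ext (by simp) (by
      simpa using (hg.real_eigenvector hl hzl hre.ne').1)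
    rwa [← this]
  rcases lt_or_gt_of_ne hμ with h1 | h1
  · exact key _ (h.neg_lam_mem μ) (by simpa using h1)
  · exact key _ (h.lam_mem μ) h1

/-- The real eigenvectors of `φ` with the real eigenvalue `ρ`. -/
def eigenline (g : PseudoRiemannianMetric (2 * m) M) (φ : TwoForm (2 * m) M) (x : M) (ρ : ℝ) :
    Submodule ℝ (TangentSpace (𝓡 (2 * m)) x) where
  carrier := {k | ∀ A, φ.cval x A (1 ⊗ₜ[ℝ] k) = ρ * g.cval x A (1 ⊗ₜ[ℝ] k)}
  zero_mem' := by simp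
  add_mem' := fun ha hb A => by
    rw [TensorProduct.tmul_add, map_add, map_add, ha A, hb A]; ring
  smul_mem' := fun c k hk A => by
    rw [one_tmul_real_smul, map_smul, map_smul, hk A]; simp only [smul_eq_mul]; ring

theorem mem_eigenline {ρ : ℝ} {k : TangentSpace (𝓡 (2 * m)) x} :
    k ∈ eigenline g φ x ρ ↔ ∀ A, φ.cval x A (1 ⊗ₜ[ℝ] k) = ρ * g.cval x A (1 ⊗ₜ[ℝ] k) := Iff.rfl

theorem eigenline_orthogonal {ρ : ℝ} (hρ : ρ ≠ 0) {k l : TangentSpace (𝓡 (2 * m)) x}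
    (hk : k ∈ eigenline g φ x ρ) (hl : l ∈ eigenline g φ x ρ) : g.val x k l = 0 := by
  have h := eigenvector_orthogonal hk hl (by
    rw [← Complex.ofReal_add, Complex.ofReal_ne_zero]
    intro h; apply hρ; linarith)
  rwa [cval_tmul, Complex.ofReal_eq_zero] at h

theorem PseudoRiemannianMetric.IsLorentzian.eigenline_eq_span (hg : g.IsLorentzian) {ρ : ℝ}
    (hρ : ρ ≠ 0) {k : TangentSpace (𝓡 (2 * m)) x} (hk : k ∈ eigenline g φ x ρ) (hk0 : k ≠ 0) :
    eigenline g φ x ρ = Submodule.span ℝ {k} := by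
  apply le_antisymm
  · intro l hl
    obtain ⟨c, rfl⟩ := hg.exists_smul (eigenline_orthogonal hρ hl hl)
      (eigenline_orthogonal hρ hk hk) (eigenline_orthogonal hρ hl hk) hk0
    exact Submodule.smul_mem _ _ (Submodule.mem_span_singleton_self k)
  · rw [Submodule.span_singleton_le_iff_mem]
    exact hk

/-- The real vectors in an isotropic `D` are null and mutually orthogonal, hence proportional.
Containing one point of the line therefore forces equality. -/
theorem PseudoRiemannianMetric.IsLorentzian.realPoints_eq_iff (hg : g.IsLorentzian) {ρ : ℝ}
    (hρ : ρ ≠ 0) {k : TangentSpace (𝓡 (2 * m)) x} (hk : k ∈ eigenline g φ x ρ) (hk0 : k ≠ 0)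
    {D : Submodule ℂ (ℂ ⊗[ℝ] TangentSpace (𝓡 (2 * m)) x)}
    (hD : ∀ A ∈ D, ∀ B ∈ D, g.cval x A B = 0) :
    realPoints D = eigenline g φ x ρ ↔ (1 : ℂ) ⊗ₜ[ℝ] k ∈ D := by
  constructor
  · intro h
    rw [← h] at hk
    exact hk
  · intro h
    rw [hg.eigenline_eq_span hρ hk hk0]
    apply le_antisymm
    · intro l hl
      have hz : ∀ a b : TangentSpace (𝓡 (2 * m)) x, (1 : ℂ) ⊗ₜ[ℝ] a ∈ D → (1 : ℂ) ⊗ₜ[ℝ] b ∈ D →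
          g.val x a b = 0 := fun a b ha hb => by
        have := hD _ ha _ hb
        rwa [cval_tmul, Complex.ofReal_eq_zero] at this
      obtain ⟨c, rfl⟩ := hg.exists_smul (hz _ _ hl hl) (hz _ _ h h) (hz _ _ hl h) hk0
      exact Submodule.smul_mem _ _ (Submodule.mem_span_singleton_self k)
    · rw [Submodule.span_singleton_le_iff_mem]
      exact h

/-- The vector `w μ` is a complex multiple of a real vector spanning the eigenline, so the question
is whether `s` picks `w μ`. -/
theorem PseudoRiemannianMetric.IsLorentzian.realPoints_span (hg : g.IsLorentzian)
    {v w : Fin m → ℂ ⊗[ℝ] TangentSpace (𝓡 (2 * m)) x} {lam : Fin m → ℂ}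
    (h : NullEigen (g.cval x) (φ.cval x) v w lam) {μ : Fin m} {ρ : ℝ} (hρ : ρ ≠ 0)
    (hμ : lam μ = ρ) (s : Fin m → Bool) :
    realPoints (Submodule.span ℂ (range (sel v w s))) = eigenline g φ x ρ ↔ s μ = false := by
  have hB := cval_symm g x
  have hw := fun A => h.Ω_w hB (finrank_ctangent x) A μ
  have hw0 : w μ ≠ 0 := (h.linearIndependent hB).ne_zero (Sum.inr μ)
  rw [← h.w_mem_iff hB s μ]
  obtain ⟨-, c, k, hc, hk, hwk⟩ := hg.real_eigenvector hw0 hw (by rw [hμ]; simpa using hρ)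
  rw [hg.realPoints_eq_iff hρ (k := k) ?_ hk fun A hA B hB' => h.isotropic hB s hA hB', hwk,
    Submodule.smul_mem_iff _ hc]
  intro A
  have := hw A
  rw [hwk, hμ] at this
  simp only [map_smul, smul_eq_mul] at this
  exact mul_left_cancel₀ hc (by rw [this]; ring)

end LorentzPointwise

/-! ### The two null line fields: smoothness, counting, and constancy on connected sets. -/

section PrincipalLines

/-- The remaining `m - 1` choices are free; the index `μ` ensures `m ≥ 1`, so the subtraction is not
truncated. -/
theorem ncard_apply_eq {m : ℕ} (μ : Fin m) (c : Bool) :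
    {s : Fin m → Bool | s μ = c}.ncard = 2 ^ (m - 1) := by
  classical
  have h : {s : Fin m → Bool | s μ = c} =
      ↑(Fintype.piFinset fun ν : Fin m => if ν = μ then {c} else (Finset.univ : Finset Bool)) := by
    ext s
    simp only [mem_ofPred_eq, Finset.mem_coe, Fintype.mem_piFinset]
    constructor
    · rintro rfl ν
      by_cases hν : ν = μ
      · subst hν; simp
      · simp [hν]
    · intro hs
      simpa using hs μ
  rw [h, Set.ncard_coe_finset, Fintype.card_piFinset, ← Finset.mul_prod_erase _ _ (Finset.mem_univ μ),
    Finset.prod_congr rfl (g := fun _ => 2) fun ν hν => by simp [Finset.ne_of_mem_erase hν]]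
  simp

variable {m : ℕ} {M : Type*} [TopologicalSpace M]
  [ChartedSpace (EuclideanSpace ℝ (Fin (2 * m))) M] [IsManifold (𝓡 (2 * m)) ∞ M]
  {g : PseudoRiemannianMetric (2 * m) M} {φ : TwoForm (2 * m) M} {x : M}

theorem neg_mem_eigenvalues (hc : (eigenvalues g φ x).ncard = 2 * m) {z : ℂ}
    (hz : z ∈ eigenvalues g φ x) : -z ∈ eigenvalues g φ x := by
  obtain ⟨u, -, hu⟩ := exists_eigenvectors (cval_nondegenerate g x) (cval_symm g x)
    (φ.cval_skew x) (finrank_ctangent x) hc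
  exact (hu z hz).1

/-- The real eigenvectors for the eigenvalues `r` and `-r`. -/
def principalLine (g : PseudoRiemannianMetric (2 * m) M) (φ : TwoForm (2 * m) M) (r : M → ℝ)
    (b : Bool) (x : M) : Submodule ℝ (TangentSpace (𝓡 (2 * m)) x) :=
  eigenline g φ x (cond b (r x) (-r x))

variable {r : M → ℝ}

theorem cond_ne_zero (hr : 0 < r x) (b : Bool) : cond b (r x) (-r x) ≠ 0 := by
  cases b
  · simpa using hr.ne'
  · exact hr.ne'

theorem cond_mem (hc : (eigenvalues g φ x).ncard = 2 * m) (hr : (r x : ℂ) ∈ eigenvalues g φ x)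
    (b : Bool) : ((cond b (r x) (-r x) : ℝ) : ℂ) ∈ eigenvalues g φ x := by
  cases b
  · simpa using neg_mem_eigenvalues hc hr
  · exact hr

theorem PseudoRiemannianMetric.IsLorentzian.eigenvalue_eq (hg : g.IsLorentzian)
    (hc : (eigenvalues g φ x).ncard = 2 * m) (hr : 0 < r x ∧ (r x : ℂ) ∈ eigenvalues g φ x)
    {z : ℂ} (hz : z ∈ eigenvalues g φ x) {b : Bool} (hb : 0 < z.re * cond b (r x) (-r x)) :
    z = (cond b (r x) (-r x) : ℝ) := by
  have hr1 := hr.1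
  cases b
  · have h1 : z.re < 0 := by
      simp only [cond_false] at hb
      nlinarith
    have := hg.pos_unique (neg_mem_eigenvalues hc hz) hr.2 (by simpa using h1) (by simpa using hr1)
    rw [cond_false, Complex.ofReal_neg, ← this, neg_neg]
  · exact hg.pos_unique hz hr.2 (pos_of_mul_pos_left hb hr1.le) (by simpa using hr1)

theorem PseudoRiemannianMetric.IsLorentzian.exists_principal (hg : g.IsLorentzian)
    (hc : (eigenvalues g φ x).ncard = 2 * m) (hr : 0 < r x ∧ (r x : ℂ) ∈ eigenvalues g φ x)
    (b : Bool) : ∃ k ∈ principalLine g φ r b x, k ≠ 0 := by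
  obtain ⟨l, hl, hz⟩ := cond_mem hc hr.2 b
  obtain ⟨-, c, k, h0, hk, rfl⟩ := hg.real_eigenvector hl hz
    (by rw [Complex.ofReal_re]; exact cond_ne_zero hr.1 b)
  refine ⟨k, fun A => ?_, hk⟩
  have := hz A
  simp only [map_smul, smul_eq_mul] at this
  exact mul_left_cancel₀ h0 (by rw [this]; ring)

theorem PseudoRiemannianMetric.IsLorentzian.principalLine_ne (hg : g.IsLorentzian)
    (hc : (eigenvalues g φ x).ncard = 2 * m) (hr : 0 < r x ∧ (r x : ℂ) ∈ eigenvalues g φ x) :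
    principalLine g φ r true x ≠ principalLine g φ r false x := by
  intro h
  obtain ⟨k, hk, h0⟩ := hg.exists_principal hc hr true
  have h1 := eigenvalue_unique (tmul_ne_zero h0) hk (mem_eigenline.1 (h ▸ hk))
  rw [Complex.ofReal_inj] at h1
  simp only [cond_true, cond_false] at h1
  linarith [hr.1]

theorem sel_swap {W : Type*} [AddCommGroup W] [Module ℂ W] (v w : Fin m → W) (s : Fin m → Bool) :
    sel w v (fun μ => !s μ) = sel v w s := by
  funext μ
  by_cases h : s μ <;> simp [sel, h]

theorem PseudoRiemannianMetric.IsLorentzian.exists_index (hg : g.IsLorentzian)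
    (hc : (eigenvalues g φ x).ncard = 2 * m) (hr : 0 < r x ∧ (r x : ℂ) ∈ eigenvalues g φ x)
    {v w : Fin m → ℂ ⊗[ℝ] TangentSpace (𝓡 (2 * m)) x} {lam : Fin m → ℂ}
    (h : NullEigen (g.cval x) (φ.cval x) v w lam) :
    ∃ μ, ∃ c : Bool, lam μ = (cond c (r x) (-r x) : ℝ) := by
  obtain ⟨μ, hμ⟩ := hg.exists_re_ne_zero hc h
  rcases lt_or_gt_of_ne hμ with h1 | h1
  · exact ⟨μ, false, hg.eigenvalue_eq hc hr (h.lam_mem μ) (by simpa using mul_neg_of_neg_of_pos h1 hr.1)⟩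
  · exact ⟨μ, true, hg.eigenvalue_eq hc hr (h.lam_mem μ) (mul_pos h1 hr.1)⟩

/-- If `b = c`, the line is that of `w μ`. Otherwise swap all `v` and `w` and complement `s`: the
spans are unchanged and `lam μ` changes sign. -/
theorem PseudoRiemannianMetric.IsLorentzian.realPoints_iff (hg : g.IsLorentzian)
    (hr : 0 < r x)
    {v w : Fin m → ℂ ⊗[ℝ] TangentSpace (𝓡 (2 * m)) x} {lam : Fin m → ℂ}
    (h : NullEigen (g.cval x) (φ.cval x) v w lam) {μ : Fin m} {c : Bool}
    (hμ : lam μ = (cond c (r x) (-r x) : ℝ)) (s : Fin m → Bool) (b : Bool) :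
    realPoints (Submodule.span ℂ (range (sel v w s))) = principalLine g φ r b x ↔
      s μ = xor c b := by
  have h1 := hg.realPoints_span h (cond_ne_zero hr c) hμ s
  have h2 := hg.realPoints_span (h.swap (cval_symm g x) (φ.cval_skew x)) (μ := μ)
    (cond_ne_zero hr (!c)) (by rw [hμ]; cases c <;> simp) (fun μ => !s μ)
  rw [sel_swap] at h2
  by_cases hbc : b = c
  · subst hbc
    rw [Bool.xor_self]
    exact h1
  · have : b = !c := by revert hbc; cases b <;> cases c <;> simp
    subst this
    rw [Bool.xor_not_self, principalLine, h2]
    simp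

/-- At each point, membership of the principal lines in the eigendistributions is decided by one
of the pairs. -/
theorem IsEigendistributionFamily.exists_realPoints_iff (hg : g.IsLorentzian)
    (hc : (eigenvalues g φ x).ncard = 2 * m) (hr : 0 < r x ∧ (r x : ℂ) ∈ eigenvalues g φ x)
    {U : Set M} {D : (Fin m → Bool) → Π x : M, Submodule ℂ (ℂ ⊗[ℝ] TangentSpace (𝓡 (2 * m)) x)}
    (hD : IsEigendistributionFamily g φ U D) (hx : x ∈ U) :
    ∃ (μ : Fin m) (c : Bool), ∀ s b,
      realPoints (D s x) = principalLine g φ r b x ↔ s μ = xor c b := by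
  obtain ⟨v, w, lam, h, hs⟩ := hD.nullEigen hx
  obtain ⟨μ, c, hμ⟩ := hg.exists_index hc hr h
  refine ⟨μ, c, fun s b => ?_⟩
  rw [hs]
  exact hg.realPoints_iff hr.1 h hμ s b

theorem IsEigendistributionFamily.ncard_realPoints (hg : g.IsLorentzian)
    (hc : (eigenvalues g φ x).ncard = 2 * m) (hr : 0 < r x ∧ (r x : ℂ) ∈ eigenvalues g φ x)
    {U : Set M} {D : (Fin m → Bool) → Π x : M, Submodule ℂ (ℂ ⊗[ℝ] TangentSpace (𝓡 (2 * m)) x)}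
    (hD : IsEigendistributionFamily g φ U D) (hx : x ∈ U) (b : Bool) :
    {s | realPoints (D s x) = principalLine g φ r b x}.ncard = 2 ^ (m - 1) := by
  obtain ⟨μ, c, h⟩ := hD.exists_realPoints_iff hg hc hr hx
  simp only [h]
  exact ncard_apply_eq μ _

theorem continuousAt_ne_zero {X : Π x : M, TangentSpace (𝓡 (2 * m)) x}
    (g : PseudoRiemannianMetric (2 * m) M) (hX : DiffFieldAt X x) (h0 : X x ≠ 0) :
    ∀ᶠ y in 𝓝 x, X y ≠ 0 := by
  obtain ⟨u, hu⟩ : ∃ u, g.val x (X x) u ≠ 0 := by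
    by_contra! h
    exact h0 (g.nondegenerate x _ h)
  have h1 := (mdiff_bilin g.contMDiff hX (FiberBundle.mdifferentiableAt_extend (𝓡 (2 * m))
    (EuclideanSpace ℝ (Fin (2 * m))) u)).continuousAt
  have h2 := h1.eventually_ne (y := 0) (by simpa using hu)
  filter_upwards [h2] with y hy h
  exact hy (by simp [h])

/-- The principal lines are smooth. -/
theorem PseudoRiemannianMetric.IsLorentzian.exists_principal_section (hg : g.IsLorentzian)
    (hc : ∀ x : M, (eigenvalues g φ x).ncard = 2 * m)
    (hr : ∀ x, 0 < r x ∧ (r x : ℂ) ∈ eigenvalues g φ x) (b : Bool) (p : M) :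
    ∃ V : Set M, IsOpen V ∧ p ∈ V ∧ ∃ k : Π x : M, TangentSpace (𝓡 (2 * m)) x,
      SmoothFieldOn k V ∧ ∀ x ∈ V, k x ≠ 0 ∧
        principalLine g φ r b x = Submodule.span ℝ {k x} := by
  have hw : ∃ (v w : Fin m → ℂ ⊗[ℝ] TangentSpace (𝓡 (2 * m)) p) (lam : Fin m → ℂ) (μ : Fin m),
      NullEigen (g.cval p) (φ.cval p) v w lam ∧ lam μ = (cond b (r p) (-r p) : ℝ) := by
    obtain ⟨v, w, lam, h⟩ := exists_eigenbasis_at (hc p)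
    obtain ⟨μ, c, hμ⟩ := hg.exists_index (hc p) (hr p) h
    by_cases hbc : b = c
    · exact ⟨v, w, lam, μ, h, hbc ▸ hμ⟩
    · refine ⟨w, v, _, μ, h.swap (cval_symm g p) (φ.cval_skew p), ?_⟩
      rw [hμ]
      revert hbc
      cases b <;> cases c <;> simp
  obtain ⟨v, w, lam, μ, h, hμ⟩ := hw
  have hB := cval_symm g p
  have hw := fun A => h.Ω_w hB (finrank_ctangent p) A μ
  obtain ⟨-, c, k, h0, hk, hwk⟩ := hg.real_eigenvector
    (l := w μ) ((h.linearIndependent hB).ne_zero (Sum.inr μ)) hw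
    (by rw [hμ, Complex.ofReal_re]; exact cond_ne_zero (hr p).1 b)
  obtain ⟨U, hU, hpU, Z, Λ, hZ, hΛ, hZp, hΛp, hZΛ⟩ := h.exists_local_eigenpair (hc p) μ
  have hX : SmoothFieldOn (fun x => cre (c⁻¹ • Z x)) U := (SmoothCFieldOn.const_smul c⁻¹ hZ).1
  have hXp : cre (c⁻¹ • Z p) = k := by
    rw [hZp, hwk, smul_smul, inv_mul_cancel₀ h0, one_smul]
    simp
  have e1 : ∀ᶠ x in 𝓝 p, cre (c⁻¹ • Z x) ≠ 0 :=
    continuousAt_ne_zero g (hX.diffAt hU hpU) (by rw [hXp]; exact hk)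
  -- Only the sign of `re Λ` has to persist near `p`. Uniqueness of the eigenvalue with that sign
  -- then identifies `Λ` with `±r`, so continuity of the pointwise chosen `r` is not needed.
  have e2 : ∀ᶠ x in 𝓝 p, 0 < (Λ x).re * cond b 1 (-1) := by
    have h1 : ContinuousAt (fun x => (Λ x).re * (cond b 1 (-1) : ℝ)) p :=
      (Complex.continuous_re.continuousAt.comp (hΛ.continuousOn.continuousAt
        (hU.mem_nhds hpU))).mul continuousAt_const
    refine h1.eventually_const_lt ?_
    simp only [hΛp, hμ, Complex.ofReal_re]
    cases b <;> simpa using (hr p).1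
  obtain ⟨V, hV, hVo, hpV⟩ := eventually_nhds_iff.1 ((e1.and e2).and (hU.mem_nhds hpU))
  refine ⟨V, hVo, hpV, _, hX.mono fun x hx => (hV x hx).2, fun x hx => ?_⟩
  obtain ⟨⟨hx1, hx2⟩, hxU⟩ := hV x hx
  refine ⟨hx1, hg.eigenline_eq_span (cond_ne_zero (hr x).1 b) ?_ hx1⟩
  have hZ0 : c⁻¹ • Z x ≠ 0 := fun h => hx1 (by rw [h, map_zero])
  have hZ1 : ∀ A, φ.cval x A (c⁻¹ • Z x) = Λ x * g.cval x A (c⁻¹ • Z x) := fun A => by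
    simp only [map_smul, smul_eq_mul, hZΛ x hxU A]
    ring
  have hΛx : Λ x = (cond b (r x) (-r x) : ℝ) := by
    refine hg.eigenvalue_eq (hc x) (hr x) ⟨_, hZ0, hZ1⟩ ?_
    have := mul_pos hx2 (hr x).1
    revert this
    cases b <;> simp
  obtain ⟨-, d, l, hd, -, hl⟩ := hg.real_eigenvector hZ0 hZ1
    (by rw [hΛx, Complex.ofReal_re]; exact cond_ne_zero (hr x).1 b)
  -- Away from `p` the eigenvector field is only a complex multiple of a real vector; its real part
  -- is still a multiple of that vector.
  have hcre : cre (c⁻¹ • Z x) = d.re • l := by rw [hl]; simp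
  rw [hcre]
  refine Submodule.smul_mem _ _ fun A => ?_
  have := hZ1 A
  rw [hl, hΛx] at this
  simp only [map_smul, smul_eq_mul] at this
  exact mul_left_cancel₀ hd (by rw [this]; ring)

/-- The complexified connection applied to real fields also contains derivatives of and along their
zero imaginary parts. -/
theorem leviCivita_zero_right (g : PseudoRiemannianMetric (2 * m) M)
    {X : Π x : M, TangentSpace (𝓡 (2 * m)) x} (hX : DiffFieldAt X x) :
    leviCivita g X (fun _ => 0) x = 0 := by
  have h0 : DiffFieldAt (fun _ => 0 : Π x : M, TangentSpace (𝓡 (2 * m)) x) x :=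
    smoothFieldOn_zero.diffAt isOpen_univ (mem_univ x)
  refine (leviCivita_unique g hX h0 0 fun Z hZ => ?_).symm
  have hz : (fun _ => 0 : Π x : M, TangentSpace (𝓡 (2 * m)) x) = 0 := rfl
  simp only [koszul, map_zero, zero_apply, hz, Pi.zero_apply, dirDeriv,
    VectorField.mlieBracket_zero_right, VectorField.mlieBracket_zero_left, mvfderiv_const]
  simp

theorem leviCivita_zero_left (g : PseudoRiemannianMetric (2 * m) M)
    {X : Π x : M, TangentSpace (𝓡 (2 * m)) x} (hX : DiffFieldAt X x) :
    leviCivita g (fun _ => 0) X x = 0 := by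
  have h0 : DiffFieldAt (fun _ => 0 : Π x : M, TangentSpace (𝓡 (2 * m)) x) x :=
    smoothFieldOn_zero.diffAt isOpen_univ (mem_univ x)
  have h1 := leviCivita_torsion g h0 hX
  have hz : (fun _ => 0 : Π x : M, TangentSpace (𝓡 (2 * m)) x) = 0 := rfl
  rw [leviCivita_zero_right g hX, sub_zero, hz, VectorField.mlieBracket_zero_left] at h1
  exact h1.symm

/-- A real section of an eigendistribution has its covariant derivative along itself there. -/
theorem IsEigendistributionFamily.leviCivita_mem
    (hφ : IsConformalKillingYano g φ) (hc : ∀ x : M, (eigenvalues g φ x).ncard = 2 * m)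
    (hT : ∀ (x : M) (v w : Fin m → ℂ ⊗[ℝ] TangentSpace (𝓡 (2 * m)) x) (lam : Fin m → ℂ),
      IsNullEigenbasis g φ x v w lam → TauComponentsVanish φ x v w)
    {U : Set M} {D : (Fin m → Bool) → Π x : M, Submodule ℂ (ℂ ⊗[ℝ] TangentSpace (𝓡 (2 * m)) x)}
    (hD : IsEigendistributionFamily g φ U D) (s : Fin m → Bool) {V : Set M} (hV : IsOpen V)
    (hVU : V ⊆ U) {k : Π x : M, TangentSpace (𝓡 (2 * m)) x} (hk : SmoothFieldOn k V)
    (hkD : ∀ y ∈ V, k y ∈ realPoints (D s y)) (hx : x ∈ V) :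
    leviCivita g k k x ∈ realPoints (D s x) := by
  have h1 := hD.cnabla_mem hφ hc hT s hV hVU (smoothCFieldOn_tmul hk) (smoothCFieldOn_tmul hk)
    hkD hkD hx
  have hkx := hk.diffAt hV hx
  have h2 : cnabla g (fun y => (1 : ℂ) ⊗ₜ[ℝ] k y) (fun y => (1 : ℂ) ⊗ₜ[ℝ] k y) x =
      (1 : ℂ) ⊗ₜ[ℝ] leviCivita g k k x := by
    have hz : DiffFieldAt (fun _ => 0 : Π x : M, TangentSpace (𝓡 (2 * m)) x) x :=
      smoothFieldOn_zero.diffAt isOpen_univ (mem_univ x)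
    simp only [cnabla, cre_tmul, cim_tmul, Complex.one_re, Complex.one_im, one_smul, zero_smul,
      leviCivita_zero_right g hkx, leviCivita_zero_left g hkx, leviCivita_zero_right g hz]
    apply ctensor_ext <;> simp
  rw [h2] at h1
  exact h1

/-- Each `D s x` contains exactly one of the two lines. Omitting a given line is an open condition,
so containing it is both open and closed in `U`. -/
theorem IsEigendistributionFamily.realPoints_constant (hg : g.IsLorentzian)
    (hc : ∀ x : M, (eigenvalues g φ x).ncard = 2 * m)
    (hr : ∀ x, 0 < r x ∧ (r x : ℂ) ∈ eigenvalues g φ x)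
    {U : Set M} {D : (Fin m → Bool) → Π x : M, Submodule ℂ (ℂ ⊗[ℝ] TangentSpace (𝓡 (2 * m)) x)}
    (hD : IsEigendistributionFamily g φ U D) (hU : IsPreconnected U) (s : Fin m → Bool) (b : Bool)
    {y : M} (hx : x ∈ U) (hy : y ∈ U) (h : realPoints (D s x) = principalLine g φ r b x) :
    realPoints (D s y) = principalLine g φ r b y := by
  classical
  have hdich : ∀ x ∈ U, ∀ b, realPoints (D s x) = principalLine g φ r b x ↔
      ¬ realPoints (D s x) = principalLine g φ r (!b) x := fun x hx b => by
    obtain ⟨μ, c, hμ⟩ := hD.exists_realPoints_iff hg (hc x) (hr x) hx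
    rw [hμ, hμ]
    cases s μ <;> cases b <;> cases c <;> decide
  have hopen : ∀ x ∈ U, ∀ b, ¬ realPoints (D s x) = principalLine g φ r b x →
      ∀ᶠ y in 𝓝[U] x, ¬ realPoints (D s y) = principalLine g φ r b y := by
    intro x hx b hne
    obtain ⟨V, hV, hxV, k, hk, hkV⟩ := hg.exists_principal_section hc hr b x
    have hmem : ∀ y ∈ V, k y ∈ principalLine g φ r b y := fun y hy => by
      rw [(hkV y hy).2]; exact Submodule.mem_span_singleton_self _
    -- As `D` is its own orthogonal complement, an omitted `k x` has nonzero product with some `B ∈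
    -- D`; extended to sections, the product stays nonzero nearby.
    obtain ⟨B, hB, hkB⟩ : ∃ B ∈ D s x, g.cval x (1 ⊗ₜ[ℝ] k x) B ≠ 0 := by
      by_contra! hall
      exact hne ((hg.realPoints_eq_iff (cond_ne_zero (hr x).1 b) (hmem x hxV) (hkV x hxV).1
        (hD.isotropic s x hx)).2 (hD.mem_of_orthogonal s hx hall))
    obtain ⟨V', hV', hxV', hV'U, Z, hZ, hZD, rfl⟩ := (hD.1 s).exists_extension hx hB
    have hcont := (smooth_cval g (smoothCFieldOn_tmul (hk.mono inter_subset_left))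
      (hZ.mono inter_subset_right)).continuousOn.continuousAt
      ((hV.inter hV').mem_nhds ⟨hxV, hxV'⟩)
    filter_upwards [nhdsWithin_le_nhds (hcont.eventually_ne hkB),
      nhdsWithin_le_nhds ((hV.inter hV').mem_nhds ⟨hxV, hxV'⟩)] with y hy hyV heq
    have hky := hmem y hyV.1
    rw [← heq] at hky
    exact hy (hD.isotropic s y (hV'U hyV.2) _ hky _ (hZD y hyV.2))
  have hcont : ContinuousOn (fun x => decide (realPoints (D s x) = principalLine g φ r b x)) U := by
    intro x hx
    refine ContinuousWithinAt.congr_of_eventuallyEq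
      (f := fun _ => decide (realPoints (D s x) = principalLine g φ r b x))
      continuousWithinAt_const ?_ rfl
    by_cases h0 : realPoints (D s x) = principalLine g φ r b x
    · filter_upwards [hopen x hx _ ((hdich x hx b).1 h0), self_mem_nhdsWithin] with y hy hyU
      simp [h0, (hdich y hyU b).2 hy]
    · filter_upwards [hopen x hx _ h0] with y hy
      simp [h0, hy]
  have := hU.constant hcont hx hy
  simp only [decide_eq_decide] at this
  exact this.1 h

end PrincipalLines

/-! ### Global Lorentzian families and geodesy. -/

section Main

variable {m : ℕ} {M : Type*} [TopologicalSpace M]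
  [ChartedSpace (EuclideanSpace ℝ (Fin (2 * m))) M] [IsManifold (𝓡 (2 * m)) ∞ M]
  {g : PseudoRiemannianMetric (2 * m) M} {φ : TwoForm (2 * m) M} {r : M → ℝ}

/-- In an ordered null eigenbasis the real eigenvalue comes first. -/
theorem PseudoRiemannianMetric.IsLorentzian.lam_zero (hg : g.IsLorentzian) {x : M}
    (hc : (eigenvalues g φ x).ncard = 2 * m) (hr : 0 < r x ∧ (r x : ℂ) ∈ eigenvalues g φ x)
    {v w : Fin m → ℂ ⊗[ℝ] TangentSpace (𝓡 (2 * m)) x} {lam : Fin m → ℂ}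
    (h : NullEigen (g.cval x) (φ.cval x) v w lam) (ho : Ordered lam) {μ : Fin m}
    (hμ0 : ∀ ν, μ ≤ ν) : lam μ = r x := by
  obtain ⟨ν, c, hν⟩ := hg.exists_index hc hr h
  have h1 := ho.1 ν
  have hct : c = true := by
    cases c
    · rw [hν] at h1
      simp at h1
      linarith [hr.1]
    · rfl
  subst hct
  rw [cond_true] at hν
  rcases (hμ0 ν).eq_or_lt with h2 | h2
  · rw [h2, hν]
  -- The first key lies below `-r x < 0`, and with `re + im > 0` this forces a positive real part.
  · have h3 := ho.2 h2
    have h4 := ho.1 μ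
    simp only [hν, Complex.ofReal_im, Complex.ofReal_re] at h3
    exact hg.pos_unique (h.lam_mem μ) hr.2 (by linarith [hr.1]) (by simpa using hr.1)

/-- The normalised enumeration puts `r x` at index `0` at every point, so the same choices `s` serve
all of `M`, connected or not. -/
theorem PseudoRiemannianMetric.IsLorentzian.exists_family (hg : g.IsLorentzian) [Nonempty M]
    (hc : ∀ x : M, (eigenvalues g φ x).ncard = 2 * m)
    (hr : ∀ x, 0 < r x ∧ (r x : ℂ) ∈ eigenvalues g φ x) :
    ∃ D, IsEigendistributionFamily g φ univ D ∧ ∃ μ : Fin m, ∀ s x b,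
      realPoints (D s x) = principalLine g φ r b x ↔ s μ = !b := by
  obtain ⟨v, w, lam, h, hD⟩ := exists_global_family hc (hg.orderable hc)
  refine ⟨_, hD, ?_⟩
  obtain ⟨x₀⟩ := ‹Nonempty M›
  obtain ⟨ν, -⟩ := hg.exists_index (hc x₀) (hr x₀) (h x₀).1
  have : NeZero m := ⟨fun h => by subst h; exact ν.elim0⟩
  refine ⟨0, fun s x b => ?_⟩
  rw [hg.realPoints_iff (hr x).1 (h x).1 (c := true)
    (hg.lam_zero (hc x) (hr x) (h x).1 (h x).2 Fin.zero_le), Bool.true_xor]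

/-- Each line field consists of the real points of one global eigendistribution, which is parallel
along itself; hence `∇_k k` is a real point of it again. -/
theorem PseudoRiemannianMetric.IsLorentzian.isGeodesicNullCongruence (hg : g.IsLorentzian)
    [Nonempty M] (hφ : IsConformalKillingYano g φ)
    (hc : ∀ x : M, (eigenvalues g φ x).ncard = 2 * m)
    (hT : ∀ (x : M) (v w : Fin m → ℂ ⊗[ℝ] TangentSpace (𝓡 (2 * m)) x) (lam : Fin m → ℂ),
      IsNullEigenbasis g φ x v w lam → TauComponentsVanish φ x v w)
    (hr : ∀ x, 0 < r x ∧ (r x : ℂ) ∈ eigenvalues g φ x) (b : Bool) :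
    IsGeodesicNullCongruence g (principalLine g φ r b) where
  smooth := hg.exists_principal_section hc hr b
  null := fun x _ hk => eigenline_orthogonal (cond_ne_zero (hr x).1 b) hk hk
  geodesic := by
    intro V hV k hk hkL x hx
    obtain ⟨D, hD, μ, hμ⟩ := hg.exists_family hc hr
    have hs := fun y => (hμ (fun _ => !b) y b).2 rfl
    rw [← hs]
    exact hD.leviCivita_mem hφ hc hT _ hV (subset_univ V) hk
      (fun y hy => by rw [hs]; exact hkL y hy) hx

end Main

end CKY

end

theorem theorem1 {m : ℕ} {M : Type*} [TopologicalSpace M] [Nonempty M]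
    [ChartedSpace (EuclideanSpace ℝ (Fin (2 * m))) M] [IsManifold (𝓡 (2 * m)) ∞ M]
    (g : CKY.PseudoRiemannianMetric (2 * m) M) (φ : CKY.TwoForm (2 * m) M)
    (hφ : CKY.IsConformalKillingYano g φ)
    -- `2m` distinct eigenvalues, so `φ` is diagonalisable; they come in pairs `±z`, so none is `0`
    (hdist : ∀ x : M, (CKY.eigenvalues g φ x).ncard = 2 * m) :
    -- the `2^m` distributions exist, as smooth distributions near each point
    (∀ p : M, ∃ U : Set M, IsOpen U ∧ p ∈ U ∧ ∃ D, CKY.IsEigendistributionFamily g φ U D) ∧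
    -- the condition on `τ = dφ` holds if `θ^μ ∧ τ (V^μ, ·, ·) = 0 = θ_μ ∧ τ (V_μ, ·, ·)` for all
    -- `μ`, if `φ` is closed, and in dimension four
    (∀ (x : M) (v w : Fin m → ℂ ⊗[ℝ] TangentSpace (𝓡 (2 * m)) x) (lam : Fin m → ℂ),
      CKY.IsNullEigenbasis g φ x v w lam →
        (((∀ μ, CKY.WedgeContractionVanish g φ x (w μ) ∧ CKY.WedgeContractionVanish g φ x (v μ)) ∨
            (∀ a b c, CKY.extDeriv φ x a b c = 0) ∨ m = 2) →
          CKY.TauComponentsVanish φ x v w)) ∧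
    -- under the condition on `τ`, the distributions are integrable
    ((∀ (x : M) (v w : Fin m → ℂ ⊗[ℝ] TangentSpace (𝓡 (2 * m)) x) (lam : Fin m → ℂ),
      CKY.IsNullEigenbasis g φ x v w lam → CKY.TauComponentsVanish φ x v w) →
      (∀ U : Set M, IsOpen U → ∀ D, CKY.IsEigendistributionFamily g φ U D →
        (∀ x ∈ U, Function.Injective fun s => D s x) ∧
        (∀ s, ∀ x ∈ U, finrank ℂ (D s x) = m ∧ ∀ A ∈ D s x, ∀ B ∈ D s x, g.cval x A B = 0) ∧
        (∀ s, CKY.IsIntegrable (D s) U)) ∧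
      -- Euclidean signature: `2^m` distinct Hermitian structures on `M`, and on each open set `U`
      -- carrying the distributions, which are the `(1,0)`-tangent spaces of the structures
      (g.IsRiemannian →
        (∃ D, CKY.IsEigendistributionFamily g φ univ D) ∧
        ∀ U : Set M, IsOpen U → ∀ D, CKY.IsEigendistributionFamily g φ U D →
          ∃ J : (Fin m → Bool) →
              Π x : M, TangentSpace (𝓡 (2 * m)) x →ₗ[ℝ] TangentSpace (𝓡 (2 * m)) x,
            (∀ s, CKY.IsHermitianStructure g (J s) U) ∧
            (∀ s, ∀ x ∈ U, D s x = Module.End.eigenspace ((J s x).baseChange ℂ) Complex.I) ∧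
            (∀ x ∈ U, Function.Injective fun s => J s x)) ∧
      -- Lorentzian signature: two geodesic null congruences, each from `2^(m-1)` distributions
      (g.IsLorentzian →
        ∃ L : Bool → Π x : M, Submodule ℝ (TangentSpace (𝓡 (2 * m)) x),
          (∀ b, CKY.IsGeodesicNullCongruence g (L b)) ∧
          (∀ x, L true x ≠ L false x) ∧
          (∃ D, CKY.IsEigendistributionFamily g φ univ D ∧
            ∀ b, {s | ∀ x, CKY.realPoints (D s x) = L b x}.ncard = 2 ^ (m - 1)) ∧
          (∀ U : Set M, IsOpen U → ∀ D, CKY.IsEigendistributionFamily g φ U D →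
            (∀ x ∈ U, ∀ b, {s | CKY.realPoints (D s x) = L b x}.ncard = 2 ^ (m - 1)) ∧
            (IsConnected U →
              ∀ b, {s | ∀ x ∈ U, CKY.realPoints (D s x) = L b x}.ncard = 2 ^ (m - 1))))) := by
  have hr : g.IsLorentzian → ∃ r : M → ℝ, ∀ x, 0 < r x ∧ (r x : ℂ) ∈ CKY.eigenvalues g φ x :=
    fun hg => ⟨_, fun x => (hg.exists_pos (hdist x)).choose_spec⟩
  refine ⟨CKY.exists_local_family hdist, fun x v w lam h => CKY.tauComponentsVanish_of h.nullEigen,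
    fun hT => ⟨fun U hU D hD => ⟨fun x hx => hD.injective hx, fun s x hx =>
      ⟨hD.finrank hx s, hD.isotropic s x hx⟩, fun s => hD.isIntegrable hφ hdist hT s⟩,
      fun hg => ?_, fun hg => ?_⟩⟩
  · obtain ⟨v, w, lam, -, hD⟩ := CKY.exists_global_family hdist (hg.orderable hdist)
    exact ⟨⟨_, hD⟩, fun U hU D hD =>
      hD.exists_hermitian (fun s => hD.isIntegrable hφ hdist hT s) hg⟩
  · obtain ⟨r, hr⟩ := hr hg
    refine ⟨CKY.principalLine g φ r, hg.isGeodesicNullCongruence hφ hdist hT hr,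
      fun x => hg.principalLine_ne (hdist x) (hr x), ?_, fun U hU D hD =>
        ⟨fun x hx => hD.ncard_realPoints hg (hdist x) (hr x) hx, fun hUc b => ?_⟩⟩
    · obtain ⟨D, hD, μ, hμ⟩ := hg.exists_family hdist hr
      refine ⟨D, hD, fun b => ?_⟩
      simp only [hμ, forall_const]
      exact CKY.ncard_apply_eq μ _
    · obtain ⟨x, hx⟩ := hUc.nonempty
      -- On a connected set, a choice that gives the line at one point gives it everywhere, so
      -- counting at `x` suffices.
      rw [← hD.ncard_realPoints hg (hdist x) (hr x) hx b]
      congr 1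
      ext s
      exact ⟨fun h => h x hx, fun h y hy =>
        hD.realPoints_constant hg hdist hr hUc.isPreconnected s b hx hy h⟩
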